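/- Conventions. A simplicial space is a simplicial object $X=(X_n)_{n\ge 0}$ in simplicial sets; a point of $X_n$ is a $0$-simplex of $X_n$. A map $f:K\to L$ of Kan complexes is an equivalence if it has a left and a right homotopy inverse; a commutative square $A\to B\to D$, $A\to C\to D$ of Kan complexes in which $B\to D$ or $C\to D$ is a Kan fibration is a homotopy pullback if $A\to B\times_D C$ is an equivalence. A map $p:Y\to X$ of simplicial spaces is a Reedy fibration if for every $n\ge 0$ the map $Y_n\to X_n\times_{\mathrm{Map}(\partial F(n),X)}\mathrm{Map}(\partial F(n),Y)$ is a Kan fibration, where $\partial F(n)$ is $\partial\Delta[n]$ viewed as a levelwise discrete simplicial space and $\mathrm{Map}(A,X)_l=\mathrm{Hom}(A\times\Delta[l],X)$, with $\Delta[l]$ constant in the first direction. $X$ is Reedy fibrant if the map to the point is a Reedy fibration. A complete Segal space (CSS) is a Reedy fibrant simplicial space $W$ such that $W_n\to W_1\times_{W_0}\cdots\times_{W_0}W_1$ is an equivalence for all $n\ge 2$ and $s_0:W_0\to W_{hoequiv}$ is an equivalence, where $W_{hoequiv}\subseteq W_1$ is the subspace spanned by the homotopy equivalences, i.e. the points $f:x\to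 y$ of $W_1$ for which there are $g,h:y\to x$ and composites $gf$, $fh$ (given by points of $W_2$) that are joined to $s_0x$, resp. $s_0y$, by a path in $W_1$ lying in the fiber of (source, target) over $(x,x)$, resp. $(y,y)$. Here source and target are $W_1\to W_0$ given by the vertices $0$ and $1$. Let $W$ be a CSS. Objects of $W$ are the points of $W_0$, morphisms are the points of $W_1$; $map_W(x,z)$ is the fiber of (source, target) $:W_1\to W_0\times W_0$ over $(x,z)$. For a morphism $f:x\to y$ and an object $z$, $map_W(f,z)$ is the space of $2$-cells in $W_2$ with vertices $x,y,z$ whose edge from $x$ to $y$ is $f$, and $f^*:map_W(f,z)\to map_W(x,z)$ takes such a $2$-cell to its edge from $x$ to $z$. Let $p:C\to W$ be a Reedy fibration of complete Segal spaces. A morphism $f:x\to y$ of $C$ is $p$-coCartesian if for every object $z$ of $C$ the square $$\begin{array}{ccc} map_C(f,z) & \xrightarrow{f^*} & map_C(x,z)\\ \downarrow & & \downarrow\\ map_W(pf,pz) & \xrightarrow{(pf)^*} & map_W(px,pz)\end{array}$$ is a homotopy pullback. The map $p$ is a coCartesian fibration if for every morphism $f:x\to y$ of $W$ and every object $x'$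 of $C$ with $p(x')=x$ there is a $p$-coCartesian morphism $f'$ of $C$ with source $x'$ and $p(f')=f$. A point $\sigma$ of $C_n$ is $p$-coCartesian if $\theta^*\sigma$ is a $p$-coCartesian morphism for every $\theta:[1]\to[n]$; $\mathrm{LFib}_W(C)\subseteq C$ is the simplicial subspace for which $\mathrm{LFib}_W(C)_n$ consists of the simplices of $C_n$ all of whose vertices are $p$-coCartesian. A map $q:L\to W$ of simplicial spaces is a left fibration if $L$ and $W$ are CSS, $q$ is a Reedy fibration, and the square formed by $q_1:L_1\to W_1$, $q_0:L_0\to W_0$ and the source maps $L_1\to L_0$, $W_1\to W_0$ is a homotopy pullback. Proposition. Let $p:C\to W$ be a Reedy fibration of complete Segal spaces. Then $p$ is a coCartesian fibration if and only if the composite $\mathrm{LFib}_W(C)\hookrightarrow C\xrightarrow{p}W$ is a left fibration. -/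

import Mathlib

open CategoryTheory Limits Opposite Simplicial

universe u

/-! ### Spaces (simplicial sets, and in practice Kan complexes) -/

namespace SSet

/-- A map of simplicial sets is a Kan fibration if it has the right lifting property with respect
to all horn inclusions `Λ[n, i] ⟶ Δ[n]`, `n ≥ 1`. -/
def IsKanFibration {K L : SSet.{u}} (f : K ⟶ L) : Prop :=
  modelCategoryQuillen.J.rlp f

/-- A map `f : L ⟶ K` (of Kan complexes) is an equivalence if there are maps `g, h : K ⟶ L` such
that `f ∘ g` is homotopic to the identity of `K` and `h ∘ f` is homotopic to the identity
of `L`. -/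
def IsEquivalence {L K : SSet.{u}} (f : L ⟶ K) : Prop :=
  (∃ g : K ⟶ L, Nonempty (Homotopy (g ≫ f) (𝟙 K))) ∧
    ∃ h : K ⟶ L, Nonempty (Homotopy (f ≫ h) (𝟙 L))

/-- The square with top `t : A ⟶ B`, left `l : A ⟶ C`, right `r : B ⟶ D` and bottom `b : C ⟶ D`
commutes and is a homotopy pullback square: the comparison map `A ⟶ B ×_D C` is an equivalence.
This is the right notion when all objects are Kan complexes and `r` or `b` is a Kan fibration,
which is the case wherever it is used below. -/
def IsHomotopyPullback {A B C D : SSet.{u}} (t : A ⟶ B) (l : A ⟶ C) (r : B ⟶ D) (b : C ⟶ D) :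
    Prop :=
  ∃ w : t ≫ r = l ≫ b, IsEquivalence (pullback.lift t l w)

/-- The subspace of `K` spanned by the points that satisfy `P`: it consists of the simplices all
of whose vertices satisfy `P`. -/
def fullSubcomplex (K : SSet.{u}) (P : K _⦋0⦌ → Prop) : K.Subcomplex where
  obj l := {τ | ∀ v : ⦋0⦌ ⟶ l.unop, P (K.map v.op τ)}
  map {l m} φ τ hτ v := by
    have := hτ (v ≫ φ.unop)
    rwa [op_comp, Quiver.Hom.op_unop, Functor.map_comp_apply] at this

/-- The map induced on subcomplexes by a map of simplicial sets. -/
def Subcomplex.restrictMap {K L : SSet.{u}} (φ : K ⟶ L) (A : K.Subcomplex) (B : L.Subcomplex)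
    (h : A ≤ B.preimage φ) : (A : SSet.{u}) ⟶ (B : SSet.{u}) :=
  Subcomplex.homOfLE h ≫ B.fromPreimage φ

/-- The fiber of `φ : K ⟶ L` over the point `y` of `L`. -/
def fiber {K L : SSet.{u}} (φ : K ⟶ L) (y : L _⦋0⦌) : K.Subcomplex :=
  (Subcomplex.ofSimplex y).preimage φ

lemma mem_fiber_comp {K L M : SSet.{u}} {φ : K ⟶ L} {ψ : L ⟶ M} {χ : K ⟶ M} (w : φ ≫ ψ = χ)
    {y : L _⦋0⦌} {n : SimplexCategoryᵒᵖ} {τ : K.obj n} (hτ : τ ∈ (fiber φ y).obj n) :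
    τ ∈ (fiber χ (ψ.app _ y)).obj n := by
  subst w
  obtain ⟨v, hv⟩ := hτ
  refine ⟨v, ?_⟩
  have h := NatTrans.naturality_apply ψ v y
  rw [hv] at h
  exact h.symm

end SSet

/-! ### Simplicial spaces -/

/-- A simplicial space `X` is a simplicial object in simplicial sets; `X _⦋n⦌` is the simplicial set
written `X_n`, and `(X _⦋n⦌) _⦋l⦌` is the set `X_{nl}`. -/
abbrev SimplicialSpace := SimplicialObject SSet.{u}

namespace SimplicialSpace

/-- The simplicial set `[n] ↦ X_{nl}`, for a fixed `l`. -/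
def row (X : SimplicialSpace.{u}) (l : SimplexCategoryᵒᵖ) : SSet.{u} where
  obj n := (X.obj n).obj l
  map θ := (X.map θ).app l
  map_id n := by rw [X.map_id]; rfl
  map_comp θ η := by rw [X.map_comp]; rfl

/-- The structure maps of `X` in the direction of spaces. -/
def rowMap (X : SimplicialSpace.{u}) {l m : SimplexCategoryᵒᵖ} (φ : l ⟶ m) :
    row X l ⟶ row X m where
  app n := (X.obj n).map φ
  naturality _ _ θ := ((X.map θ).naturality φ).symm

/-- The map induced on rows by a map of simplicial spaces. -/
def rowHom {X Y : SimplicialSpace.{u}} (p : X ⟶ Y) (l : SimplexCategoryᵒᵖ) :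
    row X l ⟶ row Y l where
  app n := (p.app n).app l
  naturality _ _ θ := congr_arg (fun q => q.app l) (p.naturality θ)

/-- For a simplicial set `A`, regarded as the simplicial space which is the discrete space `A_n` in
degree `n`, this is the mapping space `Map(A, X)`. An `l`-simplex of it is a map `A × Δ[l] ⟶ X` of
simplicial spaces, that is, a natural family of maps `A_n ⟶ Hom(Δ[l], X_n) = X_{nl}`. -/
def mapSpace (A : SSet.{u}) (X : SimplicialSpace.{u}) : SSet.{u} where
  obj l := A ⟶ row X l
  map φ := TypeCat.ofHom fun s => s ≫ rowMap X φ
  map_id l := by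
    ext s n a
    exact Functor.map_id_apply (X.obj n) l _
  map_comp φ ψ := by
    ext s n a
    exact Functor.map_comp_apply (X.obj n) _ _ _

/-- Restriction `Map(B, X) ⟶ Map(A, X)` along `i : A ⟶ B`. -/
def restrict {A B : SSet.{u}} (i : A ⟶ B) (X : SimplicialSpace.{u}) :
    mapSpace B X ⟶ mapSpace A X where
  app _ := TypeCat.ofHom fun s => i ≫ s
  naturality _ _ _ := by ext s; rfl

/-- The map `Map(A, X) ⟶ Map(A, Y)` induced by `p : X ⟶ Y`. -/
def postcomp (A : SSet.{u}) {X Y : SimplicialSpace.{u}} (p : X ⟶ Y) :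
    mapSpace A X ⟶ mapSpace A Y where
  app l := TypeCat.ofHom fun s => s ≫ rowHom p l
  naturality l m φ := by
    refine ConcreteCategory.hom_ext _ _ fun s => SSet.hom_ext fun n => ?_
    ext a
    exact (NatTrans.naturality_apply (p.app n) φ (s.app n a))

lemma restrict_postcomp {A B : SSet.{u}} (i : A ⟶ B) {X Y : SimplicialSpace.{u}} (p : X ⟶ Y) :
    restrict i X ≫ postcomp A p = postcomp B p ≫ restrict i Y := rfl

/-- `X` is Reedy fibrant: `Map(F(n), X) ⟶ Map(∂F(n), X)` is a Kan fibration for all `n ≥ 0`. -/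
def IsReedyFibrant (X : SimplicialSpace.{u}) : Prop :=
  ∀ n : ℕ, SSet.IsKanFibration (restrict (∂Δ[n] : (Δ[n] : SSet.{u}).Subcomplex).ι X)

/-- `p : Y ⟶ X` is a Reedy fibration: for all `n ≥ 0` the map
`Map(F(n), Y) ⟶ Map(∂F(n), Y) ×_{Map(∂F(n), X)} Map(F(n), X)` is a Kan fibration; equivalently, `p`
has the right lifting property with respect to
`∂F(n) × Δ[l] ∪ F(n) × Λ[l]_i ⟶ F(n) × Δ[l]`. -/
def IsReedyFibration {Y X : SimplicialSpace.{u}} (p : Y ⟶ X) : Prop :=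
  ∀ n : ℕ, SSet.IsKanFibration
    (pullback.lift (restrict (∂Δ[n] : (Δ[n] : SSet.{u}).Subcomplex).ι Y) (postcomp Δ[n] p)
      (restrict_postcomp _ p))

/-! ### Segal spaces -/

/-- The space `X_1 ×_{X_0} ... ×_{X_0} X_1` (`n` factors) of paths of `n` composable arrows, the
target of each being the source of the next one. -/
def pathSpace (X : SimplicialSpace.{u}) (n : ℕ) : SSet.{u} where
  obj l := (row X l).Path n
  map φ := TypeCat.ofHom fun γ => γ.map (rowMap X φ)
  map_id l := by
    refine ConcreteCategory.hom_ext _ _ fun γ => ?_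
    apply SSet.Path.ext <;> funext i
    · exact Functor.map_id_apply (X.obj _) _ _
    · exact Functor.map_id_apply (X.obj _) _ _
  map_comp φ ψ := by
    refine ConcreteCategory.hom_ext _ _ fun γ => ?_
    apply SSet.Path.ext <;> funext i
    · exact Functor.map_comp_apply (X.obj _) _ _ _
    · exact Functor.map_comp_apply (X.obj _) _ _ _

/-- The Segal map `X_n ⟶ X_1 ×_{X_0} ... ×_{X_0} X_1`. -/
def segalMap (X : SimplicialSpace.{u}) (n : ℕ) : X _⦋n⦌ ⟶ pathSpace X n where
  app l := TypeCat.ofHom fun σ => (row X l).spine n σ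
  naturality l m φ := by
    ext σ
    apply SSet.Path.ext <;> funext i
    · exact NatTrans.naturality_apply (X.map (SimplexCategory.const ⦋0⦌ ⦋n⦌ i).op) φ σ
    · exact NatTrans.naturality_apply (X.map (SimplexCategory.mkOfSucc i).op) φ σ

/-- A Segal space is a Reedy fibrant simplicial space whose Segal maps are equivalences. -/
structure IsSegal (T : SimplicialSpace.{u}) : Prop where
  reedyFibrant : IsReedyFibrant T
  segal : ∀ n : ℕ, 2 ≤ n → SSet.IsEquivalence (segalMap T n)

/-- The objects of `T`: the points of `T_0`. -/
abbrev Obj (T : SimplicialSpace.{u}) : Type u := (T _⦋0⦌) _⦋0⦌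

/-- The morphisms of `T`: the points of `T_1`. -/
abbrev Mor (T : SimplicialSpace.{u}) : Type u := (T _⦋1⦌) _⦋0⦌

/-- The source (vertex `0`) map `T_1 ⟶ T_0`. -/
abbrev src (T : SimplicialSpace.{u}) : T _⦋1⦌ ⟶ T _⦋0⦌ := T.δ 1

/-- The target (vertex `1`) map `T_1 ⟶ T_0`. -/
abbrev tgt (T : SimplicialSpace.{u}) : T _⦋1⦌ ⟶ T _⦋0⦌ := T.δ 0

/-- The source of a morphism. -/
abbrev source {T : SimplicialSpace.{u}} (f : Mor T) : Obj T := (src T).app _ f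

/-- The target of a morphism. -/
abbrev target {T : SimplicialSpace.{u}} (f : Mor T) : Obj T := (tgt T).app _ f

/-- The identity of an object. -/
abbrev idMor {T : SimplicialSpace.{u}} (x : Obj T) : Mor T := (T.σ (n := 0) 0).app _ x

/-- The mapping space `map_T(x, y)`, as a subcomplex of `T_1`. -/
def homSpace (T : SimplicialSpace.{u}) (x y : Obj T) : (T _⦋1⦌).Subcomplex :=
  SSet.fiber (src T) x ⊓ SSet.fiber (tgt T) y

/-- Two points of `map_T(x, y)` are homotopic: they are joined by a path in `map_T(x, y)`. -/
def HomotopicMor {T : SimplicialSpace.{u}} (x y : Obj T) (f g : Mor T) : Prop :=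
  ∃ γ ∈ (homSpace T x y).obj (op ⦋1⦌), (T _⦋1⦌).δ 1 γ = f ∧ (T _⦋1⦌).δ 0 γ = g

/-- `k` is a composition `g ∘ f`, witnessed by a `2`-cell. -/
def IsComposition {T : SimplicialSpace.{u}} (f g k : Mor T) : Prop :=
  ∃ ν : (T _⦋2⦌) _⦋0⦌, (T.δ (n := 1) 2).app _ ν = f ∧ (T.δ (n := 1) 0).app _ ν = g ∧
    (T.δ (n := 1) 1).app _ ν = k

/-- `f : x ⟶ y` is a homotopy equivalence: there are `g, h : y ⟶ x` with `g ∘ f ∼ id_x` and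
`f ∘ h ∼ id_y`. -/
def IsHoEquiv {T : SimplicialSpace.{u}} (f : Mor T) : Prop :=
  (∃ g ∈ (homSpace T (target f) (source f)).obj (op ⦋0⦌), ∃ k, IsComposition f g k ∧
      HomotopicMor (source f) (source f) k (idMor (source f))) ∧
    ∃ h ∈ (homSpace T (target f) (source f)).obj (op ⦋0⦌), ∃ k, IsComposition h f k ∧
      HomotopicMor (target f) (target f) k (idMor (target f))

/-- The space `T_hoequiv` of homotopy equivalences. -/
def hoEquivSpace (T : SimplicialSpace.{u}) : (T _⦋1⦌).Subcomplex :=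
  SSet.fullSubcomplex (T _⦋1⦌) IsHoEquiv

lemma mem_homSpace_iff {T : SimplicialSpace.{u}} {x y : Obj T} {l : SimplexCategoryᵒᵖ}
    (τ : (T _⦋1⦌).obj l) :
    τ ∈ (homSpace T x y).obj l ↔
      (src T).app l τ = (T _⦋0⦌).map (l.unop.const ⦋0⦌ 0).op x ∧
        (tgt T).app l τ = (T _⦋0⦌).map (l.unop.const ⦋0⦌ 0).op y := by
  have key : ∀ (φ : T _⦋1⦌ ⟶ T _⦋0⦌) (z : Obj T), τ ∈ (SSet.fiber φ z).obj l ↔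
      φ.app l τ = (T _⦋0⦌).map (l.unop.const ⦋0⦌ 0).op z := by
    intro φ z
    constructor
    · rintro ⟨v, hv⟩
      obtain rfl : v = (l.unop.const ⦋0⦌ 0).op := Quiver.Hom.unop_inj (Subsingleton.elim _ _)
      exact hv.symm
    · intro h
      exact ⟨(l.unop.const ⦋0⦌ 0).op, h.symm⟩
  exact and_congr (key _ _) (key _ _)

lemma source_idMor {T : SimplicialSpace.{u}} (x : Obj T) : source (idMor x) = x :=
  congr_arg (fun q : T _⦋0⦌ ⟶ T _⦋0⦌ => q.app _ x) (T.δ_comp_σ_succ (i := 0))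

lemma target_idMor {T : SimplicialSpace.{u}} (x : Obj T) : target (idMor x) = x :=
  congr_arg (fun q : T _⦋0⦌ ⟶ T _⦋0⦌ => q.app _ x) (T.δ_comp_σ_self (i := 0))

lemma idMor_mem_homSpace {T : SimplicialSpace.{u}} (x : Obj T) :
    idMor x ∈ (homSpace T x x).obj (op ⦋0⦌) := by
  rw [mem_homSpace_iff]
  have h : (T _⦋0⦌).map ((op ⦋0⦌ : SimplexCategoryᵒᵖ).unop.const ⦋0⦌ 0).op x = x := by
    have e : ((op ⦋0⦌ : SimplexCategoryᵒᵖ).unop.const ⦋0⦌ 0) = 𝟙 _ := Subsingleton.elim _ _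
    rw [e]
    exact Functor.map_id_apply (T _⦋0⦌) _ _
  rw [h]
  exact ⟨source_idMor x, target_idMor x⟩

lemma isComposition_idMor {T : SimplicialSpace.{u}} (x : Obj T) :
    IsComposition (idMor x) (idMor x) (idMor x) := by
  refine ⟨(T.σ (n := 1) 0).app _ (idMor x), ?_, ?_, ?_⟩
  · have h := congr_arg (fun q : T _⦋1⦌ ⟶ T _⦋1⦌ => q.app _ (idMor x))
      (T.δ_comp_σ_of_gt (i := 1) (j := 0) (by decide))
    refine h.trans ?_
    exact congr_arg ((T.σ (n := 0) 0).app _) (source_idMor x)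
  · exact congr_arg (fun q : T _⦋1⦌ ⟶ T _⦋1⦌ => q.app _ (idMor x)) (T.δ_comp_σ_self (i := 0))
  · exact congr_arg (fun q : T _⦋1⦌ ⟶ T _⦋1⦌ => q.app _ (idMor x)) (T.δ_comp_σ_succ (i := 0))

lemma isHoEquiv_idMor {T : SimplicialSpace.{u}} (x : Obj T) : IsHoEquiv (idMor x) := by
  have hc : HomotopicMor x x (idMor x) (idMor x) := by
    refine ⟨(T _⦋1⦌).σ (n := 0) 0 (idMor x), ?_, ?_, ?_⟩
    · exact (homSpace T x x).map _ (idMor_mem_homSpace x)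
    · exact ConcreteCategory.congr_hom ((T _⦋1⦌).δ_comp_σ_succ (i := 0)) (idMor x)
    · exact ConcreteCategory.congr_hom ((T _⦋1⦌).δ_comp_σ_self (i := 0)) (idMor x)
  have h₁ := source_idMor x
  have h₂ := target_idMor x
  unfold IsHoEquiv
  rw [h₁, h₂]
  exact ⟨⟨idMor x, idMor_mem_homSpace x, idMor x, isComposition_idMor x, hc⟩,
    ⟨idMor x, idMor_mem_homSpace x, idMor x, isComposition_idMor x, hc⟩⟩

/-- The map `s_0 : T_0 ⟶ T_hoequiv`. -/
def toHoEquivSpace (T : SimplicialSpace.{u}) : T _⦋0⦌ ⟶ (hoEquivSpace T : SSet.{u}) :=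
  SSet.Subcomplex.lift (T.σ (n := 0) 0) (by
    rintro l _ ⟨τ, rfl⟩ v
    have h := NatTrans.naturality_apply (T.σ (n := 0) 0) v.op τ
    rw [← h]
    exact isHoEquiv_idMor _)

/-- A complete Segal space (CSS). -/
structure IsCSS (T : SimplicialSpace.{u}) : Prop extends IsSegal T where
  complete : SSet.IsEquivalence (toHoEquivSpace T)

/-! ### Left fibrations -/

/-- A left fibration is a Reedy fibration `p : L ⟶ W` of CSS such that the square formed by the
source maps `L_1 ⟶ L_0`, `W_1 ⟶ W_0` and by `p` is a homotopy pullback. -/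
structure IsLeftFibration {L W : SimplicialSpace.{u}} (p : L ⟶ W) : Prop where
  css_source : IsCSS L
  css_target : IsCSS W
  reedy : IsReedyFibration p
  isHomotopyPullback :
    SSet.IsHomotopyPullback (src L) (p.app (op ⦋1⦌)) (p.app (op ⦋0⦌)) (src W)

/-! ### CoCartesian fibrations -/

/-- The image of an object under a map of simplicial spaces. -/
abbrev mapObj {V W : SimplicialSpace.{u}} (p : V ⟶ W) (x : Obj V) : Obj W :=
  (p.app (op ⦋0⦌)).app _ x

/-- The image of a morphism under a map of simplicial spaces. -/
abbrev mapMor {V W : SimplicialSpace.{u}} (p : V ⟶ W) (f : Mor V) : Mor W :=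
  (p.app (op ⦋1⦌)).app _ f

lemma source_mapMor {V W : SimplicialSpace.{u}} (p : V ⟶ W) (f : Mor V) :
    source (mapMor p f) = mapObj p (source f) :=
  (congr_arg (fun q : V _⦋1⦌ ⟶ W _⦋0⦌ => q.app _ f) (p.naturality (SimplexCategory.δ 1).op)).symm

/-- The space `map_T(f, z)`, for `f : x ⟶ y`, of `2`-cells of `T` whose edge from vertex `0` to
vertex `1` is `f` and whose vertex `2` is `z`; it is the pullback of
`map_T(x, y, z) ⟶ map_T(x, y) × map_T(y, z)` along `{f} × map_T(y, z)`. The last vertex of a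
`2`-cell is computed here as the target of its edge from vertex `0` to vertex `2`. -/
def triangleSpace (T : SimplicialSpace.{u}) (f : Mor T) (z : Obj T) : (T _⦋2⦌).Subcomplex :=
  SSet.fiber (T.δ (n := 1) 2) f ⊓ SSet.fiber (T.δ (n := 1) 1 ≫ tgt T) z

/-- The map `f^* : map_T(f, z) ⟶ map_T(x, z)`, for `f : x ⟶ y`: it takes a `2`-cell to its edge from
vertex `0` to vertex `2`. -/
def precompMap (T : SimplicialSpace.{u}) (f : Mor T) (x z : Obj T) (hx : source f = x) :
    (triangleSpace T f z : SSet.{u}) ⟶ (homSpace T x z : SSet.{u}) :=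
  SSet.Subcomplex.restrictMap (T.δ (n := 1) 1) (triangleSpace T f z) (homSpace T x z) (by
    subst hx
    rintro l τ ⟨h₁, h₂⟩
    have h : T.δ (n := 1) 2 ≫ T.δ (n := 0) 1 = T.δ (n := 1) 1 ≫ T.δ (n := 0) 1 :=
      (T.δ_comp_δ_self (i := 1)).symm
    exact ⟨SSet.mem_fiber_comp h h₁, h₂⟩)

/-- The map `map_V(x, z) ⟶ map_W(px, pz)`. -/
def homSpaceMap {V W : SimplicialSpace.{u}} (p : V ⟶ W) (x z : Obj V) :
    (homSpace V x z : SSet.{u}) ⟶ (homSpace W (mapObj p x) (mapObj p z) : SSet.{u}) :=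
  SSet.Subcomplex.restrictMap (p.app (op ⦋1⦌)) (homSpace V x z)
    (homSpace W (mapObj p x) (mapObj p z)) (by
    rintro l τ ⟨h₁, h₂⟩
    exact ⟨SSet.mem_fiber_comp (p.naturality (SimplexCategory.δ 1).op) h₁,
      SSet.mem_fiber_comp (p.naturality (SimplexCategory.δ 0).op) h₂⟩)

/-- The map `map_V(f, z) ⟶ map_W(pf, pz)`. -/
def triangleSpaceMap {V W : SimplicialSpace.{u}} (p : V ⟶ W) (f : Mor V) (z : Obj V) :
    (triangleSpace V f z : SSet.{u}) ⟶ (triangleSpace W (mapMor p f) (mapObj p z) : SSet.{u}) :=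
  SSet.Subcomplex.restrictMap (p.app (op ⦋2⦌)) (triangleSpace V f z)
    (triangleSpace W (mapMor p f) (mapObj p z)) (by
    rintro l τ ⟨h₁, h₂⟩
    have h : (V.δ (n := 1) 1 ≫ tgt V) ≫ p.app (op ⦋0⦌) =
        p.app (op ⦋2⦌) ≫ W.δ (n := 1) 1 ≫ tgt W := by
      have e₁ := p.naturality (SimplexCategory.δ (n := 0) 0).op
      have e₂ := p.naturality (SimplexCategory.δ (n := 1) 1).op
      exact (congr_arg (fun q => V.δ (n := 1) 1 ≫ q) e₁).trans
        (congr_arg (fun q => q ≫ W.δ (n := 0) 0) e₂)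
    exact ⟨SSet.mem_fiber_comp (p.naturality (SimplexCategory.δ 2).op) h₁,
      SSet.mem_fiber_comp h h₂⟩)

/-- The morphism `f : x ⟶ y` of `V` is `p`-coCartesian: for every object `z` of `V` the square
formed by `f^* : map_V(f, z) ⟶ map_V(x, z)`, `(pf)^* : map_W(pf, pz) ⟶ map_W(px, pz)` and the maps
induced by `p` is a homotopy pullback. -/
def IsCoCartesianMor {V W : SimplicialSpace.{u}} (p : V ⟶ W) (f : Mor V) : Prop :=
  ∀ z : Obj V, SSet.IsHomotopyPullback
    (precompMap V f (source f) z rfl)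
    (triangleSpaceMap p f z)
    (homSpaceMap p (source f) z)
    (precompMap W (mapMor p f) (mapObj p (source f)) (mapObj p z) (source_mapMor p f))

/-- A coCartesian fibration is a Reedy fibration of CSS `p : C ⟶ W` such that every morphism `f` of
`W`, with a chosen lift `x'` of its source, has a `p`-coCartesian lift with source `x'`. -/
structure IsCoCartesianFibration {C W : SimplicialSpace.{u}} (p : C ⟶ W) : Prop where
  css_source : IsCSS C
  css_target : IsCSS W
  reedy : IsReedyFibration p
  exists_lift : ∀ (f : Mor W) (x' : Obj C), mapObj p x' = source f →
    ∃ f' : Mor C, source f' = x' ∧ mapMor p f' = f ∧ IsCoCartesianMor p f'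

/-- A point `σ` of `V_n` is `p`-coCartesian if all the morphisms of `V` obtained from it by
structure maps `V_n ⟶ V_1` are `p`-coCartesian. -/
def IsCoCartesianSimplex {V W : SimplicialSpace.{u}} (p : V ⟶ W) (n : SimplexCategoryᵒᵖ)
    (σ : (V.obj n) _⦋0⦌) : Prop :=
  ∀ θ : ⦋1⦌ ⟶ n.unop, IsCoCartesianMor p ((V.map θ.op).app _ σ)

/-- The simplicial subspace of `V` which is, in degree `n`, the subspace of `V_n` spanned by the
`p`-coCartesian `n`-simplices. -/
def LFib {V W : SimplicialSpace.{u}} (p : V ⟶ W) : SimplicialSpace.{u} where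
  obj n := (SSet.fullSubcomplex (V.obj n) (IsCoCartesianSimplex p n) : SSet.{u})
  map {m n} η := SSet.Subcomplex.restrictMap (V.map η)
    (SSet.fullSubcomplex (V.obj m) (IsCoCartesianSimplex p m))
    (SSet.fullSubcomplex (V.obj n) (IsCoCartesianSimplex p n)) (by
    intro l τ hτ v θ
    have h₁ := NatTrans.naturality_apply (V.map η) v.op τ
    have h₂ := hτ v (θ ≫ η.unop)
    rw [op_comp, Quiver.Hom.op_unop, V.map_comp] at h₂
    rw [← h₁]
    exact h₂)
  map_id n := by
    rw [← cancel_mono (SSet.Subcomplex.ι _)]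
    exact congr_arg (fun q => SSet.Subcomplex.ι _ ≫ q) (V.map_id n)
  map_comp η θ := by
    rw [← cancel_mono (SSet.Subcomplex.ι _)]
    exact congr_arg (fun q => SSet.Subcomplex.ι _ ≫ q) (V.map_comp η θ)

/-- The inclusion `LFib_W(V) ⟶ V`. -/
def LFib.ι {V W : SimplicialSpace.{u}} (p : V ⟶ W) : LFib p ⟶ V where
  app n := (SSet.fullSubcomplex (V.obj n) (IsCoCartesianSimplex p n)).ι
  naturality _ _ _ := rfl

/-- The map `LFib_W(V) ⟶ W`. -/
def LFib.proj {V W : SimplicialSpace.{u}} (p : V ⟶ W) : LFib p ⟶ W :=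
  LFib.ι p ≫ p

end SimplicialSpace

/-! Every homotopical condition is turned into a lifting property. A Kan fibration of Kan complexes
that is an equivalence is a trivial fibration (`IsKanFibration.isTrivialFibration`), and a Kan
fibration is trivial once spheres can be filled in each of its fibers (`ContractibleAt`). For a
Reedy fibration `p : X ⟶ Y` and a monomorphism `i : A ⟶ B`, the map `relMap p i` from Map(B, X) to
Map(A, X) ×_{Map(A, Y)} Map(B, Y) is a Kan fibration, and `RelContractible` says that its fiber over
a given extension problem is contractible. This condition is stable under pushout and satisfies
two-out-of-three for composites, so it can be checked by attaching simplices one at a time.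
Attachments along inner horns cost nothing, by the Segal condition.

In these terms a morphism f is coCartesian exactly when every extension problem along Λ[2,0] ⊂ Δ[2]
with f on the edge 01 has a contractible space of solutions (`isCoCartesianMor_iff`). Gluing inside
Δ[3] then shows that coCartesian morphisms compose and can be cancelled (`IsCoCart.comp`,
`IsCoCart.of_comp`); identities are coCartesian (`isCoCart_idMor`), and being coCartesian depends
only on the path component in X_1. In a complete Segal space the homotopy equivalences are the
morphisms joined to identities, so they are coCartesian (`IsHoEquiv.isCoCart`); conversely a
coCartesian morphism over an identity is a homotopy equivalence (`IsCoCart.isHoEquiv`).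

Consequently `LFib p` is a complete Segal space and a Reedy fibration over the base for every Reedy
fibration p of complete Segal spaces, whether or not lifts exist: it is made of unions of path
components, a simplex belongs to it when its spine does, and it has the same objects and homotopy
equivalences as the total space. Only the source square is at stake. Its comparison map is a Kan
fibration whose fiber over (x, f) is the space of coCartesian lifts of f with source x. If one lift
exists, any family of lifts differs from it by a family of homotopy equivalences over an identity,
and such families extend; so the fiber is contractible (`IsCoCart.exists_extension`). Conversely, if
the comparison map is an equivalence, it is surjective on points, and a preimage of (x, f) is a
coCartesian lift. -/

namespace SSet

open MonoidalCategory CartesianMonoidalCategory HomotopicalAlgebra modelCategoryQuillen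

/-! ### Lifting properties of trivial fibrations and Kan fibrations -/

/-- A trivial Kan fibration: right lifting property against all boundary inclusions. -/
abbrev IsTrivialFibration {K L : SSet.{u}} (f : K ⟶ L) : Prop := I.rlp f

lemma IsTrivialFibration.hasLiftingProperty {K L : SSet.{u}} {f : K ⟶ L}
    (hf : IsTrivialFibration f) {A B : SSet.{u}} (i : A ⟶ B) [Mono i] :
    HasLiftingProperty i f := by
  have h : (MorphismProperty.monomorphisms SSet.{u}).rlp f := by rwa [rlp_monomorphisms]
  exact h i (MorphismProperty.monomorphisms.infer_property i)

lemma IsTrivialFibration.exists_lift {K L : SSet.{u}} {f : K ⟶ L}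
    (hf : IsTrivialFibration f) {A B : SSet.{u}} (i : A ⟶ B) [Mono i] (a : A ⟶ K) (b : B ⟶ L)
    (w : a ≫ f = i ≫ b) : ∃ l : B ⟶ K, i ≫ l = a ∧ l ≫ f = b := by
  have := hf.hasLiftingProperty i
  have sq : CommSq a i f b := ⟨w⟩
  exact ⟨sq.lift, sq.fac_left, sq.fac_right⟩

lemma isTrivialFibration_iff {K L : SSet.{u}} {f : K ⟶ L} :
    IsTrivialFibration f ↔ ∀ (n : ℕ) (a : (∂Δ[n] : SSet.{u}) ⟶ K) (b : Δ[n] ⟶ L),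
      a ≫ f = ∂Δ[n].ι ≫ b → ∃ l : Δ[n] ⟶ K, ∂Δ[n].ι ≫ l = a ∧ l ≫ f = b := by
  constructor
  · intro h n a b w
    exact h.exists_lift _ _ _ w
  · rintro h _ _ _ ⟨n⟩
    refine ⟨fun {a b} sq => ?_⟩
    obtain ⟨l, h₁, h₂⟩ := h n a b sq.w
    exact ⟨⟨⟨l, h₁, h₂⟩⟩⟩

lemma IsKanFibration.hasLiftingProperty {K L : SSet.{u}} {f : K ⟶ L}
    (hf : IsKanFibration f) {A B : SSet.{u}} {i : A ⟶ B} (hi : anodyneExtensions i) :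
    HasLiftingProperty i f :=
  hi f hf

lemma IsKanFibration.exists_lift {K L : SSet.{u}} {f : K ⟶ L}
    (hf : IsKanFibration f) {A B : SSet.{u}} {i : A ⟶ B} (hi : anodyneExtensions i)
    (a : A ⟶ K) (b : B ⟶ L)
    (w : a ≫ f = i ≫ b) : ∃ l : B ⟶ K, i ≫ l = a ∧ l ≫ f = b := by
  have := hf.hasLiftingProperty hi
  have sq : CommSq a i f b := ⟨w⟩
  exact ⟨sq.lift, sq.fac_left, sq.fac_right⟩

lemma isKanFibration_iff {K L : SSet.{u}} {f : K ⟶ L} :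
    IsKanFibration f ↔ ∀ (n : ℕ) (i : Fin (n + 2)) (a : (Λ[n + 1, i] : SSet.{u}) ⟶ K)
      (b : Δ[n + 1] ⟶ L),
      a ≫ f = Λ[n + 1, i].ι ≫ b → ∃ l : Δ[n + 1] ⟶ K, Λ[n + 1, i].ι ≫ l = a ∧ l ≫ f = b := by
  constructor
  · intro h n i a b w
    exact h.exists_lift (anodyneExtensions.horn_ι i) _ _ w
  · intro h _ _ _ hg
    simp only [J, MorphismProperty.iSup_iff] at hg
    obtain ⟨n, ⟨i⟩⟩ := hg
    refine ⟨fun {a b} sq => ?_⟩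
    obtain ⟨l, h₁, h₂⟩ := h n i a b sq.w
    exact ⟨⟨⟨l, h₁, h₂⟩⟩⟩

lemma IsKanFibration.comp {K L M : SSet.{u}} {f : K ⟶ L} {g : L ⟶ M} (hf : IsKanFibration f)
    (hg : IsKanFibration g) : IsKanFibration (f ≫ g) :=
  MorphismProperty.comp_mem J.rlp _ _ hf hg

lemma IsTrivialFibration.comp {K L M : SSet.{u}} {f : K ⟶ L} {g : L ⟶ M}
    (hf : IsTrivialFibration f) (hg : IsTrivialFibration g) : IsTrivialFibration (f ≫ g) :=
  MorphismProperty.comp_mem I.rlp _ _ hf hg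

lemma isKanFibration_of_isPullback {K L K' L' : SSet.{u}} {t : K ⟶ K'} {f : K ⟶ L} {f' : K' ⟶ L'}
    {b : L ⟶ L'} (sq : IsPullback t f f' b) (hf : IsKanFibration f') : IsKanFibration f :=
  MorphismProperty.of_isPullback (P := J.rlp) sq hf

lemma isTrivialFibration_of_isPullback {K L K' L' : SSet.{u}} {t : K ⟶ K'} {f : K ⟶ L}
    {f' : K' ⟶ L'} {b : L ⟶ L'} (sq : IsPullback t f f' b) (hf : IsTrivialFibration f') :
    IsTrivialFibration f :=
  MorphismProperty.of_isPullback (P := I.rlp) sq hf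

lemma isKanFibration_of_isIso {K L : SSet.{u}} (f : K ⟶ L) [IsIso f] : IsKanFibration f := by
  apply MorphismProperty.rlp_of_isIso

/-! ### Homotopy lifting extension -/

lemma horn_one_zero_ι : Λ[1, 0].ι = (const (stdSimplex.obj₀Equiv.{u}.symm 0) : _ ⟶ Δ[1]) := by
  refine horn.hom_ext' fun j hj => ?_
  obtain rfl : j = 1 := by fin_cases j <;> simp_all
  rw [horn.ι_ι, stdSimplex.δ_one_eq_const]
  rfl

lemma horn_one_one_ι : Λ[1, 1].ι = (const (stdSimplex.obj₀Equiv.{u}.symm 1) : _ ⟶ Δ[1]) := by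
  refine horn.hom_ext' fun j hj => ?_
  obtain rfl : j = 0 := by fin_cases j <;> simp_all
  rw [horn.ι_ι, stdSimplex.δ_zero_eq_const]
  rfl

lemma whiskerLeft_horn_one_zero (X : SSet.{u}) : X ◁ Λ[1, 0].ι = fst X _ ≫ ι₀ := by
  rw [horn_one_zero_ι]; rfl

lemma whiskerLeft_horn_one_one (X : SSet.{u}) : X ◁ Λ[1, 1].ι = fst X _ ≫ ι₁ := by
  rw [horn_one_one_ι]; rfl

/-- The pushout product of A ⊂ X with the endpoint 1 of Δ[1] is anodyne. This is the homotopy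
extension lifting property, with the lift prescribed at the end 1; the new information is the lift
at the end 0. -/
lemma IsKanFibration.exists_homotopy_lift_one {E B : SSet.{u}} {f : E ⟶ B} (hf : IsKanFibration f)
    {X : SSet.{u}} (A : X.Subcomplex) (h : X ⊗ Δ[1] ⟶ B) (a : (A : SSet.{u}) ⊗ Δ[1] ⟶ E) (e : X ⟶ E)
    (ha : a ≫ f = A.ι ▷ Δ[1] ≫ h) (he : e ≫ f = ι₁ ≫ h) (hae : ι₁ ≫ a = A.ι ≫ e) :
    ∃ H : X ⊗ Δ[1] ⟶ E, ι₁ ≫ H = e ∧ A.ι ▷ Δ[1] ≫ H = a ∧ H ≫ f = h := by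
  have po := Subcomplex.unionProd.isPushout A Λ[1, 1]
  have w : A.ι ▷ (Λ[1, 1] : SSet.{u}) ≫ fst X _ ≫ e = (A : SSet.{u}) ◁ Λ[1, 1].ι ≫ a := by
    rw [whiskerLeft_horn_one_one, Category.assoc, hae]; rfl
  obtain ⟨H, h₁, h₂⟩ := hf.exists_lift
    (anodyneExtensions_unionProd_ι A Λ[1, 1] (anodyneExtensions.horn_ι 1)) (po.desc _ _ w) h (by
      apply po.hom_ext
      · rw [po.inl_desc_assoc, Subcomplex.unionProd.ι₁_ι_assoc, whiskerLeft_horn_one_one,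
          Category.assoc, Category.assoc, he]
      · rw [po.inr_desc_assoc, Subcomplex.unionProd.ι₂_ι_assoc, ha])
  refine ⟨H, ?_, ?_, h₂⟩
  · have h₃ := Subcomplex.unionProd.ι₁ A Λ[1, 1] ≫= h₁
    rw [po.inl_desc, Subcomplex.unionProd.ι₁_ι_assoc, whiskerLeft_horn_one_one] at h₃
    -- The horn Λ[1,1] is one point, so the projection from X ⊗ Λ[1,1] has a section, which cancels
    -- it from `h₃`.
    have h₄ := (lift (𝟙 X) (const (yonedaEquiv (horn.ι.{u} 1 0 (by simp))))) ≫= h₃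
    exact h₄
  · rw [← Subcomplex.unionProd.ι₂_ι A Λ[1, 1], Category.assoc, h₁, po.inr_desc]

end SSet

namespace SSet

open MonoidalCategory CartesianMonoidalCategory HomotopicalAlgebra modelCategoryQuillen

/-! ### Homotopies -/

/-- The existence of a homotopy. -/
def Homotopic {X Y : SSet.{u}} (f g : X ⟶ Y) : Prop :=
  ∃ h : X ⊗ Δ[1] ⟶ Y, ι₀ ≫ h = f ∧ ι₁ ≫ h = g

lemma homotopic_iff {X Y : SSet.{u}} {f g : X ⟶ Y} :
    Homotopic f g ↔ Nonempty (Homotopy f g) := by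
  refine ⟨fun ⟨h, h₀, h₁⟩ => ⟨⟨h, h₀, h₁, ?_⟩⟩, fun ⟨H⟩ => ⟨H.h, H.h₀, H.h₁⟩⟩
  -- The remaining condition concerns the empty subcomplex.
  refine SSet.hom_ext fun m => ?_
  ext ⟨⟨x, hx⟩, t⟩
  exact False.elim hx

lemma isEquivalence_iff {L K : SSet.{u}} {f : L ⟶ K} :
    IsEquivalence f ↔ (∃ g : K ⟶ L, Homotopic (g ≫ f) (𝟙 K)) ∧
      ∃ h : K ⟶ L, Homotopic (f ≫ h) (𝟙 L) := by
  simp only [homotopic_iff]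
  rfl

lemma Homotopic.refl {X Y : SSet.{u}} (f : X ⟶ Y) : Homotopic f f :=
  ⟨fst _ _ ≫ f, rfl, rfl⟩

lemma Homotopic.precomp {X Y Z : SSet.{u}} {f g : Y ⟶ Z} (h : Homotopic f g) (k : X ⟶ Y) :
    Homotopic (k ≫ f) (k ≫ g) := by
  obtain ⟨h, rfl, rfl⟩ := h
  exact ⟨k ▷ _ ≫ h, rfl, rfl⟩

lemma Homotopic.postcomp {X Y Z : SSet.{u}} {f g : X ⟶ Y} (h : Homotopic f g) (k : Y ⟶ Z) :
    Homotopic (f ≫ k) (g ≫ k) := by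
  obtain ⟨h, rfl, rfl⟩ := h
  exact ⟨h ≫ k, rfl, rfl⟩

/-- A simplicial set is a Kan complex. -/
abbrev IsKan (K : SSet.{u}) : Prop := IsKanFibration (terminal.from K)

lemma IsKanFibration.isKan {K L : SSet.{u}} {f : K ⟶ L} (hf : IsKanFibration f) (hL : IsKan L) :
    IsKan K := by
  have h := hf.comp hL
  rwa [Subsingleton.elim (f ≫ terminal.from L) (terminal.from K)] at h

/-- Horn filling for Λ[2,0] with a parameter space X: the horn is two edges glued at the vertex 0,
and tensoring an anodyne map with X keeps it anodyne. The third face of the filler compares two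
homotopies with the same start, over a prescribed triangle in the base. -/
lemma IsKanFibration.exists_lift_two_zero {E B : SSet.{u}} {f : E ⟶ B} (hf : IsKanFibration f)
    {X : SSet.{u}} (H₁ H₂ : X ⊗ Δ[1] ⟶ E) (h : ι₀ ≫ H₁ = ι₀ ≫ H₂) (T : X ⊗ Δ[2] ⟶ B)
    (h₁ : X ◁ stdSimplex.δ 2 ≫ T = H₁ ≫ f) (h₂ : X ◁ stdSimplex.δ 1 ≫ T = H₂ ≫ f) :
    ∃ S : X ⊗ Δ[2] ⟶ E, X ◁ stdSimplex.δ 2 ≫ S = H₁ ∧ X ◁ stdSimplex.δ 1 ≫ S = H₂ ∧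
      S ≫ f = T := by
  have po := horn₂₀.isPushout.{u}.map (tensorLeft X)
  have w : X ◁ stdSimplex.δ (1 : Fin 2) ≫ H₁ = X ◁ stdSimplex.δ (1 : Fin 2) ≫ H₂ := by
    have e : X ◁ stdSimplex.δ (1 : Fin 2) = fst X Δ[0] ≫ ι₀ := by
      rw [stdSimplex.δ_one_eq_const]; rfl
    rw [e, Category.assoc, h, Category.assoc]
  obtain ⟨S, h₃, h₄⟩ := hf.exists_lift (anodyneExtensions.whiskerLeft
    (anodyneExtensions.horn_ι (0 : Fin 3)) X) (po.desc _ _ w) T (by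
      apply po.hom_ext
      · rw [po.inl_desc_assoc, ← h₁]; rfl
      · rw [po.inr_desc_assoc, ← h₂]; rfl)
  refine ⟨S, ?_, ?_, h₄⟩
  · have := po.inl_desc _ _ w
    rw [← this, ← h₃]; rfl
  · have := po.inr_desc _ _ w
    rw [← this, ← h₃]; rfl

lemma ι₀_whiskerLeft_δ_zero (X : SSet.{u}) :
    ι₀ ≫ X ◁ stdSimplex.δ (0 : Fin 3) = ι₁ ≫ X ◁ stdSimplex.δ (2 : Fin 3) := by
  have : (stdSimplex.{u}.δ (0 : Fin 3)).app _ (stdSimplex.obj₀Equiv.symm 0) =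
    (stdSimplex.{u}.δ (2 : Fin 3)).app _ (stdSimplex.obj₀Equiv.symm 1) := by decide
  have h : (const (stdSimplex.obj₀Equiv.symm 0) : X ⟶ _) ≫ stdSimplex.{u}.δ (0 : Fin 3) =
    const (stdSimplex.obj₀Equiv.symm 1) ≫ stdSimplex.{u}.δ (2 : Fin 3) := by
    rw [const_comp, const_comp, this]
  exact congr_arg (fun q => lift (𝟙 X) q) h

lemma ι₁_whiskerLeft_δ_zero (X : SSet.{u}) :
    ι₁ ≫ X ◁ stdSimplex.δ (0 : Fin 3) = ι₁ ≫ X ◁ stdSimplex.δ (1 : Fin 3) := by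
  have : (stdSimplex.{u}.δ (0 : Fin 3)).app _ (stdSimplex.obj₀Equiv.symm 1) =
    (stdSimplex.{u}.δ (1 : Fin 3)).app _ (stdSimplex.obj₀Equiv.symm 1) := by decide
  have h : (const (stdSimplex.obj₀Equiv.symm 1) : X ⟶ _) ≫ stdSimplex.{u}.δ (0 : Fin 3) =
    const (stdSimplex.obj₀Equiv.symm 1) ≫ stdSimplex.{u}.δ (1 : Fin 3) := by
    rw [const_comp, const_comp, this]
  exact congr_arg (fun q => lift (𝟙 X) q) h

/-- The face opposite the vertex 0 of a filler joins the two ends. Symmetry and transitivity of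
homotopy are both special cases. -/
lemma Homotopic.of_common_source {X Y : SSet.{u}} (hY : IsKan Y) {f g₁ g₂ : X ⟶ Y}
    (h₁ : Homotopic f g₁) (h₂ : Homotopic f g₂) : Homotopic g₁ g₂ := by
  obtain ⟨H₁, rfl, rfl⟩ := h₁
  obtain ⟨H₂, h, rfl⟩ := h₂
  obtain ⟨S, hS₁, hS₂, -⟩ := hY.exists_lift_two_zero H₁ H₂ h.symm (terminal.from _)
    (Subsingleton.elim _ _) (Subsingleton.elim _ _)
  refine ⟨X ◁ stdSimplex.δ 0 ≫ S, ?_, ?_⟩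
  · rw [← Category.assoc, ι₀_whiskerLeft_δ_zero, Category.assoc, hS₁]
  · rw [← Category.assoc, ι₁_whiskerLeft_δ_zero, Category.assoc, hS₂]

lemma Homotopic.symm {X Y : SSet.{u}} (hY : IsKan Y) {f g : X ⟶ Y}
    (h : Homotopic f g) : Homotopic g f :=
  h.of_common_source hY (.refl f)

lemma Homotopic.trans {X Y : SSet.{u}} (hY : IsKan Y) {f g k : X ⟶ Y}
    (h : Homotopic f g) (h' : Homotopic g k) : Homotopic f k :=
  (h.symm hY).of_common_source hY h'

lemma whiskerLeft_δ_two_σ_one (X : SSet.{u}) :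
    X ◁ stdSimplex.δ (2 : Fin 3) ≫ X ◁ stdSimplex.σ (1 : Fin 2) = 𝟙 _ := by
  have e : stdSimplex.{u}.δ (2 : Fin 3) ≫ stdSimplex.σ (1 : Fin 2) = 𝟙 Δ[1] := by decide
  rw [← whiskerLeft_comp, e, whiskerLeft_id]

lemma whiskerLeft_δ_one_σ_one (X : SSet.{u}) :
    X ◁ stdSimplex.δ (1 : Fin 3) ≫ X ◁ stdSimplex.σ (1 : Fin 2) = 𝟙 _ := by
  have e : stdSimplex.{u}.δ (1 : Fin 3) ≫ stdSimplex.σ (1 : Fin 2) = 𝟙 Δ[1] := by decide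
  rw [← whiskerLeft_comp, e, whiskerLeft_id]

lemma whiskerLeft_δ_zero_σ_one (X : SSet.{u}) :
    X ◁ stdSimplex.δ (0 : Fin 3) ≫ X ◁ stdSimplex.σ (1 : Fin 2) = fst X Δ[1] ≫ ι₁ := by
  have e : stdSimplex.{u}.δ (0 : Fin 3) ≫ stdSimplex.σ (1 : Fin 2) =
      const (stdSimplex.obj₀Equiv.symm 1) := by decide
  rw [← whiskerLeft_comp, e]
  rfl

/-! ### Equivalences and trivial fibrations -/

lemma IsKanFibration.exists_path_lift {E B : SSet.{u}} {f : E ⟶ B} (hf : IsKanFibration f)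
    {X : SSet.{u}} (h : X ⊗ Δ[1] ⟶ B) (e : X ⟶ E) (he : e ≫ f = ι₀ ≫ h) :
    ∃ H : X ⊗ Δ[1] ⟶ E, ι₀ ≫ H = e ∧ H ≫ f = h := by
  obtain ⟨H, h₁, h₂⟩ := hf.exists_lift (anodyneExtensions.whiskerLeft
    (anodyneExtensions.horn_ι (0 : Fin 2)) X) (fst _ _ ≫ e) h (by
      rw [whiskerLeft_horn_one_zero, Category.assoc, Category.assoc, he])
  refine ⟨H, ?_, h₂⟩
  rw [whiskerLeft_horn_one_zero] at h₁
  have h₃ := (lift (𝟙 X) (const (yonedaEquiv (horn.ι.{u} 0 1 (by simp))))) ≫= h₁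
  exact h₃

/-- A Kan fibration of Kan complexes which is an equivalence is a trivial fibration. -/
lemma IsKanFibration.isTrivialFibration {K L : SSet.{u}} {f : K ⟶ L} (hf : IsKanFibration f)
    (hK : IsKan K) (he : IsEquivalence f) : IsTrivialFibration f := by
  obtain ⟨⟨g, H, hH₀, hH₁⟩, h, hh⟩ := isEquivalence_iff.1 he
  -- Lifting the homotopy from `g ≫ f` to the identity, starting at `g`, ends at a strict section
  -- `s`.
  obtain ⟨H', hH'₀, hH'⟩ := hf.exists_path_lift H g hH₀.symm
  obtain ⟨s, hs⟩ : ∃ s : L ⟶ K, s ≫ f = 𝟙 L := ⟨ι₁ ≫ H', by rw [Category.assoc, hH', hH₁]⟩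
  have h₁ : Homotopic (f ≫ s) (𝟙 K) := by
    refine Homotopic.of_common_source hK ?_ hh
    have := hh.precomp (f ≫ s)
    rwa [Category.comp_id, Category.assoc, reassoc_of% hs] at this
  obtain ⟨G, hG₀, hG₁⟩ := h₁
  -- The homotopy `G` from `f ≫ s` to the identity need not be fiberwise. Both `G` and `G ≫ f ≫ s`
  -- lie over `G ≫ f` and start at the same map; filling this horn over a degenerate triangle gives,
  -- on the face opposite 0, a homotopy from the identity to `f ≫ s` that is constant after `f`.
  have hG₂ : ι₀ ≫ G = ι₀ ≫ G ≫ f ≫ s := by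
    rw [← Category.assoc ι₀ G, hG₀, Category.assoc f s, ← Category.assoc s f, hs, Category.id_comp]
  obtain ⟨S, hS₁, hS₂, hS⟩ := hf.exists_lift_two_zero G (G ≫ f ≫ s) hG₂
    (K ◁ stdSimplex.σ 1 ≫ G ≫ f) (by
      rw [← Category.assoc, whiskerLeft_δ_two_σ_one, Category.id_comp]) (by
      rw [← Category.assoc, whiskerLeft_δ_one_σ_one, Category.id_comp]
      simp only [Category.assoc, hs, Category.comp_id])
  have hc : ∀ (A : SSet.{u}) (u : A ⟶ K), (u ▷ _ ≫ (K ◁ stdSimplex.δ 0 ≫ S)) ≫ f =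
      fst _ _ ≫ u ≫ f := by
    intro A u
    rw [Category.assoc, Category.assoc, hS, ← Category.assoc (K ◁ _), whiskerLeft_δ_zero_σ_one,
      Category.assoc, ← Category.assoc ι₁ G, hG₁, Category.id_comp, whiskerRight_fst_assoc]
  refine isTrivialFibration_iff.2 fun n u v w => ?_
  -- The section solves the lifting problem up to a fiberwise homotopy on the boundary; extending
  -- that homotopy over the simplex corrects the solution at the end 0.
  obtain ⟨H, h₂, h₃, h₄⟩ := hf.exists_homotopy_lift_one ∂Δ[n] (fst _ _ ≫ v)
    (u ▷ _ ≫ K ◁ stdSimplex.δ 0 ≫ S) (v ≫ s) (by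
      rw [hc, w]; rfl) (by rw [Category.assoc, hs]; rfl) (by
      rw [ι₁_comp_assoc, ← Category.assoc ι₁, ι₁_whiskerLeft_δ_zero, Category.assoc, hS₂,
        reassoc_of% hG₁, ← reassoc_of% w])
  refine ⟨ι₀ ≫ H, ?_, ?_⟩
  · rw [← ι₀_comp_assoc, h₃, ι₀_comp_assoc, ← Category.assoc ι₀, ι₀_whiskerLeft_δ_zero,
      Category.assoc, hS₁, hG₁, Category.comp_id]
  · rw [Category.assoc, h₄]; rfl

end SSet

/-! ### Relative homotopies, sections, and contractible fibers -/

namespace SSet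

open MonoidalCategory CartesianMonoidalCategory HomotopicalAlgebra modelCategoryQuillen

/-- The two horns of Δ[1] are its two vertices, so this presents ∂Δ[1] as a disjoint union of two
points and lets maps out of it be given by a pair. -/
lemma boundary_one_bicartSq :
    Subcomplex.BicartSq.{u} (X := Δ[1]) ⊥ Λ[1, 0] Λ[1, 1] ∂Δ[1] where
  sup_eq := by
    apply le_antisymm
    · refine sup_le ?_ ?_
      · rw [horn_eq_iSup, iSup_le_iff]
        exact fun j => face_singleton_compl_le_boundary j.1
      · rw [horn_eq_iSup, iSup_le_iff]
        exact fun j => face_singleton_compl_le_boundary j.1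
    · rw [boundary_eq_iSup, iSup_le_iff]
      intro i
      fin_cases i
      · exact le_trans (face_le_horn 0 1 (by simp)) le_sup_right
      · exact le_trans (face_le_horn 1 0 (by simp)) le_sup_left
  inf_eq := by
    have h₀ : Λ[1, 0] = stdSimplex.face.{u} {(1 : Fin 2)}ᶜ := by
      apply le_antisymm
      · rw [horn_eq_iSup, iSup_le_iff]
        rintro ⟨j, hj⟩
        obtain rfl : j = 1 := by fin_cases j <;> simp_all
        rfl
      · exact face_le_horn 1 0 (by simp)
    have h₁ : Λ[1, 1] = stdSimplex.face.{u} {(0 : Fin 2)}ᶜ := by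
      apply le_antisymm
      · rw [horn_eq_iSup, iSup_le_iff]
        rintro ⟨j, hj⟩
        obtain rfl : j = 0 := by fin_cases j <;> simp_all
        rfl
      · exact face_le_horn 0 1 (by simp)
    rw [h₀, h₁, stdSimplex.face_inter_face, ← stdSimplex.face_empty]
    congr 1

/-- The map on `X ⊗ ∂Δ[1]` given by two maps. -/
lemma exists_ends {X Y : SSet.{u}} (f g : X ⟶ Y) :
    ∃ a : X ⊗ (∂Δ[1] : SSet.{u}) ⟶ Y,
      X ◁ Subcomplex.homOfLE boundary_one_bicartSq.le₂₄ ≫ a = fst _ _ ≫ f ∧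
      X ◁ Subcomplex.homOfLE boundary_one_bicartSq.le₃₄ ≫ a = fst _ _ ≫ g := by
  have po := boundary_one_bicartSq.{u}.isPushout.map (tensorLeft X)
  have w : X ◁ Subcomplex.homOfLE boundary_one_bicartSq.le₁₂ ≫ fst _ _ ≫ f =
      X ◁ Subcomplex.homOfLE boundary_one_bicartSq.le₁₃ ≫ fst _ _ ≫ g := by
    refine SSet.hom_ext fun m => ?_
    ext ⟨x, t, ht⟩
    exact False.elim ht
  exact ⟨po.desc _ _ w, po.inl_desc _ _ w, po.inr_desc _ _ w⟩

lemma ends_hom_ext {X Y : SSet.{u}} {a b : X ⊗ (∂Δ[1] : SSet.{u}) ⟶ Y}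
    (h₀ : X ◁ Subcomplex.homOfLE boundary_one_bicartSq.le₂₄ ≫ a =
      X ◁ Subcomplex.homOfLE boundary_one_bicartSq.le₂₄ ≫ b)
    (h₁ : X ◁ Subcomplex.homOfLE boundary_one_bicartSq.le₃₄ ≫ a =
      X ◁ Subcomplex.homOfLE boundary_one_bicartSq.le₃₄ ≫ b) : a = b :=
  (boundary_one_bicartSq.{u}.isPushout.map (tensorLeft X)).hom_ext h₀ h₁

/-- Homotopies relative to a subcomplex exist in the fibers of trivial fibrations. -/
lemma IsTrivialFibration.exists_homotopy {E B : SSet.{u}} {q : E ⟶ B} (hq : IsTrivialFibration q)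
    {X : SSet.{u}} (A : X.Subcomplex) (e₀ e₁ : X ⟶ E) (h : e₀ ≫ q = e₁ ≫ q)
    (hA : A.ι ≫ e₀ = A.ι ≫ e₁) :
    ∃ H : X ⊗ Δ[1] ⟶ E, ι₀ ≫ H = e₀ ∧ ι₁ ≫ H = e₁ ∧ H ≫ q = fst _ _ ≫ e₀ ≫ q ∧
      A.ι ▷ _ ≫ H = fst _ _ ≫ A.ι ≫ e₀ := by
  have po := Subcomplex.unionProd.isPushout A ∂Δ[1]
  obtain ⟨a, h₀, h₁⟩ := exists_ends e₀ e₁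
  have w : A.ι ▷ (∂Δ[1] : SSet.{u}) ≫ a = (A : SSet.{u}) ◁ ∂Δ[1].ι ≫ fst _ _ ≫ A.ι ≫ e₀ := by
    apply ends_hom_ext
    · rw [whisker_exchange_assoc, h₀]; rfl
    · rw [whisker_exchange_assoc, h₁, whiskerRight_fst_assoc, ← hA]; rfl
  -- The homotopy is a lift against the pushout product of A ⊂ X with ∂Δ[1] ⊂ Δ[1], over a constant
  -- homotopy in the base.
  obtain ⟨H, h₂, h₃⟩ := hq.exists_lift (A.unionProd ∂Δ[1]).ι (po.desc _ _ w) (fst _ _ ≫ e₀ ≫ q) (by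
    apply po.hom_ext
    · rw [po.inl_desc_assoc, Subcomplex.unionProd.ι₁_ι_assoc]
      apply ends_hom_ext
      · rw [reassoc_of% h₀]; rfl
      · rw [reassoc_of% h₁, h]; rfl
    · rw [po.inr_desc_assoc, Subcomplex.unionProd.ι₂_ι_assoc]; rfl)
  have h₄ : X ◁ ∂Δ[1].ι ≫ H = a := by
    rw [← Subcomplex.unionProd.ι₁_ι A, Category.assoc, h₂, po.inl_desc]
  refine ⟨H, ?_, ?_, h₃, ?_⟩
  · rw [← h₄] at h₀
    have h₅ := (lift (𝟙 X) (const (yonedaEquiv (horn.ι.{u} 0 1 (by simp))))) ≫= h₀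
    exact h₅
  · rw [← h₄] at h₁
    have h₅ := (lift (𝟙 X) (const (yonedaEquiv (horn.ι.{u} 1 0 (by simp))))) ≫= h₁
    exact h₅
  · rw [← Subcomplex.unionProd.ι₂_ι A ∂Δ[1], Category.assoc, h₂, po.inr_desc]

lemma IsTrivialFibration.exists_section {K L : SSet.{u}} {f : K ⟶ L} (hf : IsTrivialFibration f) :
    ∃ s : L ⟶ K, s ≫ f = 𝟙 L ∧ Homotopic (f ≫ s) (𝟙 K) := by
  obtain ⟨s, -, hs⟩ := hf.exists_lift (⊥ : L.Subcomplex).ι (Subcomplex.isInitialBot.to K) (𝟙 L)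
    (Subcomplex.isInitialBot.hom_ext _ _)
  obtain ⟨H, h₀, h₁, -⟩ := hf.exists_homotopy ⊥ (f ≫ s) (𝟙 K) (by simp [hs])
    (Subcomplex.isInitialBot.hom_ext _ _)
  exact ⟨s, hs, H, h₀, h₁⟩

lemma IsTrivialFibration.isEquivalence {K L : SSet.{u}} {f : K ⟶ L} (hf : IsTrivialFibration f) :
    IsEquivalence f := by
  obtain ⟨s, hs, h⟩ := hf.exists_section
  exact isEquivalence_iff.2 ⟨⟨s, hs ▸ .refl _⟩, s, h⟩

/-- A retraction `r` of a homotopy section `s` is an equivalence. -/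
lemma isEquivalence_of_section {K L : SSet.{u}} (hK : IsKan K) {r : K ⟶ L} {s : L ⟶ K}
    (h : s ≫ r = 𝟙 L) {t : K ⟶ L} (ht : Homotopic (t ≫ s) (𝟙 K)) : IsEquivalence r := by
  refine isEquivalence_iff.2 ⟨⟨s, h ▸ .refl _⟩, s, ?_⟩
  refine Homotopic.of_common_source hK ?_ ht
  have := ht.postcomp (r ≫ s)
  rwa [Category.assoc, reassoc_of% h, Category.id_comp] at this

/-! ### Fibers -/

lemma const_app_zero {X Y : SSet.{u}} (y : Y _⦋0⦌) {x : X _⦋0⦌} :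
    (const y : X ⟶ Y).app (op ⦋0⦌) x = y := by
  have e : (SimplexCategory.const ⦋0⦌ ⦋0⦌ 0) = 𝟙 _ := Subsingleton.elim _ _
  change Y.map (SimplexCategory.const ⦋0⦌ ⦋0⦌ 0).op y = y
  rw [e]
  exact Functor.map_id_apply Y _ _

/-- The fiber of `q` over the point `b` has fillers for all spheres. -/
def ContractibleAt {E B : SSet.{u}} (q : E ⟶ B) (b : B _⦋0⦌) : Prop :=
  ∀ (n : ℕ) (u : (∂Δ[n] : SSet.{u}) ⟶ E), u ≫ q = const b →
    ∃ w : Δ[n] ⟶ E, ∂Δ[n].ι ≫ w = u ∧ w ≫ q = const b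

lemma IsTrivialFibration.contractibleAt {E B : SSet.{u}} {q : E ⟶ B} (hq : IsTrivialFibration q)
    (b : B _⦋0⦌) : ContractibleAt q b :=
  fun n u hu => hq.exists_lift ∂Δ[n].ι u (const b) hu

/-- Sphere fillers over b are sphere fillers in the pullback of q to b. Results on trivial
fibrations thereby become results on a single contractible fiber. -/
lemma ContractibleAt.isTrivialFibration_snd {E B : SSet.{u}} {q : E ⟶ B} {b : B _⦋0⦌}
    (h : ContractibleAt q b) :
    IsTrivialFibration (pullback.snd q (const b : ⊤_ SSet.{u} ⟶ B)) := by
  refine isTrivialFibration_iff.2 fun n u v w => ?_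
  obtain ⟨l, h₁, h₂⟩ := h n (u ≫ pullback.fst _ _) (by
    rw [Category.assoc, pullback.condition]; rfl)
  have hl : l ≫ q = v ≫ const b := h₂
  refine ⟨pullback.lift l v hl, pullback.hom_ext ?_ (Subsingleton.elim _ _),
    Subsingleton.elim _ _⟩
  rw [Category.assoc, pullback.lift_fst, h₁]

lemma exists_lift_to_fiber {E B : SSet.{u}} {q : E ⟶ B} {b : B _⦋0⦌} {X : SSet.{u}} (u : X ⟶ E)
    (hu : u ≫ q = const b) :
    ∃ l : X ⟶ pullback q (const b : ⊤_ SSet.{u} ⟶ B), l ≫ pullback.fst _ _ = u :=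
  ⟨pullback.lift u (terminal.from X) hu, pullback.lift_fst _ _ _⟩

lemma ContractibleAt.exists_lift {E B : SSet.{u}} {q : E ⟶ B} {b : B _⦋0⦌}
    (h : ContractibleAt q b) {X Y : SSet.{u}} (i : X ⟶ Y) [Mono i] (u : X ⟶ E)
    (hu : u ≫ q = const b) : ∃ w : Y ⟶ E, i ≫ w = u ∧ w ≫ q = const b := by
  obtain ⟨u', rfl⟩ := exists_lift_to_fiber u hu
  obtain ⟨l, h₁, -⟩ := h.isTrivialFibration_snd.exists_lift i u' (terminal.from _)
    (Subsingleton.elim _ _)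
  refine ⟨l ≫ pullback.fst _ _, by rw [reassoc_of% h₁], ?_⟩
  rw [Category.assoc, pullback.condition]; rfl

lemma ContractibleAt.exists_homotopy {E B : SSet.{u}} {q : E ⟶ B} {b : B _⦋0⦌}
    (h : ContractibleAt q b) {X : SSet.{u}} (A : X.Subcomplex) (e₀ e₁ : X ⟶ E)
    (h₀ : e₀ ≫ q = const b) (h₁ : e₁ ≫ q = const b) (hA : A.ι ≫ e₀ = A.ι ≫ e₁) :
    ∃ H : X ⊗ Δ[1] ⟶ E, ι₀ ≫ H = e₀ ∧ ι₁ ≫ H = e₁ ∧ H ≫ q = const b ∧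
      A.ι ▷ _ ≫ H = fst _ _ ≫ A.ι ≫ e₀ := by
  obtain ⟨u₀, rfl⟩ := exists_lift_to_fiber e₀ h₀
  obtain ⟨u₁, rfl⟩ := exists_lift_to_fiber e₁ h₁
  obtain ⟨H, h₂, h₃, -, h₄⟩ := h.isTrivialFibration_snd.exists_homotopy A u₀ u₁
    (Subsingleton.elim _ _) (pullback.hom_ext (by simpa using hA) (Subsingleton.elim _ _))
  refine ⟨H ≫ pullback.fst _ _, by rw [reassoc_of% h₂], by rw [reassoc_of% h₃], ?_, ?_⟩
  · rw [Category.assoc, pullback.condition]; rfl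
  · rw [reassoc_of% h₄]

/-- Solvability of lifting problems is invariant under homotopies of the bottom map. -/
lemma IsKanFibration.exists_lift_of_homotopy {E B : SSet.{u}} {q : E ⟶ B} (hq : IsKanFibration q)
    {X : SSet.{u}} (A : X.Subcomplex) (h : X ⊗ Δ[1] ⟶ B)
    (H : ∀ u : (A : SSet.{u}) ⟶ E, u ≫ q = A.ι ≫ ι₁ ≫ h →
      ∃ w : X ⟶ E, A.ι ≫ w = u ∧ w ≫ q = ι₁ ≫ h)
    (u : (A : SSet.{u}) ⟶ E) (hu : u ≫ q = A.ι ≫ ι₀ ≫ h) :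
    ∃ w : X ⟶ E, A.ι ≫ w = u ∧ w ≫ q = ι₀ ≫ h := by
  obtain ⟨U, hU₀, hU⟩ := hq.exists_path_lift (A.ι ▷ _ ≫ h) u (by rw [hu, ι₀_comp_assoc])
  obtain ⟨w, hw, hw'⟩ := H (ι₁ ≫ U) (by rw [Category.assoc, hU, ι₁_comp_assoc])
  obtain ⟨K, hK₁, hK, hK'⟩ := hq.exists_homotopy_lift_one A h U w hU hw' hw.symm
  exact ⟨ι₀ ≫ K, by rw [← ι₀_comp_assoc, hK, hU₀], by rw [Category.assoc, hK']⟩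

/-- The contraction of a simplex onto its last vertex. -/
def stdSimplexContraction (n : ℕ) : Δ[n] ⊗ Δ[1] ⟶ (Δ[n] : SSet.{u}) where
  app m := TypeCat.ofHom fun x => stdSimplex.objMk
    ⟨fun i => if stdSimplex.asOrderHom x.2 i = 0 then stdSimplex.asOrderHom x.1 i else Fin.last n, by
      intro i j hij
      have h₁ := (stdSimplex.asOrderHom x.1).monotone hij
      have h₂ := (stdSimplex.asOrderHom x.2).monotone hij
      dsimp only
      split_ifs with h h'
      · exact h₁
      · exact Fin.le_last _
      · rename_i h'
        rw [h'] at h₂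
        exact absurd (Fin.le_zero_iff.1 h₂) h
      · exact le_rfl⟩
  naturality _ _ _ := rfl

lemma ι₀_stdSimplexContraction (n : ℕ) : ι₀ ≫ stdSimplexContraction.{u} n = 𝟙 _ := by
  refine SSet.hom_ext fun m => ?_
  ext x
  exact stdSimplex.ext (d := m.unop.len) _ _ fun i => rfl

lemma ι₁_stdSimplexContraction (n : ℕ) :
    ι₁ ≫ stdSimplexContraction.{u} n = const (stdSimplex.obj₀Equiv.symm (Fin.last n)) := by
  refine SSet.hom_ext fun m => ?_
  ext x
  rfl

/-- Contracting Δ[n] onto its last vertex deforms v to a constant map, and solvability can be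
carried back along the deformation. So only the fiber over the last vertex of v matters. -/
lemma IsKanFibration.exists_lift_of_contractibleAt {E B : SSet.{u}} {q : E ⟶ B}
    (hq : IsKanFibration q) {n : ℕ} (v : Δ[n] ⟶ B)
    (h : ContractibleAt q (v.app _ (stdSimplex.obj₀Equiv.symm (Fin.last n))))
    (u : (∂Δ[n] : SSet.{u}) ⟶ E) (hu : u ≫ q = ∂Δ[n].ι ≫ v) :
    ∃ w : Δ[n] ⟶ E, ∂Δ[n].ι ≫ w = u ∧ w ≫ q = v := by
  have h₀ : ι₀ ≫ stdSimplexContraction n ≫ v = v := by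
    rw [← Category.assoc, ι₀_stdSimplexContraction]; exact Category.id_comp v
  have h₁ : ι₁ ≫ stdSimplexContraction n ≫ v =
      const (v.app _ (stdSimplex.obj₀Equiv.symm (Fin.last n))) := by
    rw [← Category.assoc, ι₁_stdSimplexContraction, const_comp]
  have := hq.exists_lift_of_homotopy ∂Δ[n] (stdSimplexContraction n ≫ v) (by
    rw [h₁]; exact h n) u (by rw [h₀, hu])
  rwa [h₀] at this

/-- A Kan fibration with contractible fibers is a trivial fibration. -/
lemma IsKanFibration.isTrivialFibration_of_contractibleAt {E B : SSet.{u}} {q : E ⟶ B}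
    (hq : IsKanFibration q) (h : ∀ b, ContractibleAt q b) : IsTrivialFibration q :=
  isTrivialFibration_iff.2 fun _ u v w => hq.exists_lift_of_contractibleAt v (h _) u w

/-- An edge of the base is a homotopy between constant maps, along which the solvability of
sphere-filling problems is carried from its end to its start. -/
lemma ContractibleAt.of_edge {E B : SSet.{u}} {q : E ⟶ B} (hq : IsKanFibration q) (γ : B _⦋1⦌)
    (h : ContractibleAt q (B.δ 0 γ)) : ContractibleAt q (B.δ 1 γ) := by
  have key : ∀ (X : SSet.{u}) (ε : Fin 2),
      (const (stdSimplex.obj₀Equiv.symm ε) : X ⟶ Δ[1]) ≫ yonedaEquiv.symm γ =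
        const (B.map (SimplexCategory.const ⦋0⦌ ⦋1⦌ ε).op γ) := by
    intro X ε
    rw [const_comp]
    rfl
  intro n u hu
  have h₀ : (ι₀ : (Δ[n] : SSet.{u}) ⟶ _) ≫ snd _ _ ≫ yonedaEquiv.symm γ = const (B.δ 1 γ) := by
    rw [ι₀_snd_assoc, key, ← SimplexCategory.δ_one_eq_const]; rfl
  have h₁ : (ι₁ : (Δ[n] : SSet.{u}) ⟶ _) ≫ snd _ _ ≫ yonedaEquiv.symm γ = const (B.δ 0 γ) := by
    rw [ι₁_snd_assoc, key, ← SimplexCategory.δ_zero_eq_const]; rfl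
  have := hq.exists_lift_of_homotopy ∂Δ[n] (snd _ _ ≫ yonedaEquiv.symm γ) (by
    rw [h₁]; exact h n) u (by rw [h₀, hu]; rfl)
  rwa [h₀] at this

/-- A base change has the same fibers. No fibration hypothesis is needed, because `ContractibleAt`
only involves maps lying over a constant map. -/
lemma contractibleAt_iff_of_isPullback {E B E' B' : SSet.{u}} {t : E ⟶ E'} {q : E ⟶ B}
    {q' : E' ⟶ B'} {g : B ⟶ B'} (sq : IsPullback t q q' g) (b : B _⦋0⦌) :
    ContractibleAt q b ↔ ContractibleAt q' (g.app _ b) := by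
  constructor
  · intro h n u hu
    obtain ⟨w, h₁, h₂⟩ := h n (sq.lift u (const b) (by rw [hu, const_comp])) (by simp)
    exact ⟨w ≫ t, by rw [reassoc_of% h₁, sq.lift_fst], by rw [Category.assoc, sq.w,
      reassoc_of% h₂, const_comp]⟩
  · intro h n u hu
    obtain ⟨w, h₁, h₂⟩ := h n (u ≫ t) (by rw [Category.assoc, sq.w, reassoc_of% hu, const_comp])
    refine ⟨sq.lift w (const b) (by rw [h₂, const_comp]), sq.hom_ext ?_ ?_, by simp⟩
    · rw [Category.assoc, sq.lift_fst, h₁]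
    · rw [Category.assoc, sq.lift_snd, hu]; rfl

section Composition

variable {X Y Z : SSet.{u}} {q₁ : X ⟶ Y} {q₂ : Y ⟶ Z}

/-- With the two lemmas that follow, this is two-out-of-three for contractibility of fibers, at a
single point z. Here a sphere is filled first in Y over z, and the filler is then lifted through q₁.
-/
lemma ContractibleAt.comp (h₁ : IsKanFibration q₁) {z : Z _⦋0⦌} (hz : ContractibleAt q₂ z)
    (hy : ∀ y : Y _⦋0⦌, q₂.app _ y = z → ContractibleAt q₁ y) : ContractibleAt (q₁ ≫ q₂) z := by
  intro n u hu
  obtain ⟨v, hv, hv'⟩ := hz n (u ≫ q₁) (by rw [Category.assoc, hu])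
  obtain ⟨w, hw, hw'⟩ := h₁.exists_lift_of_contractibleAt v (hy _ (by
    have := congr_arg (fun f => f.app _ (stdSimplex.obj₀Equiv.symm (Fin.last n))) hv'
    refine this.trans ?_
    exact const_app_zero z)) u hv.symm
  exact ⟨w, hw, by rw [reassoc_of% hw', hv']⟩

/-- A sphere over y has a filler over z. Its image in Y is homotopic, relative to the boundary, to
the constant map at y, because the fiber of q₂ is contractible; lifting this homotopy moves the
filler over y. -/
lemma ContractibleAt.of_comp_left (h₁ : IsKanFibration q₁) {z : Z _⦋0⦌}
    (hz : ContractibleAt q₂ z) (h : ContractibleAt (q₁ ≫ q₂) z) {y : Y _⦋0⦌}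
    (hy : q₂.app _ y = z) : ContractibleAt q₁ y := by
  intro n u hu
  obtain ⟨w, hw, hw'⟩ := h n u (by rw [reassoc_of% hu, const_comp, hy])
  obtain ⟨H, hH₀, hH₁, hH, hA⟩ := hz.exists_homotopy ∂Δ[n] (const y) (w ≫ q₁)
    (by rw [const_comp, hy]) (by rw [Category.assoc, hw']) (by rw [reassoc_of% hw, hu]; rfl)
  obtain ⟨K, hK₁, hK, hK'⟩ := h₁.exists_homotopy_lift_one ∂Δ[n] H (fst _ _ ≫ u) w
    (by rw [hA, Category.assoc, hu]; rfl) hH₁.symm (by rw [hw]; rfl)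
  exact ⟨ι₀ ≫ K, by rw [← ι₀_comp_assoc, hK]; rfl, by rw [Category.assoc, hK', hH₀]⟩

/-- Over the fiber of q₂ at z the map q₁ becomes a trivial fibration. A sphere in that fiber can
thus be lifted to X, filled there, and mapped back to Y. -/
lemma ContractibleAt.of_comp_right (h₁ : IsKanFibration q₁) {z : Z _⦋0⦌}
    (hy : ∀ y : Y _⦋0⦌, q₂.app _ y = z → ContractibleAt q₁ y)
    (h : ContractibleAt (q₁ ≫ q₂) z) : ContractibleAt q₂ z := by
  have sq := (IsPullback.of_hasPullback q₁ (pullback.fst q₂ (const z : ⊤_ SSet.{u} ⟶ Z)))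
  have ht : IsTrivialFibration (pullback.snd q₁ (pullback.fst q₂ (const z : ⊤_ SSet.{u} ⟶ Z))) := by
    refine (isKanFibration_of_isPullback sq h₁).isTrivialFibration_of_contractibleAt fun b => ?_
    rw [contractibleAt_iff_of_isPullback sq]
    refine hy _ ?_
    have := congr_arg (fun f => f.app _ b)
      (pullback.condition (f := q₂) (g := (const z : ⊤_ SSet.{u} ⟶ Z)))
    refine this.trans ?_
    exact const_app_zero z
  intro n u hu
  obtain ⟨v, rfl⟩ := exists_lift_to_fiber u hu
  obtain ⟨u', -, rfl⟩ := ht.exists_lift (⊥ : (∂Δ[n] : SSet.{u}).Subcomplex).ι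
    (Subcomplex.isInitialBot.to _) v (Subcomplex.isInitialBot.hom_ext _ _)
  have e := u' ≫= (pullback.condition (f := q₁)
    (g := pullback.fst q₂ (const z : ⊤_ SSet.{u} ⟶ Z)))
  obtain ⟨w, hw, hw'⟩ := h n (u' ≫ pullback.fst _ _) (by
    rw [Category.assoc, ← Category.assoc _ q₁ q₂, pullback.condition, ← hu]; simp only [Category.assoc])
  exact ⟨w ≫ q₁, by rw [reassoc_of% hw, e, Category.assoc], by rw [Category.assoc, hw']⟩

end Composition

end SSet

namespace SSet

open MonoidalCategory CartesianMonoidalCategory HomotopicalAlgebra modelCategoryQuillen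

/-! ### Edges -/

/-- Two points are the endpoints of an edge. -/
def Joined {K : SSet.{u}} (x y : K _⦋0⦌) : Prop :=
  ∃ e : K _⦋1⦌, K.δ 1 e = x ∧ K.δ 0 e = y

lemma ι₀_yonedaEquiv_symm {X K : SSet.{u}} (e : K _⦋1⦌) :
    (ι₀ : X ⟶ X ⊗ Δ[1]) ≫ snd _ _ ≫ yonedaEquiv.symm e = const (K.δ 1 e) := by
  rw [ι₀_snd_assoc, const_comp]
  have : K.δ 1 e = K.map (SimplexCategory.const ⦋0⦌ ⦋1⦌ 0).op e := by
    rw [← SimplexCategory.δ_one_eq_const]; rfl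
  rw [this]; rfl

lemma ι₁_yonedaEquiv_symm {X K : SSet.{u}} (e : K _⦋1⦌) :
    (ι₁ : X ⟶ X ⊗ Δ[1]) ≫ snd _ _ ≫ yonedaEquiv.symm e = const (K.δ 0 e) := by
  rw [ι₁_snd_assoc, const_comp]
  have : K.δ 0 e = K.map (SimplexCategory.const ⦋0⦌ ⦋1⦌ 1).op e := by
    rw [← SimplexCategory.δ_zero_eq_const]; rfl
  rw [this]; rfl

lemma joined_of_path {X K : SSet.{u}} (x₀ : X _⦋0⦌) (h : X ⊗ Δ[1] ⟶ K) :
    Joined ((ι₀ ≫ h).app _ x₀) ((ι₁ ≫ h).app _ x₀) := by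
  refine ⟨yonedaEquiv (lift (const x₀) (𝟙 Δ[1]) ≫ h), ?_, ?_⟩
  · rw [← stdSimplex.yonedaEquiv_δ_comp, stdSimplex.δ_one_eq_const]
    exact (congr_arg yonedaEquiv (const_comp x₀ (ι₀ ≫ h))).trans (yonedaEquiv_const _)
  · rw [← stdSimplex.yonedaEquiv_δ_comp, stdSimplex.δ_zero_eq_const]
    exact (congr_arg yonedaEquiv (const_comp x₀ (ι₁ ≫ h))).trans (yonedaEquiv_const _)

/-- A point of the terminal simplicial set. -/
noncomputable def terminalPoint : (⊤_ SSet.{u}) _⦋0⦌ :=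
  (terminal.from (Δ[0] : SSet.{u})).app _ (stdSimplex.obj₀Equiv.symm 0)

lemma homotopic_const_iff {K : SSet.{u}} {x y : K _⦋0⦌} :
    Homotopic (const x : ⊤_ SSet.{u} ⟶ K) (const y) ↔ Joined x y := by
  constructor
  · rintro ⟨h, h₀, h₁⟩
    have := joined_of_path terminalPoint h
    rwa [h₀, h₁, const_app_zero, const_app_zero] at this
  · rintro ⟨e, rfl, rfl⟩
    exact ⟨snd _ _ ≫ yonedaEquiv.symm e, ι₀_yonedaEquiv_symm e, ι₁_yonedaEquiv_symm e⟩

lemma Homotopic.joined {X K : SSet.{u}} {f g : X ⟶ K} (h : Homotopic f g) (x : X _⦋0⦌) :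
    Joined (f.app _ x) (g.app _ x) := by
  obtain ⟨h, rfl, rfl⟩ := h
  exact joined_of_path x h

lemma Joined.symm {K : SSet.{u}} (hK : IsKan K) {x y : K _⦋0⦌} (h : Joined x y) : Joined y x :=
  homotopic_const_iff.1 ((homotopic_const_iff.2 h).symm hK)

lemma Joined.trans {K : SSet.{u}} (hK : IsKan K) {x y z : K _⦋0⦌} (h : Joined x y)
    (h' : Joined y z) : Joined x z :=
  homotopic_const_iff.1 ((homotopic_const_iff.2 h).trans hK (homotopic_const_iff.2 h'))

lemma Joined.map {K L : SSet.{u}} (f : K ⟶ L) {x y : K _⦋0⦌} (h : Joined x y) :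
    Joined (f.app _ x) (f.app _ y) := by
  obtain ⟨e, rfl, rfl⟩ := h
  exact ⟨f.app _ e, (NatTrans.naturality_apply f _ e).symm, (NatTrans.naturality_apply f _ e).symm⟩

/-- Lifting of edges along a Kan fibration, with prescribed source. -/
lemma IsKanFibration.exists_edge_lift {E B : SSet.{u}} {q : E ⟶ B} (hq : IsKanFibration q)
    (x : E _⦋0⦌) (e : B _⦋1⦌) (he : B.δ 1 e = q.app _ x) :
    ∃ e' : E _⦋1⦌, E.δ 1 e' = x ∧ q.app _ e' = e := by
  obtain ⟨H, hH₀, hH⟩ := hq.exists_path_lift (X := ⊤_ SSet.{u}) (snd _ _ ≫ yonedaEquiv.symm e)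
    (const x) (by rw [ι₀_yonedaEquiv_symm, const_comp, he])
  refine ⟨yonedaEquiv (lift (const terminalPoint) (𝟙 Δ[1]) ≫ H), ?_, ?_⟩
  · rw [← stdSimplex.yonedaEquiv_δ_comp, stdSimplex.δ_one_eq_const]
    refine (congr_arg yonedaEquiv (const_comp terminalPoint (ι₀ ≫ H))).trans
      ((yonedaEquiv_const _).trans ?_)
    rw [hH₀, const_app_zero]
  · rw [← yonedaEquiv_comp, Category.assoc, hH]
    exact yonedaEquiv.apply_symm_apply e

lemma IsTrivialFibration.exists_point {E B : SSet.{u}} {q : E ⟶ B} (hq : IsTrivialFibration q)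
    (b : B _⦋0⦌) : ∃ x : E _⦋0⦌, q.app _ x = b := by
  obtain ⟨s, hs, -⟩ := hq.exists_section
  exact ⟨s.app _ b, ConcreteCategory.congr_hom (congr_app hs _) b⟩

lemma ContractibleAt.exists_point {E B : SSet.{u}} {q : E ⟶ B} {b : B _⦋0⦌}
    (h : ContractibleAt q b) : ∃ x : E _⦋0⦌, q.app _ x = b := by
  obtain ⟨w, -, hw⟩ := h.exists_lift (⊥ : (Δ[0] : SSet.{u}).Subcomplex).ι
    (Subcomplex.isInitialBot.to _) (Subcomplex.isInitialBot.hom_ext _ _)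
  refine ⟨w.app _ (stdSimplex.obj₀Equiv.symm 0), ?_⟩
  have := ConcreteCategory.congr_hom (congr_app hw (op ⦋0⦌)) (stdSimplex.obj₀Equiv.symm 0)
  exact this.trans (const_app_zero b)

lemma ContractibleAt.joined {E B : SSet.{u}} {q : E ⟶ B} {b : B _⦋0⦌}
    (h : ContractibleAt q b) {x y : E _⦋0⦌} (hx : q.app _ x = b) (hy : q.app _ y = b) :
    Joined x y := by
  obtain ⟨H, h₀, h₁, -⟩ := h.exists_homotopy (X := ⊤_ SSet.{u}) ⊥ (const x) (const y)
    (by rw [const_comp, hx]) (by rw [const_comp, hy]) (Subcomplex.isInitialBot.hom_ext _ _)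
  exact homotopic_const_iff.1 ⟨H, h₀, h₁⟩

/-! ### Full subcomplexes -/

section Full

variable {K L : SSet.{u}}

lemma mem_fullSubcomplex_zero {P : K _⦋0⦌ → Prop} {x : K _⦋0⦌} :
    x ∈ (fullSubcomplex K P).obj (op ⦋0⦌) ↔ P x := by
  constructor
  · intro h
    have := h (𝟙 _)
    rwa [op_id, Functor.map_id_apply] at this
  · intro h v
    obtain rfl : v = 𝟙 _ := Subsingleton.elim _ _
    rwa [op_id, Functor.map_id_apply]

/-- A predicate on points is invariant if it is constant along edges. -/
def IsInvariant (P : K _⦋0⦌ → Prop) : Prop :=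
  ∀ ⦃x y : K _⦋0⦌⦄, Joined x y → (P x ↔ P y)

lemma isInvariant_of_forward (hK : IsKan K) {P : K _⦋0⦌ → Prop}
    (h : ∀ ⦃x y : K _⦋0⦌⦄, Joined x y → P y → P x) : IsInvariant P :=
  fun _ _ hxy => ⟨h (hxy.symm hK), h hxy⟩

lemma range_le_fullSubcomplex_iff {P : L _⦋0⦌ → Prop} {f : K ⟶ L} :
    Subcomplex.range f ≤ fullSubcomplex L P ↔ ∀ x : K _⦋0⦌, P (f.app _ x) := by
  constructor
  · intro h x
    exact mem_fullSubcomplex_zero.1 (h _ ⟨x, rfl⟩)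
  · rintro h m _ ⟨x, rfl⟩ v
    rw [← NatTrans.naturality_apply]
    exact h _

/-- In dimension one the horn misses a vertex of the simplex. The vertex i always lies in Λ[n+1, i],
and every vertex is linked to it by an edge of the simplex, in one direction or the other. -/
lemma horn_vertex_joined {n : ℕ} (i : Fin (n + 2)) (v : (Δ[n + 1] : SSet.{u}) _⦋0⦌) :
    ∃ w : (Λ[n + 1, i] : SSet.{u}) _⦋0⦌, Joined v (w : (Δ[n + 1] : SSet.{u}) _⦋0⦌) ∨
      Joined (w : (Δ[n + 1] : SSet.{u}) _⦋0⦌) v := by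
  have hi : stdSimplex.obj₀Equiv.symm i ∈ (Λ[n + 1, i] : (Δ[n + 1] : SSet.{u}).Subcomplex).obj _ := by
    obtain ⟨j, hj⟩ := exists_ne i
    refine face_le_horn j i hj _ ?_
    rw [stdSimplex.obj₀Equiv_symm_mem_face_iff]
    simpa using hj.symm
  refine ⟨⟨_, hi⟩, ?_⟩
  obtain ⟨k, rfl⟩ := stdSimplex.obj₀Equiv.symm.surjective v
  have key : ∀ a b : Fin (n + 2), a ≤ b →
      Joined (K := (Δ[n + 1] : SSet.{u})) (stdSimplex.obj₀Equiv.symm a)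
        (stdSimplex.obj₀Equiv.symm b) := by
    intro a b hab
    refine ⟨stdSimplex.edge _ a b hab, ?_, ?_⟩
    · refine stdSimplex.ext _ _ fun j => ?_
      fin_cases j; rfl
    · refine stdSimplex.ext _ _ fun j => ?_
      fin_cases j; rfl
  rcases le_total k i with h | h
  · exact Or.inl (key _ _ h)
  · exact Or.inr (key _ _ h)

lemma range_le_fullSubcomplex_of_horn {P : L _⦋0⦌ → Prop} (hP : IsInvariant P) {n : ℕ}
    {i : Fin (n + 2)} (f : Δ[n + 1] ⟶ L)
    (h : ∀ w : (Λ[n + 1, i] : SSet.{u}) _⦋0⦌, P (f.app _ w)) :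
    Subcomplex.range f ≤ fullSubcomplex L P := by
  rw [range_le_fullSubcomplex_iff]
  intro v
  obtain ⟨w, hw | hw⟩ := horn_vertex_joined i v
  · exact (hP (hw.map f)).2 (h w)
  · exact (hP (hw.map f)).1 (h w)

/-- Membership of a simplex is a condition on its vertices, and an invariant condition passes from
the vertices of a horn to all vertices. A full subcomplex of this kind is a union of path
components. -/
lemma isKanFibration_fullSubcomplex_ι {P : K _⦋0⦌ → Prop} (hP : IsInvariant P) :
    IsKanFibration (fullSubcomplex K P).ι := by
  refine isKanFibration_iff.2 fun n i a b w => ?_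
  have hb : Subcomplex.range b ≤ fullSubcomplex K P := by
    refine range_le_fullSubcomplex_of_horn hP (i := i) b fun x => ?_
    have := ConcreteCategory.congr_hom (congr_app w _) x
    refine mem_fullSubcomplex_zero (P := P).1 ?_
    have h := (a.app _ x).2
    exact this ▸ h
  refine ⟨Subcomplex.lift b hb, ?_, Subcomplex.lift_ι _ _⟩
  rw [← cancel_mono (fullSubcomplex K P).ι, w]
  rfl

lemma IsInvariant.homotopic {P : L _⦋0⦌ → Prop} (hP : IsInvariant P) {f g : K ⟶ L}
    (h : Homotopic f g) (x : K _⦋0⦌) : P (f.app _ x) ↔ P (g.app _ x) :=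
  hP (h.joined x)

lemma exists_homotopy_lift_full {P : L _⦋0⦌ → Prop} (hP : IsInvariant P)
    {f g : K ⟶ (fullSubcomplex L P : SSet.{u})}
    (h : Homotopic (f ≫ (fullSubcomplex L P).ι) (g ≫ (fullSubcomplex L P).ι)) :
    Homotopic f g := by
  obtain ⟨h, h₀, h₁⟩ := h
  obtain ⟨H, hH₀, hH⟩ := (isKanFibration_fullSubcomplex_ι hP).exists_path_lift h f h₀.symm
  exact ⟨H, hH₀, by rw [← cancel_mono (fullSubcomplex L P).ι, Category.assoc, hH, h₁]⟩

/-- Equivalences restrict to equivalences between full subcomplexes that correspond to each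
other. -/
lemma IsEquivalence.full {f : K ⟶ L} (hf : IsEquivalence f) {P : K _⦋0⦌ → Prop}
    {Q : L _⦋0⦌ → Prop} (hPQ : ∀ x, P x ↔ Q (f.app _ x)) (hQ : IsInvariant Q)
    {f' : (fullSubcomplex K P : SSet.{u}) ⟶ (fullSubcomplex L Q : SSet.{u})}
    (hf' : f' ≫ (fullSubcomplex L Q).ι = (fullSubcomplex K P).ι ≫ f) : IsEquivalence f' := by
  have hP : IsInvariant P := fun x y hxy => by rw [hPQ, hPQ]; exact hQ (hxy.map f)
  obtain ⟨⟨g, hg⟩, k, hk⟩ := isEquivalence_iff.1 hf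
  have hQ' : ∀ x : (fullSubcomplex L Q : SSet.{u}) _⦋0⦌, Q x.1 :=
    fun x => mem_fullSubcomplex_zero.1 x.2
  have hg' : Subcomplex.range ((fullSubcomplex L Q).ι ≫ g) ≤ fullSubcomplex K P := by
    rw [range_le_fullSubcomplex_iff]
    intro x
    rw [hPQ]
    exact (hQ.homotopic hg x.1).2 (hQ' x)
  have hk' : Subcomplex.range ((fullSubcomplex L Q).ι ≫ k) ≤ fullSubcomplex K P := by
    rw [range_le_fullSubcomplex_iff]
    intro x
    -- The left inverse `k` is compared with the right inverse `g`: both `k x` and `g x` are joined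
    -- to `k (f (g x))`.
    have h₁ := (hg.joined x.1).map k
    have h₂ := hk.joined (g.app _ x.1)
    have h₃ : P (g.app _ x.1) := by
      rw [hPQ]
      exact (hQ.homotopic hg x.1).2 (hQ' x)
    exact (hP h₁).1 ((hP h₂).2 h₃)
  refine isEquivalence_iff.2 ⟨⟨Subcomplex.lift _ hg', ?_⟩, Subcomplex.lift _ hk', ?_⟩
  · apply exists_homotopy_lift_full hQ
    rw [Category.assoc, hf', Subcomplex.lift_ι_assoc]
    exact hg.precomp (fullSubcomplex L Q).ι
  · apply exists_homotopy_lift_full hP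
    have e : (f' ≫ Subcomplex.lift _ hk') ≫ (fullSubcomplex K P).ι =
        (fullSubcomplex K P).ι ≫ f ≫ k := by
      rw [Category.assoc, Subcomplex.lift_ι, reassoc_of% hf']
    rw [e]
    exact hk.precomp (fullSubcomplex K P).ι

end Full

/-- A homotopy right inverse hits y up to an edge, and lifting that edge gives a point exactly over
y. -/
lemma IsKanFibration.exists_point_of_isEquivalence {K L : SSet.{u}} {f : K ⟶ L}
    (hf : IsKanFibration f) (he : IsEquivalence f) (y : L _⦋0⦌) : ∃ x : K _⦋0⦌, f.app _ x = y := by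
  obtain ⟨⟨g, hg⟩, -⟩ := isEquivalence_iff.1 he
  obtain ⟨e, he₁, he₀⟩ := hg.joined y
  obtain ⟨e', -, he'⟩ := hf.exists_edge_lift (g.app _ y) e he₁
  refine ⟨K.δ 0 e', ?_⟩
  have := NatTrans.naturality_apply f (SimplexCategory.δ (0 : Fin 2)).op e'
  refine this.trans ?_
  rw [he']
  exact he₀

end SSet

namespace SimplicialSpace

open MonoidalCategory CartesianMonoidalCategory HomotopicalAlgebra SSet
open SSet.modelCategoryQuillen

/-! ### Cotensors -/

/-- The simplicial set `n ↦ Hom(K, X_n)`. -/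
def cot (X : SimplicialSpace.{u}) (K : SSet.{u}) : SSet.{u} where
  obj n := K ⟶ X.obj n
  map θ := TypeCat.ofHom fun g => g ≫ X.map θ
  map_id n := by
    refine ConcreteCategory.hom_ext _ _ fun g => ?_
    change g ≫ X.map (𝟙 n) = g
    rw [X.map_id, Category.comp_id]
  map_comp θ η := by
    refine ConcreteCategory.hom_ext _ _ fun g => ?_
    change g ≫ X.map (θ ≫ η) = (g ≫ X.map θ) ≫ X.map η
    rw [X.map_comp, Category.assoc]

/-- Functoriality of the cotensor in the space. -/
def cotRes (X : SimplicialSpace.{u}) {K L : SSet.{u}} (j : K ⟶ L) : cot X L ⟶ cot X K where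
  app _ := TypeCat.ofHom fun g => j ≫ g
  naturality _ _ _ := rfl

/-- Functoriality of the cotensor in the simplicial space. -/
def cotMap {X Y : SimplicialSpace.{u}} (p : X ⟶ Y) (K : SSet.{u}) : cot X K ⟶ cot Y K where
  app n := TypeCat.ofHom fun g => g ≫ p.app n
  naturality m n θ := by
    refine ConcreteCategory.hom_ext _ _ fun (g : K ⟶ X.obj m) => ?_
    change (g ≫ X.map θ) ≫ p.app n = (g ≫ p.app m) ≫ Y.map θ
    rw [Category.assoc, Category.assoc, p.naturality]

variable {A B K L : SSet.{u}} {X Y : SimplicialSpace.{u}}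

/-- Maps into a mapping space are maps into a cotensor. -/
def toCot (f : K ⟶ mapSpace A X) : A ⟶ cot X K where
  app n := TypeCat.ofHom fun a =>
    { app l := TypeCat.ofHom fun k => (show A ⟶ row X l from f.app l k).app n a
      naturality l m φ := by
        refine ConcreteCategory.hom_ext _ _ fun k => ?_
        exact congr_arg (fun s : A ⟶ row X m => s.app n a) (NatTrans.naturality_apply f φ k) }
  naturality m n θ := by
    refine ConcreteCategory.hom_ext _ _ fun a => SSet.hom_ext fun l => ?_
    refine ConcreteCategory.hom_ext _ _ fun k => ?_
    exact NatTrans.naturality_apply (show A ⟶ row X l from f.app l k) θ a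

/-- The inverse of `toCot`. -/
def ofCot (g : A ⟶ cot X K) : K ⟶ mapSpace A X where
  app l := TypeCat.ofHom fun k =>
    (show A ⟶ row X l from
    { app n := TypeCat.ofHom fun a => (show K ⟶ X.obj n from g.app n a).app l k
      naturality m n θ := by
        refine ConcreteCategory.hom_ext _ _ fun a => ?_
        exact congr_arg (fun s : K ⟶ X.obj n => s.app l k) (NatTrans.naturality_apply g θ a) })
  naturality l m φ := by
    refine ConcreteCategory.hom_ext _ _ fun k => SSet.hom_ext fun n => ?_
    refine ConcreteCategory.hom_ext _ _ fun a => ?_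
    exact NatTrans.naturality_apply (show K ⟶ X.obj n from g.app n a) φ k

lemma toCot_ofCot (g : A ⟶ cot X K) : toCot (ofCot g) = g := rfl

lemma ofCot_toCot (f : K ⟶ mapSpace A X) : ofCot (toCot f) = f := rfl

lemma toCot_injective {f g : K ⟶ mapSpace A X} (h : toCot f = toCot g) : f = g := by
  rw [← ofCot_toCot f, h, ofCot_toCot]

lemma toCot_restrict (i : A ⟶ B) (f : K ⟶ mapSpace B X) :
    toCot (f ≫ restrict i X) = i ≫ toCot f := rfl

lemma toCot_postcomp (p : X ⟶ Y) (f : K ⟶ mapSpace A X) :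
    toCot (f ≫ postcomp A p) = toCot f ≫ cotMap p K := rfl

lemma cotRes_cotMap (p : X ⟶ Y) (j : K ⟶ L) :
    cotRes X j ≫ cotMap p K = cotMap p L ≫ cotRes Y j := rfl

/-! ### The relative restriction maps -/

/-- The map `Map(B, X) ⟶ Map(A, X) ×_{Map(A, Y)} Map(B, Y)`. -/
noncomputable abbrev relMap (p : X ⟶ Y) (i : A ⟶ B) :
    mapSpace B X ⟶ pullback (postcomp A p) (restrict i Y) :=
  pullback.lift (restrict i X) (postcomp B p) (restrict_postcomp i p)

/-- The analogue of `relMap` for cotensors. -/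
noncomputable abbrev cotRelMap (p : X ⟶ Y) (j : K ⟶ L) :
    cot X L ⟶ pullback (cotMap p K) (cotRes Y j) :=
  pullback.lift (cotRes X j) (cotMap p L) (cotRes_cotMap p j)

/-- Both sides express the extension of a map from A × L ∪ B × K to B × L, relative to Y. The
categorical direction i and the space direction j play symmetric roles. -/
lemma hasLiftingProperty_relMap_iff (p : X ⟶ Y) (i : A ⟶ B) (j : K ⟶ L) :
    HasLiftingProperty j (relMap p i) ↔ HasLiftingProperty i (cotRelMap p j) := by
  constructor
  · intro h
    refine ⟨fun {f g} sq => ⟨?_⟩⟩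
    have h₁ : f ≫ cotRes X j = i ≫ g ≫ pullback.fst _ _ := by
      have := sq.w =≫ pullback.fst _ _
      rwa [Category.assoc, pullback.lift_fst, Category.assoc] at this
    have h₂ : f ≫ cotMap p L = i ≫ g ≫ pullback.snd _ _ := by
      have := sq.w =≫ pullback.snd _ _
      rwa [Category.assoc, pullback.lift_snd, Category.assoc] at this
    have h₃ := g ≫= pullback.condition (f := cotMap p K) (g := cotRes Y j)
    have sq' : CommSq (ofCot (g ≫ pullback.fst _ _)) j (relMap p i)
        (pullback.lift (ofCot f) (ofCot (g ≫ pullback.snd _ _)) (toCot_injective h₂)) := by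
      refine ⟨pullback.hom_ext ?_ ?_⟩
      · rw [Category.assoc, pullback.lift_fst, Category.assoc, pullback.lift_fst]
        exact toCot_injective h₁.symm
      · rw [Category.assoc, pullback.lift_snd, Category.assoc, pullback.lift_snd]
        exact toCot_injective ((Category.assoc _ _ _).trans (h₃.trans (Category.assoc _ _ _).symm))
    have h₄ := sq'.fac_right =≫ pullback.fst _ _
    have h₅ := sq'.fac_right =≫ pullback.snd _ _
    rw [Category.assoc, pullback.lift_fst, pullback.lift_fst] at h₄
    rw [Category.assoc, pullback.lift_snd, pullback.lift_snd] at h₅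
    refine ⟨⟨toCot sq'.lift, congr_arg toCot h₄, pullback.hom_ext ?_ ?_⟩⟩
    · rw [Category.assoc, pullback.lift_fst]
      exact congr_arg toCot sq'.fac_left
    · rw [Category.assoc, pullback.lift_snd]
      exact congr_arg toCot h₅
  · intro h
    refine ⟨fun {f g} sq => ⟨?_⟩⟩
    have h₁ : f ≫ restrict i X = j ≫ g ≫ pullback.fst _ _ := by
      have := sq.w =≫ pullback.fst _ _
      rwa [Category.assoc, pullback.lift_fst, Category.assoc] at this
    have h₂ : f ≫ postcomp B p = j ≫ g ≫ pullback.snd _ _ := by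
      have := sq.w =≫ pullback.snd _ _
      rwa [Category.assoc, pullback.lift_snd, Category.assoc] at this
    have h₃ := g ≫= pullback.condition (f := postcomp A p) (g := restrict i Y)
    have h₂' : toCot f ≫ cotMap p K = toCot (g ≫ pullback.snd _ _) ≫ cotRes Y j :=
      congr_arg toCot h₂
    have sq' : CommSq (toCot (g ≫ pullback.fst _ _)) i (cotRelMap p j)
        (pullback.lift (toCot f) (toCot (g ≫ pullback.snd _ _)) h₂') := by
      refine ⟨pullback.hom_ext ?_ ?_⟩
      · rw [Category.assoc, pullback.lift_fst, Category.assoc, pullback.lift_fst]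
        exact congr_arg toCot h₁.symm
      · rw [Category.assoc, pullback.lift_snd, Category.assoc, pullback.lift_snd]
        exact congr_arg toCot ((Category.assoc _ _ _).trans (h₃.trans (Category.assoc _ _ _).symm))
    have h₄ := sq'.fac_right =≫ pullback.fst _ _
    have h₅ := sq'.fac_right =≫ pullback.snd _ _
    rw [Category.assoc, pullback.lift_fst, pullback.lift_fst] at h₄
    rw [Category.assoc, pullback.lift_snd, pullback.lift_snd] at h₅
    refine ⟨⟨ofCot sq'.lift, toCot_injective h₄, pullback.hom_ext ?_ ?_⟩⟩
    · rw [Category.assoc, pullback.lift_fst]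
      exact toCot_injective sq'.fac_left
    · rw [Category.assoc, pullback.lift_snd]
      exact toCot_injective h₅

lemma hasLiftingProperty_restrict_iff (i : A ⟶ B) (j : K ⟶ L) :
    HasLiftingProperty j (restrict i X) ↔ HasLiftingProperty i (cotRes X j) := by
  constructor
  · intro h
    refine ⟨fun {f g} sq => ⟨?_⟩⟩
    have sq' : CommSq (ofCot g) j (restrict i X) (ofCot f) := ⟨toCot_injective sq.w.symm⟩
    exact ⟨⟨toCot sq'.lift, congr_arg toCot sq'.fac_right, congr_arg toCot sq'.fac_left⟩⟩
  · intro h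
    refine ⟨fun {f g} sq => ⟨?_⟩⟩
    have sq' : CommSq (toCot g) i (cotRes X j) (toCot f) := ⟨congr_arg toCot sq.w.symm⟩
    exact ⟨⟨ofCot sq'.lift, toCot_injective sq'.fac_right, toCot_injective sq'.fac_left⟩⟩

lemma isReedyFibration_iff {p : X ⟶ Y} : IsReedyFibration p ↔
    ∀ (n : ℕ) (m : ℕ) (k : Fin (m + 2)),
      HasLiftingProperty Λ[m + 1, k].ι (relMap p (∂Δ[n] : (Δ[n] : SSet.{u}).Subcomplex).ι) := by
  constructor
  · intro h n m k
    exact (h n).hasLiftingProperty (anodyneExtensions.horn_ι k)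
  · intro h n
    refine isKanFibration_iff.2 fun m k a b w => ?_
    have := h n m k
    have sq : CommSq a _ _ b := ⟨w⟩
    exact ⟨sq.lift, sq.fac_left, sq.fac_right⟩

/-- Exchanging the two directions, the Reedy condition says that `cotRelMap p` of a horn inclusion
lifts against boundaries. It then lifts against all monomorphisms, and exchanging back replaces
∂Δ[n] ⊂ Δ[n] by an arbitrary i. -/
lemma IsReedyFibration.isKanFibration_relMap {p : X ⟶ Y} (hp : IsReedyFibration p) (i : A ⟶ B)
    [Mono i] : IsKanFibration (relMap p i) := by
  refine isKanFibration_iff.2 fun m k a b w => ?_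
  have h : IsTrivialFibration (cotRelMap p (Λ[m + 1, k] : (Δ[m + 1] : SSet.{u}).Subcomplex).ι) := by
    rintro _ _ _ ⟨n⟩
    exact (hasLiftingProperty_relMap_iff _ _ _).1 (isReedyFibration_iff.1 hp n m k)
  have := (hasLiftingProperty_relMap_iff p i Λ[m + 1, k].ι).2 (h.hasLiftingProperty i)
  have sq : CommSq a _ _ b := ⟨w⟩
  exact ⟨sq.lift, sq.fac_left, sq.fac_right⟩

lemma IsReedyFibrant.isKanFibration_restrict (hX : IsReedyFibrant X) (i : A ⟶ B) [Mono i] :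
    IsKanFibration (restrict i X) := by
  refine isKanFibration_iff.2 fun m k a b w => ?_
  have h : IsTrivialFibration (cotRes X (Λ[m + 1, k] : (Δ[m + 1] : SSet.{u}).Subcomplex).ι) := by
    rintro _ _ _ ⟨n⟩
    exact (hasLiftingProperty_restrict_iff _ _).1
      ((hX n).hasLiftingProperty (anodyneExtensions.horn_ι k))
  have := (hasLiftingProperty_restrict_iff (X := X) i Λ[m + 1, k].ι).2 (h.hasLiftingProperty i)
  have sq : CommSq a _ _ b := ⟨w⟩
  exact ⟨sq.lift, sq.fac_left, sq.fac_right⟩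

/-! ### Representable mapping spaces -/

/-- The isomorphism `Map(F(n), X) ≅ X_n`. -/
def evIso (X : SimplicialSpace.{u}) (n : ℕ) : mapSpace Δ[n] X ≅ X _⦋n⦌ :=
  NatIso.ofComponents (fun l => (show (Δ[n] ⟶ row X l) ≃ (row X l) _⦋n⦌ from SSet.yonedaEquiv).toIso)
    fun {l m} φ => by
      refine ConcreteCategory.hom_ext _ _ fun (s : Δ[n] ⟶ row X l) => ?_
      exact SSet.yonedaEquiv_comp s (rowMap X φ)

lemma restrict_map_evIso {m n : ℕ} (θ : ⦋m⦌ ⟶ ⦋n⦌) :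
    restrict (SSet.stdSimplex.map θ) X ≫ (evIso X m).hom = (evIso X n).hom ≫ X.map θ.op := by
  refine SSet.hom_ext fun l => ConcreteCategory.hom_ext _ _ fun (s : Δ[n] ⟶ row X l) => ?_
  exact (SSet.yonedaEquiv_naturality (X := row X l) θ s).symm

lemma restrict_δ_evIso {n : ℕ} (i : Fin (n + 2)) :
    restrict (SSet.stdSimplex.δ i) X ≫ (evIso X n).hom = (evIso X (n + 1)).hom ≫ X.δ i :=
  restrict_map_evIso _

lemma postcomp_evIso (p : X ⟶ Y) (n : ℕ) :
    postcomp Δ[n] p ≫ (evIso Y n).hom = (evIso X n).hom ≫ p.app (op ⦋n⦌) := by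
  refine SSet.hom_ext fun l => ConcreteCategory.hom_ext _ _ fun (s : Δ[n] ⟶ row X l) => ?_
  exact SSet.yonedaEquiv_comp s (rowHom p l)

lemma restrict_comp {E : SSet.{u}} (i : A ⟶ B) (j : B ⟶ E) :
    restrict (i ≫ j) X = restrict j X ≫ restrict i X := rfl

lemma restrict_id : restrict (𝟙 A) X = 𝟙 _ := rfl

lemma isPullback_restrict {A₀ B₀ : SSet.{u}} {a : A₀ ⟶ A} {i₀ : A₀ ⟶ B₀} {i : A ⟶ B} {b : B₀ ⟶ B}
    (sq : IsPushout a i₀ i b) :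
    IsPullback (restrict b X) (restrict i X) (restrict i₀ X) (restrict a X) := by
  have w (s : PullbackCone (restrict i₀ X) (restrict a X)) :
      a ≫ toCot s.snd = i₀ ≫ toCot s.fst := (congr_arg toCot s.condition).symm
  refine ⟨⟨by rw [← restrict_comp, ← restrict_comp, sq.w]⟩, ⟨PullbackCone.IsLimit.mk _
    (fun s => ofCot (sq.desc (toCot s.snd) (toCot s.fst) (w s))) ?_ ?_ ?_⟩⟩
  · intro s
    exact toCot_injective (sq.inr_desc _ _ _)
  · intro s
    exact toCot_injective (sq.inl_desc _ _ _)
  · intro s m h₁ h₂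
    refine toCot_injective (sq.hom_ext ?_ ?_)
    · rw [toCot_ofCot, sq.inl_desc]; exact congr_arg toCot h₂
    · rw [toCot_ofCot, sq.inr_desc]; exact congr_arg toCot h₁

end SimplicialSpace

/-! ### Simplices of a pullback -/

namespace SSet

section Pullback

variable {P X Y Z : SSet.{u}} {fst : P ⟶ X} {snd : P ⟶ Y} {f : X ⟶ Z} {g : Y ⟶ Z}

lemma exists_simplex_of_isPullback (sq : IsPullback fst snd f g) {m : ℕ} (x : X _⦋m⦌) (y : Y _⦋m⦌)
    (h : f.app _ x = g.app _ y) : ∃ z : P _⦋m⦌, fst.app _ z = x ∧ snd.app _ z = y := by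
  have w : yonedaEquiv.symm x ≫ f = yonedaEquiv.symm y ≫ g := by
    rw [yonedaEquiv_symm_comp, yonedaEquiv_symm_comp, h]
  refine ⟨yonedaEquiv (sq.lift _ _ w), ?_, ?_⟩
  · rw [← yonedaEquiv_comp, sq.lift_fst]
    exact yonedaEquiv.apply_symm_apply x
  · rw [← yonedaEquiv_comp, sq.lift_snd]
    exact yonedaEquiv.apply_symm_apply y

lemma simplex_ext_of_isPullback (sq : IsPullback fst snd f g) {m : ℕ} {z z' : P _⦋m⦌}
    (h₁ : fst.app _ z = fst.app _ z') (h₂ : snd.app _ z = snd.app _ z') : z = z' := by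
  refine yonedaEquiv.symm.injective (sq.hom_ext ?_ ?_)
  · rw [yonedaEquiv_symm_comp, yonedaEquiv_symm_comp, h₁]
  · rw [yonedaEquiv_symm_comp, yonedaEquiv_symm_comp, h₂]

end Pullback

end SSet

/-! ### Contractible spaces of relative extensions -/

namespace SimplicialSpace

open MonoidalCategory CartesianMonoidalCategory HomotopicalAlgebra SSet
open SSet.modelCategoryQuillen

variable {A B B' : SSet.{u}} {X Y : SimplicialSpace.{u}}

/-- The simplicial set of points of a simplicial space. -/
abbrev points (X : SimplicialSpace.{u}) : SSet.{u} := row X (op ⦋0⦌)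

/-- The map induced on simplicial sets of points. -/
abbrev pointsMap (p : X ⟶ Y) : points X ⟶ points Y := rowHom p (op ⦋0⦌)

/-- The space of extensions of `α : A ⟶ X` to `B` over `γ : B ⟶ Y` is contractible. -/
def RelContractible (p : X ⟶ Y) (i : A ⟶ B) (α : A ⟶ points X) (γ : B ⟶ points Y) : Prop :=
  ∀ t : (pullback (postcomp A p) (restrict i Y)) _⦋0⦌,
    (pullback.fst (postcomp A p) (restrict i Y)).app _ t = α →
    (pullback.snd (postcomp A p) (restrict i Y)).app _ t = γ → ContractibleAt (relMap p i) t

/-- `RelContractible` holds vacuously when α and γ do not agree on A; for compatible data this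
supplies the point at which it has content. -/
lemma exists_relPoint (p : X ⟶ Y) (i : A ⟶ B) (α : A ⟶ points X) (γ : B ⟶ points Y)
    (h : α ≫ pointsMap p = i ≫ γ) : ∃ t : (pullback (postcomp A p) (restrict i Y)) _⦋0⦌,
      (pullback.fst (postcomp A p) (restrict i Y)).app _ t = α ∧
      (pullback.snd (postcomp A p) (restrict i Y)).app _ t = γ :=
  exists_simplex_of_isPullback (IsPullback.of_hasPullback _ _) _ _ h

lemma relContractible_of_isTrivialFibration {p : X ⟶ Y} {i : A ⟶ B}
    (h : IsTrivialFibration (relMap p i)) (α : A ⟶ points X) (γ : B ⟶ points Y) :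
    RelContractible p i α γ := fun t _ _ => h.contractibleAt t

lemma relMap_fst (p : X ⟶ Y) (i : A ⟶ B) :
    relMap p i ≫ pullback.fst (postcomp A p) (restrict i Y) = restrict i X :=
  pullback.lift_fst _ _ _

lemma relMap_snd (p : X ⟶ Y) (i : A ⟶ B) :
    relMap p i ≫ pullback.snd (postcomp A p) (restrict i Y) = postcomp B p :=
  pullback.lift_snd _ _ _

lemma relMap_fst_app (p : X ⟶ Y) (i : A ⟶ B) {m : SimplexCategoryᵒᵖ} (β : (mapSpace B X).obj m) :
    (pullback.fst (postcomp A p) (restrict i Y)).app _ ((relMap p i).app m β) =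
      (restrict i X).app m β :=
  ConcreteCategory.congr_hom (congr_app (relMap_fst p i) m) β

lemma relMap_snd_app (p : X ⟶ Y) (i : A ⟶ B) {m : SimplexCategoryᵒᵖ} (β : (mapSpace B X).obj m) :
    (pullback.snd (postcomp A p) (restrict i Y)).app _ ((relMap p i).app m β) =
      (postcomp B p).app m β :=
  ConcreteCategory.congr_hom (congr_app (relMap_snd p i) m) β

lemma RelContractible.exists_extension {p : X ⟶ Y} {i : A ⟶ B} {α : A ⟶ points X}
    {γ : B ⟶ points Y} (h : RelContractible p i α γ) (w : α ≫ pointsMap p = i ≫ γ) :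
    ∃ β : B ⟶ points X, i ≫ β = α ∧ β ≫ pointsMap p = γ := by
  obtain ⟨t, rfl, rfl⟩ := exists_relPoint p i α γ w
  obtain ⟨β, hβ⟩ := (h t rfl rfl).exists_point
  refine ⟨β, ?_, ?_⟩
  · rw [← hβ]; exact (relMap_fst_app p i β).symm
  · rw [← hβ]; exact (relMap_snd_app p i β).symm

/-! ### Pushouts -/

section Pushout

variable {A₀ B₀ : SSet.{u}} {a : A₀ ⟶ A} {i₀ : A₀ ⟶ B₀} {i : A ⟶ B} {b : B₀ ⟶ B}

/-- The map between the targets of two relative restriction maps. -/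
noncomputable abbrev relTargetMap (p : X ⟶ Y) (w : a ≫ i = i₀ ≫ b) :
    pullback (postcomp A p) (restrict i Y) ⟶ pullback (postcomp A₀ p) (restrict i₀ Y) :=
  pullback.map _ _ _ _ (restrict a X) (restrict b Y) (restrict a Y) rfl
    (by rw [← restrict_comp, ← restrict_comp, w])

lemma relTargetMap_fst (p : X ⟶ Y) (w : a ≫ i = i₀ ≫ b) :
    relTargetMap p w ≫ pullback.fst _ _ = pullback.fst _ _ ≫ restrict a X :=
  pullback.lift_fst _ _ _

lemma relTargetMap_snd (p : X ⟶ Y) (w : a ≫ i = i₀ ≫ b) :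
    relTargetMap p w ≫ pullback.snd _ _ = pullback.snd _ _ ≫ restrict b Y :=
  pullback.lift_snd _ _ _

/-- Mapping spaces turn the pushout into pullbacks for X and for Y, and pasting them makes the
relative map of a cobase change a base change of the original one. -/
lemma isPullback_relMap (p : X ⟶ Y) (sq : IsPushout a i₀ i b) :
    IsPullback (restrict b X) (relMap p i) (relMap p i₀) (relTargetMap p sq.w) := by
  have h₁ : IsPullback (relTargetMap p sq.w) (pullback.fst (postcomp A p) (restrict i Y))
      (pullback.fst (postcomp A₀ p) (restrict i₀ Y)) (restrict a X) := by
    refine IsPullback.of_right (h₁₂ := pullback.snd _ _) (h₂₂ := postcomp A₀ p) ?_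
      (relTargetMap_fst p sq.w) (IsPullback.of_hasPullback _ _).flip
    rw [relTargetMap_snd]
    exact (IsPullback.of_hasPullback (postcomp A p) (restrict i Y)).flip.paste_horiz
      (isPullback_restrict (X := Y) sq)
  have h₂ := isPullback_restrict (X := X) sq
  rw [← relMap_fst p i, ← relMap_fst p i₀] at h₂
  refine IsPullback.of_bot h₂ (pullback.hom_ext ?_ ?_) h₁
  · rw [Category.assoc, Category.assoc, relTargetMap_fst, relMap_fst, ← Category.assoc (relMap _ _), relMap_fst,
      ← restrict_comp, ← restrict_comp, sq.w]
  · rw [Category.assoc, Category.assoc, relTargetMap_snd, relMap_snd, ← Category.assoc (relMap _ _), relMap_snd]; rfl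

lemma relTargetMap_fst_app (p : X ⟶ Y) (w : a ≫ i = i₀ ≫ b) {m : SimplexCategoryᵒᵖ}
    (t : (pullback (postcomp A p) (restrict i Y)).obj m) :
    (pullback.fst (postcomp A₀ p) (restrict i₀ Y)).app m ((relTargetMap p w).app m t) =
      (restrict a X).app m ((pullback.fst (postcomp A p) (restrict i Y)).app m t) :=
  ConcreteCategory.congr_hom (congr_app (relTargetMap_fst p w) m) t

lemma relTargetMap_snd_app (p : X ⟶ Y) (w : a ≫ i = i₀ ≫ b) {m : SimplexCategoryᵒᵖ}
    (t : (pullback (postcomp A p) (restrict i Y)).obj m) :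
    (pullback.snd (postcomp A₀ p) (restrict i₀ Y)).app m ((relTargetMap p w).app m t) =
      (restrict b Y).app m ((pullback.snd (postcomp A p) (restrict i Y)).app m t) :=
  ConcreteCategory.congr_hom (congr_app (relTargetMap_snd p w) m) t

lemma RelContractible.of_isPushout {p : X ⟶ Y} (sq : IsPushout a i₀ i b) {α : A ⟶ points X}
    {γ : B ⟶ points Y} (h : RelContractible p i₀ (a ≫ α) (b ≫ γ)) : RelContractible p i α γ := by
  rintro t rfl rfl
  rw [contractibleAt_iff_of_isPullback (isPullback_relMap p sq)]
  exact h _ (relTargetMap_fst_app p sq.w t) (relTargetMap_snd_app p sq.w t)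

/-- The fibers agree, but descent from i to i₀ needs the compatibility of α and γ, so that the
extension problem for i₀ comes from one for i. -/
lemma RelContractible.of_isPushout' {p : X ⟶ Y} (sq : IsPushout a i₀ i b) {α : A ⟶ points X}
    {γ : B ⟶ points Y} (h : RelContractible p i α γ) (w : α ≫ pointsMap p = i ≫ γ) :
    RelContractible p i₀ (a ≫ α) (b ≫ γ) := by
  intro t ht₁ ht₂
  obtain ⟨s, hs₁, hs₂⟩ := exists_relPoint p i α γ w
  have := (contractibleAt_iff_of_isPullback (isPullback_relMap p sq) s).1 (h s hs₁ hs₂)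
  obtain rfl : t = _ := simplex_ext_of_isPullback (IsPullback.of_hasPullback _ _)
    (ht₁.trans ((relTargetMap_fst_app p sq.w s).trans
      (congr_arg ((restrict a X).app (op ⦋0⦌)) hs₁)).symm)
    (ht₂.trans ((relTargetMap_snd_app p sq.w s).trans
      (congr_arg ((restrict b Y).app (op ⦋0⦌)) hs₂)).symm)
  exact this

end Pushout

/-! ### Compositions -/

section Comp

/-- The map `T(j) ⟶ T(i ≫ j)` through which `relMap p (i ≫ j)` factors. -/
noncomputable abbrev relTau (p : X ⟶ Y) (i : A ⟶ B) (j : B ⟶ B') :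
    pullback (postcomp B p) (restrict j Y) ⟶ pullback (postcomp A p) (restrict (i ≫ j) Y) :=
  pullback.map _ _ _ _ (restrict i X) (𝟙 _) (restrict i Y) rfl rfl

lemma relTau_fst (p : X ⟶ Y) (i : A ⟶ B) (j : B ⟶ B') :
    relTau p i j ≫ pullback.fst _ _ = pullback.fst _ _ ≫ restrict i X :=
  pullback.lift_fst _ _ _

lemma relTau_snd (p : X ⟶ Y) (i : A ⟶ B) (j : B ⟶ B') :
    relTau p i j ≫ pullback.snd _ _ = pullback.snd _ _ :=
  (pullback.lift_snd _ _ _).trans (Category.comp_id _)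

lemma relMap_comp_relTau (p : X ⟶ Y) (i : A ⟶ B) (j : B ⟶ B') :
    relMap p j ≫ relTau p i j = relMap p (i ≫ j) := by
  apply pullback.hom_ext
  · rw [Category.assoc, relTau_fst, ← Category.assoc, relMap_fst, relMap_fst]; rfl
  · rw [Category.assoc, relTau_snd, relMap_snd, relMap_snd]

/-- The map `T(i ≫ j) ⟶ T(i)`. -/
noncomputable abbrev relSigma (p : X ⟶ Y) (i : A ⟶ B) (j : B ⟶ B') :
    pullback (postcomp A p) (restrict (i ≫ j) Y) ⟶ pullback (postcomp A p) (restrict i Y) :=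
  pullback.map _ _ _ _ (𝟙 _) (restrict j Y) (𝟙 _) rfl (by rw [Category.comp_id]; rfl)

lemma relSigma_fst (p : X ⟶ Y) (i : A ⟶ B) (j : B ⟶ B') :
    relSigma p i j ≫ pullback.fst _ _ = pullback.fst _ _ :=
  (pullback.lift_fst _ _ _).trans (Category.comp_id _)

lemma relSigma_snd (p : X ⟶ Y) (i : A ⟶ B) (j : B ⟶ B') :
    relSigma p i j ≫ pullback.snd _ _ = pullback.snd _ _ ≫ restrict j Y :=
  pullback.lift_snd _ _ _

/-- `relMap p (i ≫ j)` is `relMap p j` followed by `relTau`. Since `relTau` is a base change of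
`relMap p i`, two-out-of-three for fibers applies to composable inclusions. -/
lemma isPullback_relTau (p : X ⟶ Y) (i : A ⟶ B) (j : B ⟶ B') :
    IsPullback (pullback.fst (postcomp B p) (restrict j Y)) (relTau p i j) (relMap p i)
      (relSigma p i j) := by
  have h₁ : IsPullback (relSigma p i j) (pullback.snd (postcomp A p) (restrict (i ≫ j) Y))
      (pullback.snd (postcomp A p) (restrict i Y)) (restrict j Y) := by
    refine IsPullback.of_right ?_ (relSigma_snd p i j) (IsPullback.of_hasPullback _ _)
    rw [relSigma_fst]
    exact IsPullback.of_hasPullback _ _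
  refine IsPullback.of_bot ?_ (pullback.hom_ext ?_ ?_) h₁
  · rw [relTau_snd, relMap_snd]
    exact IsPullback.of_hasPullback _ _
  · rw [Category.assoc, Category.assoc, relSigma_fst, relTau_fst, relMap_fst]
  · rw [Category.assoc, Category.assoc, relSigma_snd, ← Category.assoc (relTau _ _ _), relTau_snd, relMap_snd,
      pullback.condition]

variable {p : X ⟶ Y} {i : A ⟶ B} {j : B ⟶ B'}

lemma contractibleAt_relTau {α : A ⟶ points X} {γ : B' ⟶ points Y}
    (h : RelContractible p i α (j ≫ γ)) {t : (pullback (postcomp A p) (restrict (i ≫ j) Y)) _⦋0⦌}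
    (h₁ : (pullback.fst (postcomp A p) (restrict (i ≫ j) Y)).app _ t = α)
    (h₂ : (pullback.snd (postcomp A p) (restrict (i ≫ j) Y)).app _ t = γ) :
    ContractibleAt (relTau p i j) t := by
  rw [contractibleAt_iff_of_isPullback (isPullback_relTau p i j)]
  refine h _ ?_ ?_
  · rw [← h₁]
    exact ConcreteCategory.congr_hom (congr_app (relSigma_fst p i j) _) t
  · rw [← h₂]
    exact ConcreteCategory.congr_hom (congr_app (relSigma_snd p i j) _) t

lemma relContractible_of_contractibleAt_relTau {α : A ⟶ points X} {γ : B' ⟶ points Y}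
    (h : ∀ t : (pullback (postcomp A p) (restrict (i ≫ j) Y)) _⦋0⦌,
      (pullback.fst (postcomp A p) (restrict (i ≫ j) Y)).app _ t = α →
      (pullback.snd (postcomp A p) (restrict (i ≫ j) Y)).app _ t = γ →
      ContractibleAt (relTau p i j) t) (w : α ≫ pointsMap p = i ≫ j ≫ γ) :
    RelContractible p i α (j ≫ γ) := by
  intro t ht₁ ht₂
  obtain ⟨s, hs₁, hs₂⟩ := exists_relPoint p (i ≫ j) α γ (by rw [w, Category.assoc])
  have := (contractibleAt_iff_of_isPullback (isPullback_relTau p i j) s).1 (h s hs₁ hs₂)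
  obtain rfl : t = _ := simplex_ext_of_isPullback (IsPullback.of_hasPullback _ _)
    (ht₁.trans ((ConcreteCategory.congr_hom (congr_app (relSigma_fst p i j) _) s).trans hs₁).symm)
    (ht₂.trans ((ConcreteCategory.congr_hom (congr_app (relSigma_snd p i j) _) s).trans
      (congr_arg ((restrict j Y).app (op ⦋0⦌)) hs₂)).symm)
  exact this

lemma contractibleAt_relMap_of_relTau {α : A ⟶ points X} {γ : B' ⟶ points Y}
    (h : ∀ β : B ⟶ points X, i ≫ β = α → β ≫ pointsMap p = j ≫ γ → RelContractible p j β γ)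
    {t : (pullback (postcomp B p) (restrict j Y)) _⦋0⦌}
    {s : (pullback (postcomp A p) (restrict (i ≫ j) Y)) _⦋0⦌} (hs : (relTau p i j).app _ t = s)
    (h₁ : (pullback.fst (postcomp A p) (restrict (i ≫ j) Y)).app _ s = α)
    (h₂ : (pullback.snd (postcomp A p) (restrict (i ≫ j) Y)).app _ s = γ) :
    ContractibleAt (relMap p j) t := by
  subst hs h₁ h₂
  have e₁ := ConcreteCategory.congr_hom (congr_app (relTau_fst p i j) (op ⦋0⦌)) t
  have e₂ := ConcreteCategory.congr_hom (congr_app (relTau_snd p i j) (op ⦋0⦌)) t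
  refine h _ e₁.symm ?_ t rfl e₂.symm
  have e₃ := ConcreteCategory.congr_hom (congr_app
    (pullback.condition (f := postcomp B p) (g := restrict j Y)) (op ⦋0⦌)) t
  exact e₃.trans (congr_arg ((restrict j Y).app (op ⦋0⦌)) e₂.symm)

/-- This and the next two lemmas are two-out-of-three for extension in two stages. The assumption on
the second stage ranges over all the intermediate extensions β. -/
lemma RelContractible.comp (hp : IsReedyFibration p) [Mono j] {α : A ⟶ points X}
    {γ : B' ⟶ points Y} (h₁ : RelContractible p i α (j ≫ γ))
    (h₂ : ∀ β : B ⟶ points X, i ≫ β = α → β ≫ pointsMap p = j ≫ γ → RelContractible p j β γ) :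
    RelContractible p (i ≫ j) α γ := by
  intro t ht₁ ht₂
  rw [← relMap_comp_relTau]
  exact (contractibleAt_relTau h₁ ht₁ ht₂).comp (hp.isKanFibration_relMap j)
    fun y hy => contractibleAt_relMap_of_relTau h₂ hy ht₁ ht₂

lemma RelContractible.of_comp_right (hp : IsReedyFibration p) [Mono j] {α : A ⟶ points X}
    {γ : B' ⟶ points Y} (h : RelContractible p (i ≫ j) α γ)
    (h₂ : ∀ β : B ⟶ points X, i ≫ β = α → β ≫ pointsMap p = j ≫ γ → RelContractible p j β γ)
    (w : α ≫ pointsMap p = i ≫ j ≫ γ) :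
    RelContractible p i α (j ≫ γ) := by
  refine relContractible_of_contractibleAt_relTau (fun t ht₁ ht₂ => ?_) w
  have := h t ht₁ ht₂
  rw [← relMap_comp_relTau] at this
  exact this.of_comp_right (hp.isKanFibration_relMap j)
    fun y hy => contractibleAt_relMap_of_relTau h₂ hy ht₁ ht₂

lemma RelContractible.of_comp_left (hp : IsReedyFibration p) [Mono j] {β : B ⟶ points X}
    {γ : B' ⟶ points Y} (h₁ : RelContractible p i (i ≫ β) (j ≫ γ))
    (h : RelContractible p (i ≫ j) (i ≫ β) γ) : RelContractible p j β γ := by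
  rintro t rfl rfl
  have e₁ := ConcreteCategory.congr_hom (congr_app (relTau_fst p i j) (op ⦋0⦌)) t
  have e₂ := ConcreteCategory.congr_hom (congr_app (relTau_snd p i j) (op ⦋0⦌)) t
  have h₃ := h ((relTau p i j).app _ t) e₁ e₂
  rw [← relMap_comp_relTau] at h₃
  exact ContractibleAt.of_comp_left (hp.isKanFibration_relMap j) (contractibleAt_relTau h₁ e₁ e₂)
    h₃ rfl

end Comp

/-! ### Invariance -/

/-- Contractibility of spaces of extensions of `α` only depends on the component of the restriction
of `α` to a subobject, if it holds for all the extensions of this restriction. -/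
lemma isInvariant_relContractible {p : X ⟶ Y} (hp : IsReedyFibration p) (hX : IsReedyFibrant X)
    (hY : IsReedyFibrant Y) {A' : SSet.{u}} (k : A' ⟶ A) [Mono k] (i : A ⟶ B) [Mono i]
    (hk : IsKan (mapSpace A' X)) :
    IsInvariant (K := mapSpace A' X) fun f => ∀ (α : A ⟶ points X) (γ : B ⟶ points Y), k ≫ α = f →
      RelContractible p i α γ := by
  refine isInvariant_of_forward hk ?_
  rintro _ _ ⟨e, rfl, rfl⟩ h α γ hα t ht₁ ht₂
  have hq : IsKanFibration (pullback.fst (postcomp A p) (restrict i Y) ≫ restrict k X) :=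
    IsKanFibration.comp (isKanFibration_of_isPullback (IsPullback.of_hasPullback _ _).flip
      (hY.isKanFibration_restrict i)) (hX.isKanFibration_restrict k)
  -- The target of `relMap p i` maps to Map(A', X) by a Kan fibration, so a path there lifts to a
  -- path of extension problems starting at `t`; contractibility is then carried back along it.
  obtain ⟨e', he'₁, he'₂⟩ := hq.exists_edge_lift t e (by
    rw [← hα, ← ht₁]; rfl)
  rw [← he'₁]
  refine ContractibleAt.of_edge (hp.isKanFibration_relMap i) e' ?_
  refine h _ _ ?_ _ rfl rfl
  rw [← he'₂]
  exact NatTrans.naturality_apply (pullback.fst (postcomp A p) (restrict i Y) ≫ restrict k X)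
    (SimplexCategory.δ 0).op e'

end SimplicialSpace

namespace SSet

lemma IsEquivalence.iso_comp_iso {K L K' L' : SSet.{u}} {f : K ⟶ L} (h : IsEquivalence f)
    (e : K' ≅ K) (e' : L ≅ L') : IsEquivalence (e.hom ≫ f ≫ e'.hom) := by
  obtain ⟨⟨g, hg⟩, k, hk⟩ := isEquivalence_iff.1 h
  refine isEquivalence_iff.2 ⟨⟨e'.inv ≫ g ≫ e.inv, ?_⟩, e'.inv ≫ k ≫ e.inv, ?_⟩
  · have := (hg.precomp e'.inv).postcomp e'.hom
    simpa using this
  · have := (hk.precomp e.hom).postcomp e.inv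
    simpa using this

end SSet

/-! ### Local inclusions and the Segal condition -/

namespace SimplicialSpace

open MonoidalCategory CartesianMonoidalCategory HomotopicalAlgebra SSet
open SSet.modelCategoryQuillen

variable {A B E : SSet.{u}} {X Y : SimplicialSpace.{u}}

/-- Maps into `X` extend essentially uniquely along `i`. -/
abbrev IsLocal (X : SimplicialSpace.{u}) (i : A ⟶ B) : Prop := IsTrivialFibration (restrict i X)

lemma IsLocal.comp {i : A ⟶ B} {j : B ⟶ E} (hi : IsLocal X i) (hj : IsLocal X j) :
    IsLocal X (i ≫ j) :=
  IsTrivialFibration.comp hj hi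

lemma IsLocal.of_isPushout {A₀ B₀ : SSet.{u}} {a : A₀ ⟶ A} {i₀ : A₀ ⟶ B₀} {i : A ⟶ B} {b : B₀ ⟶ B}
    (h : IsLocal X i₀) (sq : IsPushout a i₀ i b) : IsLocal X i :=
  isTrivialFibration_of_isPullback (isPullback_restrict sq) h

lemma IsLocal.of_comp (hX : IsReedyFibrant X) {i : A ⟶ B} {j : B ⟶ E} [Mono j] (hi : IsLocal X i)
    (hij : IsLocal X (i ≫ j)) : IsLocal X j :=
  (hX.isKanFibration_restrict j).isTrivialFibration_of_contractibleAt fun _ =>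
    ContractibleAt.of_comp_left (hX.isKanFibration_restrict j) (hi.contractibleAt _)
      (hij.contractibleAt _) rfl

/-- Followed by the projection to Map(A, X), the relative map becomes the restriction map of X,
which is trivial. The projection is a base change of the restriction map of Y, also trivial, so it
can be cancelled. -/
lemma isTrivialFibration_relMap {p : X ⟶ Y} (hp : IsReedyFibration p) {i : A ⟶ B} [Mono i]
    (hX : IsLocal X i) (hY : IsLocal Y i) : IsTrivialFibration (relMap p i) := by
  refine (hp.isKanFibration_relMap i).isTrivialFibration_of_contractibleAt fun b => ?_
  refine ContractibleAt.of_comp_left (q₂ := pullback.fst _ _) (hp.isKanFibration_relMap i)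
    ((isTrivialFibration_of_isPullback (IsPullback.of_hasPullback _ _).flip hY).contractibleAt _)
    ?_ rfl
  rw [relMap_fst]
  exact hX.contractibleAt _

lemma IsLocal.exists_extension {i : A ⟶ B} (h : IsLocal X i) (α : A ⟶ points X) :
    ∃ β : B ⟶ points X, i ≫ β = α :=
  IsTrivialFibration.exists_point h α

/-! ### Gluing of faces -/

lemma isPushout_sup_range {S T : SSet.{u}} (f : S ⟶ T) [Mono f] (D : T.Subcomplex)
    {H : S.Subcomplex} (h : D.preimage f = H) {D' : T.Subcomplex}
    (h' : D ⊔ Subcomplex.range f = D') :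
    ∃ (a : (H : SSet.{u}) ⟶ D) (hD : D ≤ D') (b : S ⟶ (D' : SSet.{u})),
      IsPushout a H.ι (Subcomplex.homOfLE hD) b ∧ a ≫ D.ι = H.ι ≫ f ∧ b ≫ D'.ι = f := by
  subst h h'
  have sq : Subcomplex.BicartSq (Subcomplex.range ((D.preimage f).ι ≫ f)) D (Subcomplex.range f)
      (D ⊔ Subcomplex.range f) := by
    refine ⟨rfl, ?_⟩
    ext n x
    constructor
    · rintro ⟨h, y, rfl⟩
      exact ⟨⟨y, h⟩, rfl⟩
    · rintro ⟨y, rfl⟩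
      exact ⟨y.2, y.1, rfl⟩
  refine ⟨D.fromPreimage f, le_sup_left, Subcomplex.lift f le_sup_right, ?_, rfl, rfl⟩
  exact sq.isPushout.of_iso' (asIso (Subcomplex.toRange ((D.preimage f).ι ≫ f))) (Iso.refl _)
    (asIso (Subcomplex.toRange f)) (Iso.refl _) rfl rfl rfl rfl

lemma range_map {m n : ℕ} (θ : ⦋m⦌ ⟶ ⦋n⦌) (hθ : Function.Injective θ.toOrderHom) :
    Subcomplex.range (SSet.stdSimplex.{u}.map θ) =
      SSet.stdSimplex.face (Finset.univ.image θ.toOrderHom) := by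
  have hm : StrictMono θ.toOrderHom := θ.toOrderHom.monotone.strictMono_of_injective hθ
  ext d x
  induction d using Opposite.rec with | _ d =>
  induction d using SimplexCategory.rec with | _ d =>
  constructor
  · rintro ⟨y, rfl⟩
    rw [stdSimplex.mem_face_iff]
    intro i
    exact Finset.mem_image_of_mem _ (Finset.mem_univ (y i))
  · intro hx
    rw [stdSimplex.mem_face_iff] at hx
    have hx' : ∀ i, ∃ k, θ.toOrderHom k = x i := fun i => by
      obtain ⟨k, -, hk⟩ := Finset.mem_image.1 (hx i)
      exact ⟨k, hk⟩
    choose g hg using hx'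
    refine ⟨SSet.stdSimplex.objMk ⟨g, fun i j hij => ?_⟩, ?_⟩
    · rw [← hm.le_iff_le, hg, hg]
      exact SSet.stdSimplex.monotone_apply x hij
    · exact SSet.stdSimplex.ext _ _ hg

lemma mono_map {m n : ℕ} {θ : ⦋m⦌ ⟶ ⦋n⦌} (hθ : Function.Injective θ.toOrderHom) :
    Mono (SSet.stdSimplex.{u}.map θ) := by
  rw [NatTrans.mono_iff_mono_app]
  intro d
  induction d using Opposite.rec with | _ d =>
  induction d using SimplexCategory.rec with | _ d =>
  rw [CategoryTheory.mono_iff_injective]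
  intro x y h
  refine SSet.stdSimplex.ext _ _ fun i => hθ ?_
  exact congr_arg (fun z : (Δ[n] : SSet.{u}) _⦋d⦌ => z i) h

/-- The union of a list of faces of a standard simplex. -/
def faces {n : ℕ} (l : List (Finset (Fin (n + 1)))) : (Δ[n] : SSet.{u}).Subcomplex :=
  ⨆ S ∈ l, SSet.stdSimplex.face S

lemma mem_faces_iff {n d : ℕ} {l : List (Finset (Fin (n + 1)))} (x : (Δ[n] : SSet.{u}) _⦋d⦌) :
    x ∈ (faces l).obj (op ⦋d⦌) ↔ ∃ S ∈ l, ∀ i, x i ∈ S := by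
  simp [faces]

/-- Every set in the first list is contained in a set in the second list. -/
abbrev Refines {n : ℕ} (l l' : List (Finset (Fin (n + 1)))) : Prop :=
  ∀ S ∈ l, ∃ S' ∈ l', S ⊆ S'

/-- Inclusions between unions of faces reduce to a finite condition on vertex sets, which lets
`decide` verify the combinatorics of the gluings in Δ[3]. -/
lemma faces_le {n : ℕ} {l l' : List (Finset (Fin (n + 1)))} (h : Refines l l') :
    faces.{u} l ≤ faces l' := by
  intro d x
  induction d using Opposite.rec with | _ d =>
  induction d using SimplexCategory.rec with | _ d =>
  intro hx
  rw [mem_faces_iff] at hx ⊢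
  obtain ⟨S, hS, hx⟩ := hx
  obtain ⟨S', hS', h⟩ := h S hS
  exact ⟨S', hS', fun i => h (hx i)⟩

lemma faces_eq {n : ℕ} {l l' : List (Finset (Fin (n + 1)))} (h : Refines l l' ∧ Refines l' l) :
    faces.{u} l = faces l' :=
  le_antisymm (faces_le h.1) (faces_le h.2)

lemma faces_singleton {n : ℕ} (S : Finset (Fin (n + 1))) :
    faces.{u} [S] = SSet.stdSimplex.face S := by
  simp [faces]

lemma faces_append {n : ℕ} (l l' : List (Finset (Fin (n + 1)))) :
    faces.{u} (l ++ l') = faces l ⊔ faces l' := by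
  ext d x
  induction d using Opposite.rec with | _ d =>
  induction d using SimplexCategory.rec with | _ d =>
  change _ ↔ x ∈ (faces l).obj _ ∨ x ∈ (faces l').obj _
  rw [mem_faces_iff, mem_faces_iff, mem_faces_iff]
  simp only [List.mem_append, or_and_right, exists_or]

lemma preimage_faces {m n : ℕ} (θ : ⦋m⦌ ⟶ ⦋n⦌) (l : List (Finset (Fin (n + 1)))) :
    (faces.{u} l).preimage (SSet.stdSimplex.map θ) =
      faces (l.map fun S => Finset.univ.filter fun i => θ.toOrderHom i ∈ S) := by
  ext d x
  induction d using Opposite.rec with | _ d =>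
  induction d using SimplexCategory.rec with | _ d =>
  refine (mem_faces_iff ((SSet.stdSimplex.map θ).app _ x)).trans ?_
  rw [mem_faces_iff]
  simp only [List.mem_map, exists_exists_and_eq_and, Finset.mem_filter, Finset.mem_univ, true_and]
  rfl

/-- Gluing a face to a union of faces. -/
lemma isPushout_faces {m n : ℕ} {θ : ⦋m⦌ ⟶ ⦋n⦌} (hθ : Function.Injective θ.toOrderHom)
    {l l' : List (Finset (Fin (n + 1)))} {l₀ : List (Finset (Fin (m + 1)))}
    {H : (Δ[m] : SSet.{u}).Subcomplex} (hH : faces l₀ = H)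
    (h : Refines (l.map fun S => Finset.univ.filter fun i => θ.toOrderHom i ∈ S) l₀ ∧
      Refines l₀ (l.map fun S => Finset.univ.filter fun i => θ.toOrderHom i ∈ S))
    (h' : Refines (l ++ [Finset.univ.image θ.toOrderHom]) l' ∧
      Refines l' (l ++ [Finset.univ.image θ.toOrderHom])) :
    ∃ (a : (H : SSet.{u}) ⟶ (faces.{u} l : SSet.{u})) (hD : faces.{u} l ≤ faces l')
      (b : Δ[m] ⟶ (faces.{u} l' : SSet.{u})),
      IsPushout a H.ι (Subcomplex.homOfLE hD) b ∧
        a ≫ (faces l).ι = H.ι ≫ SSet.stdSimplex.map θ ∧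
        b ≫ (faces l').ι = SSet.stdSimplex.map θ := by
  have := mono_map.{u} hθ
  refine isPushout_sup_range _ _ ?_ ?_
  · rw [preimage_faces, ← hH, faces_eq h]
  · rw [range_map θ hθ, ← faces_singleton, ← faces_append, faces_eq h']

lemma faces_horn_two_zero : faces.{u} [{0, 1}, {0, 2}] = Λ[2, 0] := by
  rw [← horn₂₀.sq.sup_eq, ← faces_singleton, ← faces_singleton, ← faces_append]; rfl

lemma faces_horn_two_one : faces.{u} [{0, 1}, {1, 2}] = Λ[2, 1] := by
  rw [← horn₂₁.sq.sup_eq, ← faces_singleton, ← faces_singleton, ← faces_append]; rfl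

/-! ### Spines -/

/-- A path in `A` is generating if it induces a bijection between maps from `A` and paths. -/
structure IsGenerating {n : ℕ} (γ : A.Path n) : Prop where
  hom_ext : ∀ {Z : SSet.{u}} (f g : A ⟶ Z), γ.map f = γ.map g → f = g
  exists_hom : ∀ {Z : SSet.{u}} (π : Z.Path n), ∃ f : A ⟶ Z, γ.map f = π

/-- Evaluation at a path. -/
def pathMap {n : ℕ} (γ : A.Path n) (X : SimplicialSpace.{u}) : mapSpace A X ⟶ pathSpace X n where
  app l := TypeCat.ofHom fun s : A ⟶ row X l => γ.map s
  naturality _ _ _ := rfl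

lemma IsGenerating.isIso_pathMap {n : ℕ} {γ : A.Path n} (h : IsGenerating γ) :
    IsIso (pathMap γ X) := by
  rw [NatTrans.isIso_iff_isIso_app]
  intro l
  rw [isIso_iff_bijective]
  exact ⟨fun f g hfg => h.hom_ext _ _ hfg, fun π => h.exists_hom (Z := row X l) π⟩

lemma restrict_pathMap {n : ℕ} (hn : n ≠ 0) {γ : A.Path n} {i : A ⟶ Δ[n]}
    (h : γ.map i = SSet.stdSimplex.spineId n) :
    restrict i X ≫ pathMap γ X = (evIso X n).hom ≫ segalMap X n := by
  obtain ⟨n, rfl⟩ := Nat.exists_eq_succ_of_ne_zero hn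
  refine SSet.hom_ext fun l => ConcreteCategory.hom_ext _ _ fun (s : Δ[n + 1] ⟶ row X l) => ?_
  refine SSet.Path.ext' fun k => ?_
  have h₁ := congr_arg (fun e => s.app _ e) (Path.congr_arrow h k)
  refine h₁.trans ?_
  exact NatTrans.naturality_apply s (SimplexCategory.mkOfSucc k).op _

/-- Restriction to the empty subcomplex is a Kan fibration, and the mapping space out of the empty
simplicial set has exactly one simplex in each dimension. -/
lemma isKan_mapSpace (hX : IsReedyFibrant X) (A : SSet.{u}) : IsKan (mapSpace A X) := by
  refine (hX.isKanFibration_restrict (⊥ : A.Subcomplex).ι).isKan ?_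
  refine isKanFibration_iff.2 fun n k a b _ => ⟨ofCot (Subcomplex.isInitialBot.to _), ?_,
    Subsingleton.elim _ _⟩
  exact toCot_injective (Subcomplex.isInitialBot.hom_ext _ _)

lemma isKan_obj (hX : IsReedyFibrant X) (n : ℕ) : IsKan (X _⦋n⦌) :=
  IsKanFibration.isKan (isKanFibration_of_isIso (evIso X n).inv) (isKan_mapSpace hX _)

/-- Up to isomorphism the Segal map is the restriction to the spine. That restriction is a Kan
fibration of Kan complexes, so being an equivalence makes it trivial. -/
lemma IsSegal.isLocal (hX : IsSegal X) {n : ℕ} (hn : 2 ≤ n) {γ : A.Path n} (hγ : IsGenerating γ)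
    {i : A ⟶ Δ[n]} [Mono i] (h : γ.map i = SSet.stdSimplex.spineId n) : IsLocal X i := by
  have := hγ.isIso_pathMap (X := X)
  have hi := hX.reedyFibrant.isKanFibration_restrict i
  have e := restrict_pathMap (X := X) (by omega) h
  have e' : restrict i X = (evIso X n).hom ≫ segalMap X n ≫ inv (pathMap γ X) := by
    rw [← Category.assoc, ← e, Category.assoc, IsIso.hom_inv_id, Category.comp_id]
  refine hi.isTrivialFibration (isKan_mapSpace hX.reedyFibrant _) ?_
  rw [e']
  exact (hX.segal n hn).iso_comp_iso (evIso X n) (asIso (pathMap γ X)).symm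

lemma Path.arrow_map_yonedaEquiv {n : ℕ} {Z : SSet.{u}} {γ : A.Path n} {k : Fin n} {b : Δ[1] ⟶ A}
    (hb : γ.arrow k = SSet.yonedaEquiv b) (f : A ⟶ Z) :
    (γ.map f).arrow k = SSet.yonedaEquiv (b ≫ f) :=
  congr_arg (fun e => f.app _ e) hb

lemma isGenerating_horn_two_one : IsGenerating (SSet.horn.spineId.{u} (n := 0) 1 (by decide)
    (by decide)) := by
  have e₀ : (SSet.horn.spineId.{u} (n := 0) 1 (by decide) (by decide)).arrow 0 =
      SSet.yonedaEquiv horn₂₁.ι₀₁ := by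
    refine Subtype.ext (SSet.stdSimplex.ext _ _ fun i => ?_)
    fin_cases i <;> rfl
  have e₁ : (SSet.horn.spineId.{u} (n := 0) 1 (by decide) (by decide)).arrow 1 =
      SSet.yonedaEquiv horn₂₁.ι₁₂ := by
    refine Subtype.ext (SSet.stdSimplex.ext _ _ fun i => ?_)
    fin_cases i <;> rfl
  constructor
  · intro Z f g h
    refine horn₂₁.isPushout.hom_ext (SSet.yonedaEquiv.injective ?_)
      (SSet.yonedaEquiv.injective ?_)
    · rw [← Path.arrow_map_yonedaEquiv e₀, h, Path.arrow_map_yonedaEquiv e₀]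
    · rw [← Path.arrow_map_yonedaEquiv e₁, h, Path.arrow_map_yonedaEquiv e₁]
  · intro Z π
    have w : SSet.stdSimplex.δ (0 : Fin 2) ≫ SSet.yonedaEquiv.symm (π.arrow 0) =
        SSet.stdSimplex.δ (1 : Fin 2) ≫ SSet.yonedaEquiv.symm (π.arrow 1) := by
      rw [SSet.stdSimplex.δ_comp_yonedaEquiv_symm, SSet.stdSimplex.δ_comp_yonedaEquiv_symm,
        π.arrow_src, π.arrow_tgt]
      rfl
    refine ⟨horn₂₁.isPushout.desc _ _ w, SSet.Path.ext' fun k => ?_⟩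
    fin_cases k
    · refine (Path.arrow_map_yonedaEquiv e₀ _).trans ?_
      rw [horn₂₁.isPushout.inl_desc]
      exact SSet.yonedaEquiv.apply_symm_apply _
    · refine (Path.arrow_map_yonedaEquiv e₁ _).trans ?_
      rw [horn₂₁.isPushout.inr_desc]
      exact SSet.yonedaEquiv.apply_symm_apply _

lemma IsSegal.isLocal_horn (hX : IsSegal X) : IsLocal X (Λ[2, 1] : (Δ[2] : SSet.{u}).Subcomplex).ι :=
  hX.isLocal le_rfl isGenerating_horn_two_one rfl

lemma faces_vertex_zero : faces.{u} [{0}] = SSet.stdSimplex.face {(0 : Fin 2)} :=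
  faces_singleton _

/-- Extension of maps along the gluing of an edge. -/
lemma exists_desc_edge {n : ℕ} {θ : ⦋1⦌ ⟶ ⦋n⦌} {D D' : (Δ[n] : SSet.{u}).Subcomplex}
    {a : (SSet.stdSimplex.face.{u} {(0 : Fin 2)} : SSet.{u}) ⟶ D} {hD : D ≤ D'} {b : Δ[1] ⟶ (D' : SSet.{u})}
    (sq : IsPushout a (SSet.stdSimplex.face.{u} {(0 : Fin 2)}).ι (Subcomplex.homOfLE hD) b)
    (ha : a ≫ D.ι = (SSet.stdSimplex.face.{u} {(0 : Fin 2)}).ι ≫ SSet.stdSimplex.map θ)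
    {Z : SSet.{u}} (s : (D : SSet.{u}) ⟶ Z) (e : Δ[1] ⟶ Z) (v : Δ[0] ⟶ (D : SSet.{u}))
    (hv : v ≫ D.ι = SSet.stdSimplex.δ 1 ≫ SSet.stdSimplex.map θ)
    (hs : v ≫ s = SSet.stdSimplex.δ 1 ≫ e) :
    ∃ l : (D' : SSet.{u}) ⟶ Z, Subcomplex.homOfLE hD ≫ l = s ∧ b ≫ l = e := by
  have w : a ≫ s = (SSet.stdSimplex.face.{u} {(0 : Fin 2)}).ι ≫ e := by
    rw [← cancel_epi (SSet.stdSimplex.faceSingletonIso.{u} (0 : Fin 2)).hom,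
      SSet.stdSimplex.faceSingletonIso_zero_hom_comp_ι_eq_δ_assoc, ← hs, ← Category.assoc]
    congr 1
    rw [← cancel_mono D.ι, Category.assoc, ha, hv,
      SSet.stdSimplex.faceSingletonIso_zero_hom_comp_ι_eq_δ_assoc]
  exact ⟨sq.desc s e w, sq.inl_desc _ _ _, sq.inr_desc _ _ _⟩

/-- The spine of the `3`-simplex. -/
abbrev spineThree : (Δ[3] : SSet.{u}).Subcomplex := faces [{0, 1}, {1, 2}, {2, 3}]

/-- The tautological path in the spine of the `3`-simplex. -/
def spineThreePath : (spineThree.{u} : SSet.{u}).Path 3 :=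
  spineThree.liftPath (SSet.stdSimplex.spineId 3)
    (fun j => by
      rw [mem_faces_iff]
      fin_cases j
      · exact ⟨{0, 1}, by simp, fun i => by fin_cases i; decide⟩
      · exact ⟨{0, 1}, by simp, fun i => by fin_cases i; decide⟩
      · exact ⟨{1, 2}, by simp, fun i => by fin_cases i; decide⟩
      · exact ⟨{2, 3}, by simp, fun i => by fin_cases i; decide⟩)
    (fun j => by
      rw [mem_faces_iff]
      fin_cases j
      · exact ⟨{0, 1}, by simp, fun i => by fin_cases i <;> decide⟩
      · exact ⟨{1, 2}, by simp, fun i => by fin_cases i <;> decide⟩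
      · exact ⟨{2, 3}, by simp, fun i => by fin_cases i <;> decide⟩)

lemma faces_nil {n : ℕ} : faces.{u} ([] : List (Finset (Fin (n + 1)))) = ⊥ := by
  simp [faces]

lemma isGenerating_spineThreePath : IsGenerating spineThreePath.{u} := by
  -- The spine is assembled from the empty union by attaching the edges 01, 12 and 23 in turn, the
  -- last two at their initial vertex.
  obtain ⟨a₀, hD₀, b₀, sq₀, -, hb₀⟩ := isPushout_faces.{u} (l := [])
    (l' := [({0, 1} : Finset (Fin 4))])
    (θ := SimplexCategory.mkOfSucc (0 : Fin 3)) (by decide) faces_nil (by decide) (by decide)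
  obtain ⟨a₁, hD₁, b₁, sq₁, ha₁, hb₁⟩ := isPushout_faces.{u} (l := [{0, 1}])
    (l' := [({0, 1} : Finset (Fin 4)), {1, 2}])
    (θ := SimplexCategory.mkOfSucc (1 : Fin 3)) (by decide) faces_vertex_zero (by decide)
    (by decide)
  obtain ⟨a₂, hD₂, b₂, sq₂, ha₂, hb₂⟩ := isPushout_faces.{u} (l := [{0, 1}, {1, 2}])
    (l' := [({0, 1} : Finset (Fin 4)), {1, 2}, {2, 3}])
    (θ := SimplexCategory.mkOfSucc (2 : Fin 3)) (by decide) faces_vertex_zero (by decide)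
    (by decide)
  have e₀ : spineThreePath.{u}.arrow 0 =
      SSet.yonedaEquiv (b₀ ≫ Subcomplex.homOfLE hD₁ ≫ Subcomplex.homOfLE hD₂) := by
    refine Subtype.ext ?_
    change _ = SSet.yonedaEquiv (b₀ ≫ (faces _).ι)
    rw [hb₀]; rfl
  have e₁ : spineThreePath.{u}.arrow 1 = SSet.yonedaEquiv (b₁ ≫ Subcomplex.homOfLE hD₂) := by
    refine Subtype.ext ?_
    change _ = SSet.yonedaEquiv (b₁ ≫ (faces _).ι)
    rw [hb₁]; rfl
  have e₂ : spineThreePath.{u}.arrow 2 = SSet.yonedaEquiv b₂ := by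
    refine Subtype.ext ?_
    change _ = SSet.yonedaEquiv (b₂ ≫ (faces _).ι)
    rw [hb₂]; rfl
  have hbot : ∀ {Z : SSet.{u}} (f g : (faces.{u} ([] : List (Finset (Fin 4))) : SSet.{u}) ⟶ Z),
      f = g := by
    rw [faces_nil]
    exact fun f g => Subcomplex.isInitialBot.hom_ext f g
  constructor
  · intro Z f g h
    refine sq₂.hom_ext (sq₁.hom_ext (sq₀.hom_ext (hbot _ _) ?_) ?_) ?_
    · refine SSet.yonedaEquiv.injective ?_
      exact (Path.arrow_map_yonedaEquiv e₀ f).symm.trans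
        ((Path.congr_arrow h 0).trans (Path.arrow_map_yonedaEquiv e₀ g))
    · refine SSet.yonedaEquiv.injective ?_
      exact (Path.arrow_map_yonedaEquiv e₁ f).symm.trans
        ((Path.congr_arrow h 1).trans (Path.arrow_map_yonedaEquiv e₁ g))
    · refine SSet.yonedaEquiv.injective ?_
      exact (Path.arrow_map_yonedaEquiv e₂ f).symm.trans
        ((Path.congr_arrow h 2).trans (Path.arrow_map_yonedaEquiv e₂ g))
  · intro Z π
    have hs : ∃ s : (faces.{u} ([] : List (Finset (Fin 4))) : SSet.{u}) ⟶ Z, True := by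
      rw [faces_nil]
      exact ⟨Subcomplex.isInitialBot.to _, trivial⟩
    obtain ⟨s, -⟩ := hs
    have w₀ : a₀ ≫ s = (⊥ : (Δ[1] : SSet.{u}).Subcomplex).ι ≫ SSet.yonedaEquiv.symm (π.arrow 0) :=
      Subcomplex.isInitialBot.hom_ext _ _
    have w (k : Fin 2) : SSet.stdSimplex.δ (0 : Fin 2) ≫ SSet.yonedaEquiv.symm (π.arrow k.castSucc) =
        SSet.stdSimplex.δ (1 : Fin 2) ≫ SSet.yonedaEquiv.symm (π.arrow k.succ) := by
      rw [SSet.stdSimplex.δ_comp_yonedaEquiv_symm, SSet.stdSimplex.δ_comp_yonedaEquiv_symm,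
        π.arrow_src, π.arrow_tgt]
      rfl
    obtain ⟨l₁, hl₁, hl₁'⟩ := exists_desc_edge sq₁ ha₁ (sq₀.desc _ _ w₀)
      (SSet.yonedaEquiv.symm (π.arrow 1)) (SSet.stdSimplex.δ 0 ≫ b₀) (by
        rw [Category.assoc, hb₀]; decide) (by
        rw [Category.assoc, sq₀.inr_desc]; exact w 0)
    obtain ⟨l₂, hl₂, hl₂'⟩ := exists_desc_edge sq₂ ha₂ l₁
      (SSet.yonedaEquiv.symm (π.arrow 2)) (SSet.stdSimplex.δ 0 ≫ b₁) (by
        rw [Category.assoc, hb₁]; decide) (by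
        rw [Category.assoc, hl₁']; exact w 1)
    refine ⟨l₂, SSet.Path.ext' fun k => ?_⟩
    fin_cases k
    · refine (Path.arrow_map_yonedaEquiv e₀ _).trans ?_
      rw [Category.assoc, Category.assoc, hl₂, hl₁, sq₀.inr_desc]
      exact SSet.yonedaEquiv.apply_symm_apply _
    · refine (Path.arrow_map_yonedaEquiv e₁ _).trans ?_
      rw [Category.assoc, hl₂, hl₁']
      exact SSet.yonedaEquiv.apply_symm_apply _
    · refine (Path.arrow_map_yonedaEquiv e₂ _).trans ?_
      rw [hl₂']
      exact SSet.yonedaEquiv.apply_symm_apply _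

lemma IsSegal.isLocal_spineThree (hX : IsSegal X) : IsLocal X spineThree.{u}.ι :=
  hX.isLocal (by norm_num) isGenerating_spineThreePath rfl

/-- The union of the faces `012` and `023`. -/
abbrev squareFaces : (Δ[3] : SSet.{u}).Subcomplex := faces [{0, 1, 2}, {0, 2, 3}]

/-- The union of the faces containing the vertex `1`. -/
abbrev innerHornFaces : (Δ[3] : SSet.{u}).Subcomplex := faces [{0, 1, 2}, {0, 1, 3}, {1, 2, 3}]

/-- Attaching a triangle along its inner horn is a cobase change of Λ[2,1] ⊂ Δ[2]. -/
lemma IsLocal.faces {k : ℕ} {θ : ⦋2⦌ ⟶ ⦋k⦌} (hX : IsSegal X)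
    (hθ : Function.Injective θ.toOrderHom) (l l' : List (Finset (Fin (k + 1))))
    (h : Refines (l.map fun S => Finset.univ.filter fun i => θ.toOrderHom i ∈ S) [{0, 1}, {1, 2}] ∧
      Refines [{0, 1}, {1, 2}] (l.map fun S => Finset.univ.filter fun i => θ.toOrderHom i ∈ S))
    (h' : Refines (l ++ [Finset.univ.image θ.toOrderHom]) l' ∧
      Refines l' (l ++ [Finset.univ.image θ.toOrderHom])) :
    ∃ hD : faces.{u} l ≤ faces l', IsLocal X (Subcomplex.homOfLE hD) := by
  obtain ⟨a, hD, b, sq, -, -⟩ := isPushout_faces.{u} hθ faces_horn_two_one h h'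
  exact ⟨hD, hX.isLocal_horn.of_isPushout sq⟩

/-- The union of 012 and 023 arises from the spine by two inner horn attachments, and the spine
inclusion is local; cancellation gives the rest. The same argument applies to the inner horn, with
the triangles 012, 123 and then 013. -/
lemma IsSegal.isLocal_squareFaces (hX : IsSegal X) : IsLocal X squareFaces.{u}.ι := by
  obtain ⟨h₁, h₁'⟩ := IsLocal.faces hX (θ := SimplexCategory.δ (3 : Fin 4)) (by decide)
    [{0, 1}, {1, 2}, {2, 3}] [{0, 1, 2}, {2, 3}] (by decide) (by decide)
  obtain ⟨h₂, h₂'⟩ := IsLocal.faces hX (θ := SimplexCategory.δ (1 : Fin 4)) (by decide)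
    [{0, 1, 2}, {2, 3}] [{0, 1, 2}, {0, 2, 3}] (by decide) (by decide)
  exact (h₁'.comp h₂').of_comp hX.reedyFibrant hX.isLocal_spineThree

lemma IsSegal.isLocal_innerHornFaces (hX : IsSegal X) : IsLocal X innerHornFaces.{u}.ι := by
  obtain ⟨h₁, h₁'⟩ := IsLocal.faces hX (θ := SimplexCategory.δ (3 : Fin 4)) (by decide)
    [{0, 1}, {1, 2}, {2, 3}] [{0, 1, 2}, {2, 3}] (by decide) (by decide)
  obtain ⟨h₂, h₂'⟩ := IsLocal.faces hX (θ := SimplexCategory.δ (0 : Fin 4)) (by decide)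
    [{0, 1, 2}, {2, 3}] [{0, 1, 2}, {1, 2, 3}] (by decide) (by decide)
  obtain ⟨h₃, h₃'⟩ := IsLocal.faces hX (θ := SimplexCategory.δ (2 : Fin 4)) (by decide)
    [{0, 1, 2}, {1, 2, 3}] [{0, 1, 2}, {0, 1, 3}, {1, 2, 3}] (by decide) (by decide)
  exact ((h₁'.comp h₂').comp h₃').of_comp hX.reedyFibrant hX.isLocal_spineThree

end SimplicialSpace

namespace SSet

lemma mem_fiber_zero_iff {K L : SSet.{u}} {φ : K ⟶ L} {y : L _⦋0⦌} {x : K _⦋0⦌} :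
    x ∈ (fiber φ y).obj (op ⦋0⦌) ↔ φ.app _ x = y := by
  constructor
  · rintro ⟨v, hv⟩
    obtain rfl : v = 𝟙 _ := Quiver.Hom.unop_inj (Subsingleton.elim _ _)
    exact hv.symm.trans (Functor.map_id_apply L _ _)
  · rintro rfl
    exact ⟨𝟙 _, Functor.map_id_apply L _ _⟩

lemma fiber_ι_comp {K L : SSet.{u}} (φ : K ⟶ L) (y : L _⦋0⦌) : (fiber φ y).ι ≫ φ = const y := by
  refine SSet.hom_ext fun m => ConcreteCategory.hom_ext _ _ fun ⟨x, v, hv⟩ => ?_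
  obtain rfl : v = (m.unop.const ⦋0⦌ 0).op := Quiver.Hom.unop_inj (Subsingleton.elim _ _)
  exact hv.symm

lemma range_le_fiber {K L Z : SSet.{u}} {φ : K ⟶ L} {y : L _⦋0⦌} {v : Z ⟶ K}
    (h : v ≫ φ = const y) : Subcomplex.range v ≤ fiber φ y := by
  rintro m _ ⟨x, rfl⟩
  refine ⟨(m.unop.const ⦋0⦌ 0).op, ?_⟩
  exact (ConcreteCategory.congr_hom (congr_app h m) x).symm

end SSet

/-! ### CoCartesian morphisms as extension problems along Λ[2,0] -/

namespace SimplicialSpace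

open MonoidalCategory CartesianMonoidalCategory HomotopicalAlgebra SSet
open SSet.modelCategoryQuillen

variable {X Y : SimplicialSpace.{u}}

lemma faces_hom_ext {n : ℕ} {l : List (Finset (Fin (n + 1)))} {Z : SSet.{u}}
    {f g : (faces.{u} l : SSet.{u}) ⟶ Z}
    (h : ∀ S ∈ l, ∃ (m : ℕ) (θ : ⦋m⦌ ⟶ ⦋n⦌), Function.Injective θ.toOrderHom ∧
      S = Finset.univ.image θ.toOrderHom ∧
      ∀ b : Δ[m] ⟶ (faces.{u} l : SSet.{u}), b ≫ (faces l).ι = SSet.stdSimplex.map θ →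
        b ≫ f = b ≫ g) : f = g := by
  refine SSet.hom_ext fun d => ConcreteCategory.hom_ext _ _ fun ⟨x, hx⟩ => ?_
  induction d using Opposite.rec with | _ d =>
  induction d using SimplexCategory.rec with | _ d =>
  obtain ⟨S, hS, hxS⟩ := (mem_faces_iff x).1 hx
  obtain ⟨m, θ, hθ, hS', H⟩ := h S hS
  have hle : Subcomplex.range (SSet.stdSimplex.map θ) ≤ faces.{u} l := by
    rw [range_map θ hθ, ← hS', ← faces_singleton]
    exact faces_le fun S'' hS'' => ⟨S, hS, by simp_all⟩
  have hx' : x ∈ (Subcomplex.range (SSet.stdSimplex.{u}.map θ)).obj _ := by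
    rw [range_map θ hθ, ← hS', stdSimplex.mem_face_iff]
    exact hxS
  obtain ⟨y, rfl⟩ := hx'
  exact ConcreteCategory.congr_hom (congr_app (H (Subcomplex.lift _ hle) rfl) _) y

/-- The map from a representable given by a point of `X_n`. -/
abbrev simplexMap {n : ℕ} (ν : (X _⦋n⦌) _⦋0⦌) : Δ[n] ⟶ points X :=
  SSet.yonedaEquiv (X := points X).symm ν

/-- `f` is coCartesian, in terms of the relative restriction map along `Λ[2, 0] ⟶ Δ[2]`. -/
def IsCoCart (p : X ⟶ Y) (f : Mor X) : Prop :=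
  ∀ (α : (Λ[2, 0] : SSet.{u}) ⟶ points X) (γ : Δ[2] ⟶ points Y),
    horn₂₀.ι₀₁ ≫ α = simplexMap f → RelContractible p Λ[2, 0].ι α γ

lemma map_comp_simplexMap {m n : ℕ} (θ : ⦋m⦌ ⟶ ⦋n⦌) (ν : (X _⦋n⦌) _⦋0⦌) :
    SSet.stdSimplex.map θ ≫ simplexMap ν = simplexMap ((X.map θ.op).app _ ν) :=
  yonedaEquiv_symm_naturality_left (X := points X) θ ν

lemma δ_comp_simplexMap {n : ℕ} (i : Fin (n + 2)) (ν : (X _⦋n + 1⦌) _⦋0⦌) :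
    SSet.stdSimplex.δ i ≫ simplexMap ν = simplexMap ((X.δ i).app _ ν) :=
  map_comp_simplexMap _ ν

lemma σ_comp_simplexMap {n : ℕ} (i : Fin (n + 1)) (ν : (X _⦋n⦌) _⦋0⦌) :
    SSet.stdSimplex.σ i ≫ simplexMap ν = simplexMap ((X.σ i).app _ ν) :=
  map_comp_simplexMap _ ν

lemma simplexMap_pointsMap {n : ℕ} (p : X ⟶ Y) (ν : (X _⦋n⦌) _⦋0⦌) :
    simplexMap ν ≫ pointsMap p = simplexMap ((p.app (op ⦋n⦌)).app _ ν) :=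
  yonedaEquiv_symm_comp (X := points X) (Y := points Y) ν (pointsMap p)

lemma simplexMap_injective {n : ℕ} {ν ν' : (X _⦋n⦌) _⦋0⦌} (h : simplexMap ν = simplexMap ν') :
    ν = ν' :=
  SSet.yonedaEquiv (X := points X).symm.injective h

lemma exists_simplexMap {n : ℕ} (s : Δ[n] ⟶ points X) : ∃ ν : (X _⦋n⦌) _⦋0⦌, simplexMap ν = s :=
  ⟨SSet.yonedaEquiv (X := points X) s, SSet.yonedaEquiv.symm_apply_apply s⟩

lemma evIso_inv_restrict_map {m n : ℕ} (θ : ⦋m⦌ ⟶ ⦋n⦌) :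
    (evIso X n).inv ≫ restrict (SSet.stdSimplex.map θ) X = X.map θ.op ≫ (evIso X m).inv := by
  rw [Iso.inv_comp_eq, ← Category.assoc, ← restrict_map_evIso, Category.assoc, Iso.hom_inv_id,
    Category.comp_id]

lemma const_evIso_inv {Z : SSet.{u}} {n : ℕ} (ν : (X _⦋n⦌) _⦋0⦌) :
    (const ν : Z ⟶ X _⦋n⦌) ≫ (evIso X n).inv = const (Y := mapSpace Δ[n] X) (simplexMap ν) := by
  rw [const_comp]; rfl

lemma const_restrict {A B Z : SSet.{u}} (i : A ⟶ B) (s : B ⟶ points X) :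
    (const (Y := mapSpace B X) s : Z ⟶ mapSpace B X) ≫ restrict i X =
      const (Y := mapSpace A X) (i ≫ s) := rfl

/-- This space is a fiber of the restriction from Δ[2] to the disjoint union of its edge 01 and its
vertex 2, a Kan fibration by Reedy fibrancy. -/
lemma isKan_triangleSpace (hX : IsReedyFibrant X) (f : Mor X) (z : Obj X) :
    IsKan (triangleSpace X f z) := by
  refine isKanFibration_iff.2 fun n k a b _ => ?_
  -- A vertex of the horn supplies a triangle `ν`, whose edge 01 and vertex 2 describe the point of
  -- the base over which the whole horn lies.
  obtain ⟨v₀, -⟩ := horn_vertex_joined k (stdSimplex.obj₀Equiv.symm 0)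
  let ν : (X _⦋2⦌) _⦋0⦌ := (a.app _ v₀).1
  have hν := (a.app _ v₀).2
  have hν₁ : (X.δ (n := 1) 2).app _ ν = f := mem_fiber_zero_iff.1 hν.1
  have hν₂ : (X.δ (n := 1) 1 ≫ tgt X).app _ ν = z := mem_fiber_zero_iff.1 hν.2
  have ha₁ : (a ≫ (triangleSpace X f z).ι) ≫ X.δ (n := 1) 2 = const f := by
    have := (a ≫ Subcomplex.homOfLE inf_le_left) ≫= fiber_ι_comp (X.δ (n := 1) 2) f
    exact this
  have ha₂ : (a ≫ (triangleSpace X f z).ι) ≫ X.δ (n := 1) 1 ≫ tgt X = const z := by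
    have := (a ≫ Subcomplex.homOfLE inf_le_right) ≫= fiber_ι_comp (X.δ (n := 1) 1 ≫ tgt X) z
    exact this
  have key : ((a ≫ (triangleSpace X f z).ι) ≫ (evIso X 2).inv) ≫
      restrict (faces.{u} [({0, 1} : Finset (Fin 3)), {2}]).ι X =
      Λ[n + 1, k].ι ≫ const (Y := mapSpace _ X) ((faces.{u} [{0, 1}, {2}]).ι ≫ simplexMap ν) := by
    refine toCot_injective (faces_hom_ext fun S hS => ?_)
    have hc : ∀ {m : ℕ} (θ : ⦋m⦌ ⟶ ⦋2⦌) (y : (X _⦋m⦌) _⦋0⦌),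
        (a ≫ (triangleSpace X f z).ι) ≫ X.map θ.op = const y → (X.map θ.op).app _ ν = y →
        ∀ b : Δ[m] ⟶ (faces.{u} [({0, 1} : Finset (Fin 3)), {2}] : SSet.{u}),
          b ≫ (faces [{0, 1}, {2}]).ι = SSet.stdSimplex.map θ →
        b ≫ toCot (((a ≫ (triangleSpace X f z).ι) ≫ (evIso X 2).inv) ≫
          restrict (faces.{u} [({0, 1} : Finset (Fin 3)), {2}]).ι X) =
        b ≫ toCot (Λ[n + 1, k].ι ≫
          const (Y := mapSpace _ X) ((faces.{u} [{0, 1}, {2}]).ι ≫ simplexMap ν)) := by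
      intro m θ y h₁ h₂ b hb
      rw [← toCot_restrict, ← toCot_restrict]
      congr 1
      rw [Category.assoc, ← restrict_comp, hb, Category.assoc, evIso_inv_restrict_map,
        ← Category.assoc, h₁, const_evIso_inv, ← h₂, ← map_comp_simplexMap, ← hb]
      exact (const_restrict (X := X) (Z := (Λ[n + 1, k] : SSet.{u})) b
        ((faces [{0, 1}, {2}]).ι ≫ simplexMap ν)).symm
    simp only [List.mem_cons, List.not_mem_nil, or_false] at hS
    rcases hS with rfl | rfl
    · exact ⟨1, SimplexCategory.δ 2, by decide, by decide, hc _ f ha₁ hν₁⟩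
    · refine ⟨0, SimplexCategory.δ 0 ≫ SimplexCategory.δ 1, by decide, by decide, hc _ z ?_ ?_⟩
      · rw [op_comp, X.map_comp]; exact ha₂
      · rw [op_comp, X.map_comp]; exact hν₂
  obtain ⟨l, hl₁, hl₂⟩ := (hX.isKanFibration_restrict
    (faces.{u} [({0, 1} : Finset (Fin 3)), {2}]).ι).exists_lift (anodyneExtensions.horn_ι k) _ _ key
  have hc : ∀ {m : ℕ} (θ : ⦋m⦌ ⟶ ⦋2⦌) (S : Finset (Fin 3)) (_ : Function.Injective θ.toOrderHom)
      (_ : S = Finset.univ.image θ.toOrderHom) (_ : S ∈ [({0, 1} : Finset (Fin 3)), {2}]),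
      (l ≫ (evIso X 2).hom) ≫ X.map θ.op = const ((X.map θ.op).app _ ν) := by
    intro m θ S hθ hS hS'
    have hle : Subcomplex.range (SSet.stdSimplex.map θ) ≤ faces.{u} [({0, 1} : Finset (Fin 3)), {2}]
        := by
      rw [range_map θ hθ, ← hS, ← faces_singleton]
      exact faces_le fun S'' hS'' => ⟨S, hS', by simp_all⟩
    have h₁ := hl₂ =≫ restrict (Subcomplex.lift _ hle) X
    rw [const_restrict, Category.assoc] at h₁
    have h₂ : l ≫ restrict (SSet.stdSimplex.map θ) X =
        const (Y := mapSpace _ X) (simplexMap ((X.map θ.op).app _ ν)) := by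
      rw [← map_comp_simplexMap]
      exact h₁
    rw [Category.assoc, ← restrict_map_evIso, ← Category.assoc, h₂, ← const_evIso_inv,
      Category.assoc, Iso.inv_hom_id, Category.comp_id]
  refine ⟨Subcomplex.lift (l ≫ (evIso X 2).hom) (le_inf (range_le_fiber ?_) (range_le_fiber ?_)),
    ?_, Subsingleton.elim _ _⟩
  · rw [← hν₁]
    exact hc (SimplexCategory.δ 2) {0, 1} (by decide) (by decide) (by simp)
  · have := hc (SimplexCategory.δ 0 ≫ SimplexCategory.δ 1) {2} (by decide) (by decide) (by simp)
    rw [op_comp, X.map_comp] at this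
    rw [← hν₂]
    exact this
  · rw [← cancel_mono (triangleSpace X f z).ι]
    have := hl₁ =≫ (evIso X 2).hom
    rw [Category.assoc, Category.assoc, Iso.inv_hom_id, Category.comp_id] at this
    exact this

lemma evIso_inv_restrict_δ {n : ℕ} (i : Fin (n + 2)) :
    (evIso X (n + 1)).inv ≫ restrict (SSet.stdSimplex.δ i) X = X.δ i ≫ (evIso X n).inv :=
  evIso_inv_restrict_map _

lemma evIso_inv_postcomp (p : X ⟶ Y) (n : ℕ) :
    (evIso X n).inv ≫ postcomp Δ[n] p = p.app (op ⦋n⦌) ≫ (evIso Y n).inv := by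
  rw [Iso.inv_comp_eq, ← Category.assoc, ← postcomp_evIso, Category.assoc, Iso.hom_inv_id,
    Category.comp_id]

lemma mapSpace_hom_ext {A₀ A₁ A₂ A Z : SSet.{u}} {a₁ : A₀ ⟶ A₁} {a₂ : A₀ ⟶ A₂} {i₁ : A₁ ⟶ A}
    {i₂ : A₂ ⟶ A} (sq : IsPushout a₁ a₂ i₁ i₂) {g h : Z ⟶ mapSpace A X}
    (h₁ : g ≫ restrict i₁ X = h ≫ restrict i₁ X) (h₂ : g ≫ restrict i₂ X = h ≫ restrict i₂ X) :
    g = h :=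
  toCot_injective (sq.hom_ext (congr_arg toCot h₁) (congr_arg toCot h₂))

lemma exists_mapSpace_lift {A Z : SSet.{u}} {k k' : Fin 2} {i₀ i₁ : Δ[1] ⟶ A}
    (sq : IsPushout (SSet.stdSimplex.δ k) (SSet.stdSimplex.δ k') i₀ i₁) (e e' : Z ⟶ X _⦋1⦌)
    (h : e ≫ X.δ (n := 0) k = e' ≫ X.δ (n := 0) k') :
    ∃ g : Z ⟶ mapSpace A X, g ≫ restrict i₀ X = e ≫ (evIso X 1).inv ∧
      g ≫ restrict i₁ X = e' ≫ (evIso X 1).inv := by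
  have w : SSet.stdSimplex.δ k ≫ toCot (e ≫ (evIso X 1).inv) =
      SSet.stdSimplex.δ k' ≫ toCot (e' ≫ (evIso X 1).inv) := by
    refine congr_arg toCot (?_ : (e ≫ (evIso X 1).inv) ≫ restrict (SSet.stdSimplex.δ k) X =
      (e' ≫ (evIso X 1).inv) ≫ restrict (SSet.stdSimplex.δ k') X)
    rw [Category.assoc, Category.assoc, evIso_inv_restrict_δ, evIso_inv_restrict_δ,
      ← Category.assoc, h, Category.assoc]
  exact ⟨ofCot (sq.desc _ _ w), toCot_injective (sq.inl_desc _ _ w),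
    toCot_injective (sq.inr_desc _ _ w)⟩

section Square

variable (p : X ⟶ Y) (f : Mor X) (z : Obj X)

/-- The comparison square of a morphism commutes. -/
lemma precompMap_homSpaceMap :
    precompMap X f (source f) z rfl ≫ homSpaceMap p (source f) z =
      triangleSpaceMap p f z ≫
        precompMap Y (mapMor p f) (mapObj p (source f)) (mapObj p z) (source_mapMor p f) := by
  rw [← cancel_mono (Subcomplex.ι _)]
  exact (triangleSpace X f z).ι ≫= p.naturality (SimplexCategory.δ (n := 1) 1).op

/-- The comparison map of a morphism. -/
noncomputable abbrev cocartComparison :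
    (triangleSpace X f z : SSet.{u}) ⟶ pullback (homSpaceMap p (source f) z)
      (precompMap Y (mapMor p f) (mapObj p (source f)) (mapObj p z) (source_mapMor p f)) :=
  pullback.lift _ _ (precompMap_homSpaceMap p f z)

/-- The edge from `0` to `2` of a point of the target of the comparison map. -/
noncomputable def cocartEdge : pullback (homSpaceMap p (source f) z)
      (precompMap Y (mapMor p f) (mapObj p (source f)) (mapObj p z) (source_mapMor p f)) ⟶ X _⦋1⦌ :=
  pullback.fst _ _ ≫ (homSpace X (source f) z).ι

/-- The cell in the base of a point of the target of the comparison map. -/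
noncomputable def cocartCell : pullback (homSpaceMap p (source f) z)
      (precompMap Y (mapMor p f) (mapObj p (source f)) (mapObj p z) (source_mapMor p f)) ⟶ Y _⦋2⦌ :=
  pullback.snd _ _ ≫ (triangleSpace Y (mapMor p f) (mapObj p z)).ι

lemma cocartEdge_src : cocartEdge p f z ≫ X.δ (n := 0) 1 = const (source f) :=
  (pullback.fst (homSpaceMap p (source f) z)
    (precompMap Y (mapMor p f) (mapObj p (source f)) (mapObj p z) (source_mapMor p f)) ≫
    Subcomplex.homOfLE inf_le_left) ≫= fiber_ι_comp (src X) (source f)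

lemma cocartEdge_tgt : cocartEdge p f z ≫ X.δ (n := 0) 0 = const z :=
  (pullback.fst (homSpaceMap p (source f) z)
    (precompMap Y (mapMor p f) (mapObj p (source f)) (mapObj p z) (source_mapMor p f)) ≫
    Subcomplex.homOfLE inf_le_right) ≫= fiber_ι_comp (tgt X) z

lemma cocartCell_δ_two : cocartCell p f z ≫ Y.δ (n := 1) 2 = const (mapMor p f) :=
  (pullback.snd (homSpaceMap p (source f) z)
    (precompMap Y (mapMor p f) (mapObj p (source f)) (mapObj p z) (source_mapMor p f)) ≫
    Subcomplex.homOfLE inf_le_left) ≫= fiber_ι_comp (Y.δ (n := 1) 2) (mapMor p f)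

lemma cocartEdge_comp : cocartEdge p f z ≫ p.app (op ⦋1⦌) = cocartCell p f z ≫ Y.δ (n := 1) 1 :=
  pullback.condition (f := homSpaceMap p (source f) z) (g := precompMap Y (mapMor p f)
    (mapObj p (source f)) (mapObj p z) (source_mapMor p f)) =≫ Subcomplex.ι _

/-- A point of the target of the comparison map is an edge from the source of f to z together with a
triangle of the base. Gluing the edge to f gives a map from Λ[2,0] lying under that triangle, hence
an extension problem. So the comparison map is a base change of the relative map of Λ[2,0]. -/
lemma exists_isPullback_cocartComparison :
    ∃ v : pullback (homSpaceMap p (source f) z)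
      (precompMap Y (mapMor p f) (mapObj p (source f)) (mapObj p z) (source_mapMor p f)) ⟶
      pullback (postcomp Λ[2, 0] p) (restrict Λ[2, 0].ι Y),
      (v ≫ pullback.fst _ _) ≫ restrict horn₂₀.ι₀₁ X = const f ≫ (evIso X 1).inv ∧
      (v ≫ pullback.fst _ _) ≫ restrict horn₂₀.ι₀₂ X = cocartEdge p f z ≫ (evIso X 1).inv ∧
      v ≫ pullback.snd _ _ = cocartCell p f z ≫ (evIso Y 2).inv ∧
      IsPullback ((triangleSpace X f z).ι ≫ (evIso X 2).inv) (cocartComparison p f z)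
        (relMap p Λ[2, 0].ι) v := by
  obtain ⟨g, hg₁, hg₂⟩ := exists_mapSpace_lift horn₂₀.isPushout (const f) (cocartEdge p f z) (by
    rw [cocartEdge_src]; exact const_comp _ _)
  have r₁ : ∀ Z : SimplicialSpace.{u}, restrict Λ[2, 0].ι Z ≫ restrict horn₂₀.ι₀₁ Z =
      restrict (SSet.stdSimplex.δ 2) Z := fun Z => by rw [← restrict_comp, horn.ι_ι]
  have r₂ : ∀ Z : SimplicialSpace.{u}, restrict Λ[2, 0].ι Z ≫ restrict horn₂₀.ι₀₂ Z =
      restrict (SSet.stdSimplex.δ 1) Z := fun Z => by rw [← restrict_comp, horn.ι_ι]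
  have w : g ≫ postcomp Λ[2, 0] p = (cocartCell p f z ≫ (evIso Y 2).inv) ≫
      restrict Λ[2, 0].ι Y := by
    apply mapSpace_hom_ext horn₂₀.isPushout
    · have h₁ := cocartCell_δ_two p f z =≫ (evIso Y 1).inv
      rw [Category.assoc] at h₁
      rw [Category.assoc, Category.assoc, Category.assoc, r₁, evIso_inv_restrict_δ, h₁,
        ← restrict_postcomp, ← Category.assoc, hg₁, Category.assoc, evIso_inv_postcomp,
        ← Category.assoc, const_comp]
    · have h₁ := cocartEdge_comp p f z =≫ (evIso Y 1).inv
      rw [Category.assoc, Category.assoc] at h₁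
      rw [Category.assoc, Category.assoc, Category.assoc, r₂, evIso_inv_restrict_δ, ← h₁,
        ← restrict_postcomp, ← Category.assoc, hg₂, Category.assoc, evIso_inv_postcomp]
  have hv₁ := pullback.lift_fst _ _ w
  have hv₂ := pullback.lift_snd _ _ w
  generalize pullback.lift _ _ w = v at hv₁ hv₂
  have c₁ : cocartComparison p f z ≫ cocartEdge p f z =
      (triangleSpace X f z).ι ≫ X.δ (n := 1) 1 :=
    pullback.lift_fst _ _ (precompMap_homSpaceMap p f z) =≫ Subcomplex.ι _
  have c₂ : cocartComparison p f z ≫ cocartCell p f z =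
      (triangleSpace X f z).ι ≫ p.app (op ⦋2⦌) :=
    pullback.lift_snd _ _ (precompMap_homSpaceMap p f z) =≫ Subcomplex.ι _
  have d₂ : (triangleSpace X f z).ι ≫ X.δ (n := 1) 2 = const f :=
    Subcomplex.homOfLE inf_le_left ≫= fiber_ι_comp (X.δ (n := 1) 2) f
  have key : ∀ {K : SSet.{u}} (q : K ⟶ mapSpace Δ[2] X) (r : K ⟶ _), q ≫ relMap p Λ[2, 0].ι = r ≫ v →
      (q ≫ (evIso X 2).hom) ≫ X.δ (n := 1) 2 = const f ∧
      (q ≫ (evIso X 2).hom) ≫ X.δ (n := 1) 1 = r ≫ cocartEdge p f z ∧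
      (q ≫ (evIso X 2).hom) ≫ p.app (op ⦋2⦌) = r ≫ cocartCell p f z := by
    intro K q r hqr
    have h₁ := hqr =≫ pullback.fst _ _
    rw [Category.assoc, relMap_fst, Category.assoc, hv₁] at h₁
    have h₂ := hqr =≫ pullback.snd _ _
    rw [Category.assoc, relMap_snd, Category.assoc, hv₂] at h₂
    refine ⟨?_, ?_, ?_⟩
    · have h₃ := h₁ =≫ restrict horn₂₀.ι₀₁ X
      rw [Category.assoc, r₁, Category.assoc, hg₁] at h₃
      rw [Category.assoc, ← restrict_δ_evIso, ← Category.assoc, h₃, Category.assoc, Category.assoc,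
        Iso.inv_hom_id, Category.comp_id]
      rfl
    · have h₃ := h₁ =≫ restrict horn₂₀.ι₀₂ X
      rw [Category.assoc, r₂, Category.assoc, hg₂] at h₃
      rw [Category.assoc, ← restrict_δ_evIso, ← Category.assoc, h₃, Category.assoc, Category.assoc,
        Iso.inv_hom_id, Category.comp_id]
    · rw [Category.assoc, ← postcomp_evIso, ← Category.assoc, h₂, Category.assoc, Category.assoc,
        Iso.inv_hom_id, Category.comp_id]
  refine ⟨v, by rw [hv₁, hg₁], by rw [hv₁, hg₂], hv₂, ⟨⟨?_⟩, ⟨PullbackCone.IsLimit.mk _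
    (fun s => Subcomplex.lift (s.fst ≫ (evIso X 2).hom)
      (le_inf (range_le_fiber ?_) (range_le_fiber ?_))) ?_ ?_ ?_⟩⟩⟩
  · apply pullback.hom_ext
    · rw [Category.assoc, relMap_fst, Category.assoc, Category.assoc (cocartComparison p f z), hv₁]
      apply mapSpace_hom_ext horn₂₀.isPushout
      · rw [Category.assoc, Category.assoc, r₁, Category.assoc, hg₁, evIso_inv_restrict_δ,
          ← Category.assoc, d₂]
        rfl
      · rw [Category.assoc, Category.assoc, r₂, Category.assoc, hg₂, evIso_inv_restrict_δ,
          ← Category.assoc, ← Category.assoc, c₁]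
    · rw [Category.assoc, relMap_snd, Category.assoc, Category.assoc (cocartComparison p f z), hv₂, evIso_inv_postcomp,
        ← Category.assoc, ← Category.assoc, c₂]
  · exact (key _ _ s.condition).1
  · rw [← Category.assoc, (key _ _ s.condition).2.1, Category.assoc]
    exact s.snd ≫= cocartEdge_tgt p f z
  · intro s
    have := s.fst ≫= (evIso X 2).hom_inv_id
    rw [Category.comp_id, ← Category.assoc] at this
    exact this
  · intro s
    obtain ⟨-, h₁, h₂⟩ := key _ _ s.condition
    apply pullback.hom_ext
    · rw [← cancel_mono (Subcomplex.ι _)]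
      exact (Subcomplex.lift _ _ ≫= c₁).trans h₁
    · rw [← cancel_mono (Subcomplex.ι _)]
      exact (Subcomplex.lift _ _ ≫= c₂).trans h₂
  · intro s m h₁ h₂
    rw [← cancel_mono (Subcomplex.ι _)]
    have := h₁ =≫ (evIso X 2).hom
    rw [Category.assoc, Category.assoc, Iso.inv_hom_id, Category.comp_id] at this
    exact this

end Square

/-- The comparison maps are Kan fibrations with Kan source, so they are equivalences exactly when
their fibers are contractible. As z varies these are the fibers of the relative map of Λ[2,0] over
the problems with f on the edge 01. -/
theorem isCoCartesianMor_iff {p : X ⟶ Y} (hp : IsReedyFibration p) (hX : IsReedyFibrant X)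
    (f : Mor X) : IsCoCartesianMor p f ↔ IsCoCart p f := by
  constructor
  · intro h α γ hα t ht₁ ht₂
    obtain ⟨e, he⟩ := exists_simplexMap (horn₂₀.ι₀₂ ≫ α)
    obtain ⟨ν, rfl⟩ := exists_simplexMap γ
    -- The relevant object z is read off from the edge 02 of the horn.
    obtain ⟨w, hw⟩ := h (target e)
    obtain ⟨v, hv₁, hv₂, hv₃, sq⟩ := exists_isPullback_cocartComparison p f (target e)
    have htriv : IsTrivialFibration (cocartComparison p f (target e)) :=
      (isKanFibration_of_isPullback sq (hp.isKanFibration_relMap _)).isTrivialFibration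
        (isKan_triangleSpace hX f _) hw
    have c : α ≫ pointsMap p = Λ[2, 0].ι ≫ simplexMap ν := by
      have := ConcreteCategory.congr_hom (congr_app
        (pullback.condition (f := postcomp Λ[2, 0] p) (g := restrict Λ[2, 0].ι Y)) (op ⦋0⦌)) t
      rw [← ht₁, ← ht₂]
      exact this
    have hν₂ : (Y.δ (n := 1) 2).app _ ν = mapMor p f := by
      refine simplexMap_injective ?_
      rw [← δ_comp_simplexMap, ← simplexMap_pointsMap, ← hα, Category.assoc, c, ← Category.assoc,
        horn.ι_ι]
    have hν₁ : (Y.δ (n := 1) 1).app _ ν = mapMor p e := by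
      refine simplexMap_injective ?_
      rw [← δ_comp_simplexMap, ← simplexMap_pointsMap, he, Category.assoc, c, ← Category.assoc,
        horn.ι_ι]
    have hs : source e = source f := by
      refine simplexMap_injective ?_
      rw [← δ_comp_simplexMap, ← δ_comp_simplexMap, he, ← hα, ← Category.assoc, ← Category.assoc,
        horn₂₀.isPushout.w]
    have he₁ : e ∈ (homSpace X (source f) (target e)).obj (op ⦋0⦌) :=
      ⟨mem_fiber_zero_iff.2 hs, mem_fiber_zero_iff.2 rfl⟩
    have hν : ν ∈ (triangleSpace Y (mapMor p f) (mapObj p (target e))).obj (op ⦋0⦌) := by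
      refine ⟨mem_fiber_zero_iff.2 hν₂, mem_fiber_zero_iff.2 ?_⟩
      refine (congr_arg ((tgt Y).app (op ⦋0⦌)) hν₁).trans ?_
      exact (ConcreteCategory.congr_hom (congr_app
        (p.naturality (SimplexCategory.δ (n := 0) 0).op) (op ⦋0⦌)) e).symm
    obtain ⟨b, hb₁, hb₂⟩ := exists_simplex_of_isPullback (IsPullback.of_hasPullback
      (homSpaceMap p (source f) (target e)) (precompMap Y (mapMor p f) (mapObj p (source f))
        (mapObj p (target e)) (source_mapMor p f))) (m := 0) ⟨e, he₁⟩ ⟨ν, hν⟩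
        (Subtype.ext hν₁.symm)
    have := (contractibleAt_iff_of_isPullback sq b).1 (htriv.contractibleAt b)
    have ht : t = v.app _ b := by
      refine simplex_ext_of_isPullback (IsPullback.of_hasPullback _ _) ?_ ?_
      · rw [ht₁]
        have e₁ := ConcreteCategory.congr_hom (congr_app hv₁ (op ⦋0⦌)) b
        have e₂ := ConcreteCategory.congr_hom (congr_app hv₂ (op ⦋0⦌)) b
        refine horn₂₀.isPushout.hom_ext ?_ ?_
        · rw [hα]
          refine Eq.trans ?_ e₁.symm
          rw [const_evIso_inv]
          exact (const_app_zero (Y := mapSpace Δ[1] X) _).symm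
        · rw [← he]
          refine Eq.trans ?_ e₂.symm
          exact congr_arg (fun y => (evIso X 1).inv.app (op ⦋0⦌) y.1) hb₁.symm
      · rw [ht₂]
        refine Eq.trans ?_ (ConcreteCategory.congr_hom (congr_app hv₃ (op ⦋0⦌)) b).symm
        exact congr_arg (fun y => (evIso Y 2).inv.app (op ⦋0⦌) y.1) hb₂.symm
    rw [ht]
    exact this
  · intro h z
    refine ⟨precompMap_homSpaceMap p f z, ?_⟩
    obtain ⟨v, hv₁, hv₂, hv₃, sq⟩ := exists_isPullback_cocartComparison p f z
    refine IsTrivialFibration.isEquivalence ((isKanFibration_of_isPullback sq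
      (hp.isKanFibration_relMap _)).isTrivialFibration_of_contractibleAt fun b => ?_)
    rw [contractibleAt_iff_of_isPullback sq]
    refine h _ _ ?_ _ rfl rfl
    have := ConcreteCategory.congr_hom (congr_app hv₁ (op ⦋0⦌)) b
    refine this.trans ?_
    rw [const_evIso_inv]
    exact const_app_zero (Y := mapSpace Δ[1] X) _

end SimplicialSpace

namespace SimplicialSpace

open MonoidalCategory CartesianMonoidalCategory HomotopicalAlgebra SSet
open SSet.modelCategoryQuillen

variable {X Y : SimplicialSpace.{u}}

lemma horn_two_zero_ι₀₁_ι : horn₂₀.ι₀₁.{u} ≫ Λ[2, 0].ι = SSet.stdSimplex.δ 2 := horn.ι_ι _ _ _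

lemma horn_two_zero_ι₀₂_ι : horn₂₀.ι₀₂.{u} ≫ Λ[2, 0].ι = SSet.stdSimplex.δ 1 := horn.ι_ι _ _ _

lemma horn_two_one_ι₀₁_ι : horn₂₁.ι₀₁.{u} ≫ Λ[2, 1].ι = SSet.stdSimplex.δ 2 := horn.ι_ι _ _ _

lemma horn_two_one_ι₁₂_ι : horn₂₁.ι₁₂.{u} ≫ Λ[2, 1].ι = SSet.stdSimplex.δ 0 := horn.ι_ι _ _ _

lemma joined_simplexMap {n : ℕ} {x y : (X _⦋n⦌) _⦋0⦌} (h : Joined x y) :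
    Joined (K := mapSpace Δ[n] X) (simplexMap x) (simplexMap y) :=
  h.map (evIso X n).inv

lemma joined_of_simplexMap {n : ℕ} {x y : (X _⦋n⦌) _⦋0⦌}
    (h : Joined (K := mapSpace Δ[n] X) (simplexMap x) (simplexMap y)) : Joined x y := by
  have := h.map (evIso X n).hom
  have e : ∀ x : (X _⦋n⦌) _⦋0⦌, (evIso X n).hom.app (op ⦋0⦌) (simplexMap x) = x := fun x =>
    ConcreteCategory.congr_hom (congr_app (evIso X n).inv_hom_id (op ⦋0⦌)) x
  rwa [e, e] at this

/-- Instance of `isInvariant_relContractible` for the edge 01 inside Λ[2,0]. -/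
lemma isInvariant_isCoCart {p : X ⟶ Y} (hp : IsReedyFibration p) (hX : IsReedyFibrant X)
    (hY : IsReedyFibrant Y) : IsInvariant (K := X _⦋1⦌) (IsCoCart p) := by
  have : Mono horn₂₀.ι₀₁.{u} := by
    have : Mono (horn₂₀.ι₀₁.{u} ≫ Λ[2, 0].ι) := by
      rw [horn_two_zero_ι₀₁_ι]
      exact mono_map (by decide)
    exact mono_of_mono _ Λ[2, 0].ι
  intro f g h
  exact isInvariant_relContractible hp hX hY horn₂₀.ι₀₁.{u} Λ[2, 0].ι (isKan_mapSpace hX _)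
    (joined_simplexMap h)

/-! ### Identities are coCartesian -/

section Degenerate

/-- The `2`-simplex with its edge from `0` to `1` collapsed. -/
noncomputable abbrev collapsedTriangle : SSet.{u} :=
  pushout (SSet.stdSimplex.{u}.δ (2 : Fin 3)) (SSet.stdSimplex.σ (0 : Fin 1))

noncomputable abbrev toCollapsed : Δ[2] ⟶ collapsedTriangle.{u} := pushout.inl _ _

noncomputable abbrev ofCollapsed : collapsedTriangle.{u} ⟶ Δ[1] :=
  pushout.desc (SSet.stdSimplex.σ (0 : Fin 2)) (SSet.stdSimplex.δ (1 : Fin 2)) (by decide)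

lemma toCollapsed_ofCollapsed : toCollapsed.{u} ≫ ofCollapsed = SSet.stdSimplex.σ (0 : Fin 2) :=
  pushout.inl_desc _ _ _

/-- Collapsing the edge 01 turns the horn Λ into its other edge, so the collapsed triangle is that
edge with a triangle attached along Λ. Both Λ[2,1] and Λ[2,0] are covered, according to the end of
01 at which the other edge starts. -/
lemma exists_isPushout_collapsed {Λ : (Δ[2] : SSet.{u}).Subcomplex} {k : Fin 2}
    {i₀ i₁ : Δ[1] ⟶ (Λ : SSet.{u})} {k' : Fin 3}
    (sq : IsPushout (SSet.stdSimplex.δ k) (SSet.stdSimplex.δ (1 : Fin 2)) i₀ i₁)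
    (h₀ : i₀ ≫ Λ.ι = SSet.stdSimplex.δ (2 : Fin 3)) (h₁ : i₁ ≫ Λ.ι = SSet.stdSimplex.δ k') :
    ∃ c : (Λ : SSet.{u}) ⟶ Δ[1], i₀ ≫ c = SSet.stdSimplex.σ 0 ≫ SSet.stdSimplex.δ 1 ∧ i₁ ≫ c = 𝟙 _ ∧
      IsPushout c Λ.ι (SSet.stdSimplex.δ k' ≫ toCollapsed) toCollapsed := by
  have e : SSet.stdSimplex.{u}.δ k ≫ SSet.stdSimplex.σ (0 : Fin 1) = 𝟙 Δ[0] := by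
    fin_cases k <;> decide
  have w : SSet.stdSimplex.{u}.δ k ≫ SSet.stdSimplex.σ 0 ≫ SSet.stdSimplex.δ (1 : Fin 2) =
      SSet.stdSimplex.δ (1 : Fin 2) ≫ 𝟙 _ := by
    rw [← Category.assoc, e]; rfl
  have hc₀ := sq.inl_desc _ _ w
  have hc₁ := sq.inr_desc _ _ w
  generalize sq.desc _ _ w = c at hc₀ hc₁
  have sq₁ : IsPushout (SSet.stdSimplex.{u}.σ (0 : Fin 1)) i₀ (SSet.stdSimplex.δ (1 : Fin 2)) c := by
    refine IsPushout.of_left (h₁₁ := SSet.stdSimplex.δ k) (h₂₁ := i₁)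
      (v₁₁ := SSet.stdSimplex.δ (1 : Fin 2)) ?_ hc₀.symm sq
    rw [e, hc₁]
    exact IsPushout.of_horiz_isIso ⟨by simp⟩
  refine ⟨c, hc₀, hc₁, ?_⟩
  have w₂ : SSet.stdSimplex.δ (1 : Fin 2) ≫ SSet.stdSimplex.δ k' ≫ toCollapsed =
      pushout.inr (SSet.stdSimplex.{u}.δ (2 : Fin 3)) (SSet.stdSimplex.σ (0 : Fin 1)) := by
    have h₂ : SSet.stdSimplex.{u}.δ k ≫ SSet.stdSimplex.δ 2 ≫ toCollapsed =
        SSet.stdSimplex.δ (1 : Fin 2) ≫ SSet.stdSimplex.δ k' ≫ toCollapsed := by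
      rw [← h₀, ← h₁, Category.assoc, Category.assoc, ← Category.assoc, sq.w, Category.assoc]
    rw [← h₂, pushout.condition, ← Category.assoc, e, Category.id_comp]
  have sq₂ : IsPushout (SSet.stdSimplex.σ (0 : Fin 1)) (i₀ ≫ Λ.ι)
      (SSet.stdSimplex.δ (1 : Fin 2) ≫ SSet.stdSimplex.δ k' ≫ toCollapsed) toCollapsed := by
    rw [h₀, w₂]
    exact (IsPushout.of_hasPushout _ _).flip
  refine IsPushout.of_top sq₂ ?_ sq₁
  refine sq.hom_ext ?_ ?_
  · rw [← Category.assoc, hc₀, Category.assoc, w₂, ← Category.assoc, h₀, pushout.condition]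
  · rw [← Category.assoc, hc₁, Category.id_comp, ← Category.assoc, h₁]

/-- For the edge 12 this is a cobase change of the inner horn. The edges 12 and 02 are both sections
of the same retraction onto Δ[1]; restriction along the retraction is a homotopy inverse for the
first, hence also for the second. -/
lemma IsSegal.isLocal_collapsed (hX : IsSegal X) (k : Fin 3) (hk : k = 0 ∨ k = 1) :
    IsLocal X (SSet.stdSimplex.δ k ≫ toCollapsed.{u}) := by
  have e : ∀ k : Fin 3, k = 0 ∨ k = 1 →
      (SSet.stdSimplex.δ k ≫ toCollapsed.{u}) ≫ ofCollapsed = 𝟙 _ := by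
    rintro k (rfl | rfl)
    · rw [Category.assoc, toCollapsed_ofCollapsed]; decide
    · rw [Category.assoc, toCollapsed_ofCollapsed]; decide
  have h₀ : IsLocal X (SSet.stdSimplex.δ 0 ≫ toCollapsed.{u}) := by
    obtain ⟨c, -, -, sq⟩ := exists_isPushout_collapsed.{u} horn₂₁.isPushout horn_two_one_ι₀₁_ι
      horn_two_one_ι₁₂_ι
    exact hX.isLocal_horn.of_isPushout sq
  have : IsSplitMono (SSet.stdSimplex.δ k ≫ toCollapsed.{u}) := ⟨⟨⟨ofCollapsed, e k hk⟩⟩⟩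
  refine (hX.reedyFibrant.isKanFibration_restrict _).isTrivialFibration
    (isKan_mapSpace hX.reedyFibrant _) ?_
  refine isEquivalence_of_section (isKan_mapSpace hX.reedyFibrant _) (s := restrict ofCollapsed X)
    ?_ (t := restrict (SSet.stdSimplex.δ 0 ≫ toCollapsed) X) ?_
  · rw [← restrict_comp, e k hk, restrict_id]
  · obtain ⟨s, hs, hs'⟩ := h₀.exists_section
    have h : s = restrict ofCollapsed X ≫ (restrict (SSet.stdSimplex.δ 0 ≫ toCollapsed) X ≫ s) := by
      rw [← Category.assoc, ← restrict_comp, e 0 (.inl rfl), restrict_id, Category.id_comp]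
    have h' := hs'.precomp (restrict (SSet.stdSimplex.δ 0 ≫ toCollapsed) X ≫ restrict ofCollapsed X)
    rw [Category.assoc, ← h, Category.comp_id] at h'
    exact (h'.symm (isKan_mapSpace hX.reedyFibrant _)).trans (isKan_mapSpace hX.reedyFibrant _) hs'

/-- A horn with an identity on 01, and the triangle under it, factor through the collapse of that
edge. The problem thus becomes extension from the edge 02 to the collapsed triangle, which is local
for both spaces. -/
lemma isCoCart_idMor {p : X ⟶ Y} (hp : IsReedyFibration p) (hX : IsSegal X) (hY : IsSegal Y)
    (x : Obj X) : IsCoCart p (idMor x) := by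
  obtain ⟨c, hc₀, hc₁, sq⟩ := exists_isPushout_collapsed.{u} horn₂₀.isPushout horn_two_zero_ι₀₁_ι
      horn_two_zero_ι₀₂_ι
  intro α γ hα t ht₁ ht₂
  have w : α ≫ pointsMap p = Λ[2, 0].ι ≫ γ := by
    have := ConcreteCategory.congr_hom (congr_app
      (pullback.condition (f := postcomp Λ[2, 0] p) (g := restrict Λ[2, 0].ι Y)) (op ⦋0⦌)) t
    rw [← ht₁, ← ht₂]
    exact this
  rw [← σ_comp_simplexMap (n := 0)] at hα
  have hα' : c ≫ horn₂₀.ι₀₂ ≫ α = α := by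
    refine horn₂₀.isPushout.hom_ext ?_ ?_
    · have e : SSet.stdSimplex.{u}.δ (1 : Fin 2) ≫ SSet.stdSimplex.σ (0 : Fin 1) = 𝟙 Δ[0] := by decide
      have e' : SSet.stdSimplex.δ (1 : Fin 2) ≫ horn₂₀.ι₀₂ ≫ α = simplexMap x := by
        rw [← Category.assoc, ← horn₂₀.isPushout.w, Category.assoc, hα, ← Category.assoc, e,
          Category.id_comp]
      rw [← Category.assoc, hc₀, Category.assoc, e', hα]
    · rw [← Category.assoc, hc₁, Category.id_comp]
  have w' : SSet.stdSimplex.δ (2 : Fin 3) ≫ γ = SSet.stdSimplex.σ (0 : Fin 1) ≫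
      simplexMap x ≫ pointsMap p := by
    rw [← horn_two_zero_ι₀₁_ι, Category.assoc, ← w, ← Category.assoc, hα, Category.assoc]
  have hγ : toCollapsed ≫ pushout.desc γ (simplexMap x ≫ pointsMap p) w' = γ :=
    pushout.inl_desc _ _ _
  have hmono : Mono (SSet.stdSimplex.δ 1 ≫ toCollapsed.{u}) := by
    have : Mono ((SSet.stdSimplex.δ 1 ≫ toCollapsed.{u}) ≫ ofCollapsed) := by
      rw [Category.assoc, toCollapsed_ofCollapsed]
      have : SSet.stdSimplex.{u}.δ (1 : Fin 3) ≫ SSet.stdSimplex.σ (0 : Fin 2) = 𝟙 Δ[1] := by decide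
      rw [this]; infer_instance
    exact mono_of_mono _ ofCollapsed
  have key : RelContractible p Λ[2, 0].ι (c ≫ horn₂₀.ι₀₂ ≫ α)
      (toCollapsed ≫ pushout.desc γ (simplexMap x ≫ pointsMap p) w') := by
    refine RelContractible.of_isPushout' sq (relContractible_of_isTrivialFibration
      (isTrivialFibration_relMap hp (hX.isLocal_collapsed 1 (.inr rfl))
        (hY.isLocal_collapsed 1 (.inr rfl))) _ _) ?_
    rw [Category.assoc, Category.assoc, hγ, w, ← Category.assoc, horn_two_zero_ι₀₂_ι]
  rw [hα', hγ] at key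
  exact key t ht₁ ht₂

end Degenerate

end SimplicialSpace

/-! ### Composition and cancellation of coCartesian morphisms -/

namespace SimplicialSpace

open MonoidalCategory CartesianMonoidalCategory HomotopicalAlgebra SSet
open SSet.modelCategoryQuillen

variable {X Y : SimplicialSpace.{u}}

/-- Gluing a triangle and an edge in the `3`-simplex. -/
lemma exists_triangle_edge {Z : SSet.{u}} {θ : ⦋1⦌ ⟶ ⦋3⦌} (hθ : Function.Injective θ.toOrderHom)
    {S : Finset (Fin 4)} (hS : S = Finset.univ.image θ.toOrderHom)
    (h : Refines ([({0, 1, 2} : Finset (Fin 4))].map fun S => Finset.univ.filter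
        fun i => θ.toOrderHom i ∈ S) [{0}] ∧
      Refines [{0}] ([({0, 1, 2} : Finset (Fin 4))].map fun S => Finset.univ.filter
        fun i => θ.toOrderHom i ∈ S))
    (ν : Δ[2] ⟶ Z) (e : Δ[1] ⟶ Z) (j : Δ[0] ⟶ Δ[2])
    (hj : j ≫ SSet.stdSimplex.δ 3 = SSet.stdSimplex.δ 1 ≫ SSet.stdSimplex.map θ)
    (w : j ≫ ν = SSet.stdSimplex.δ 1 ≫ e) :
    ∃ (s : (faces.{u} [({0, 1, 2} : Finset (Fin 4)), S] : SSet.{u}) ⟶ Z)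
      (b₂ : Δ[2] ⟶ (faces.{u} [({0, 1, 2} : Finset (Fin 4)), S] : SSet.{u}))
      (b₁ : Δ[1] ⟶ (faces.{u} [({0, 1, 2} : Finset (Fin 4)), S] : SSet.{u})),
      b₂ ≫ (faces _).ι = SSet.stdSimplex.δ 3 ∧ b₁ ≫ (faces _).ι = SSet.stdSimplex.map θ ∧
        b₂ ≫ s = ν ∧ b₁ ≫ s = e := by
  subst hS
  obtain ⟨a₀, hD₀, b₀, sq₀, -, hb₀⟩ := isPushout_faces.{u} (l := [])
    (l' := [({0, 1, 2} : Finset (Fin 4))])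
    (θ := SimplexCategory.δ (3 : Fin 4)) (by decide) faces_nil (by decide) (by decide)
  obtain ⟨a₁, hD₁, b₁, sq₁, ha₁, hb₁⟩ := isPushout_faces.{u} (l := [{0, 1, 2}])
    (l' := [({0, 1, 2} : Finset (Fin 4)), Finset.univ.image θ.toOrderHom])
    (θ := θ) hθ faces_vertex_zero h
    ⟨fun S hS => ⟨S, hS, subset_rfl⟩, fun S hS => ⟨S, hS, subset_rfl⟩⟩
  have hs : ∃ s : (faces.{u} ([] : List (Finset (Fin 4))) : SSet.{u}) ⟶ Z, True := by
    rw [faces_nil]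
    exact ⟨Subcomplex.isInitialBot.to _, trivial⟩
  obtain ⟨s, -⟩ := hs
  have w₀ : a₀ ≫ s = (⊥ : (Δ[2] : SSet.{u}).Subcomplex).ι ≫ ν :=
    Subcomplex.isInitialBot.hom_ext _ _
  obtain ⟨l, hl, hl'⟩ := exists_desc_edge sq₁ ha₁ (sq₀.desc _ _ w₀) e (j ≫ b₀) (by
      rw [Category.assoc, hb₀]; exact hj) (by
      rw [Category.assoc, sq₀.inr_desc]; exact w)
  refine ⟨l, b₀ ≫ Subcomplex.homOfLE hD₁, b₁, ?_, hb₁, ?_, hl'⟩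
  · rw [Category.assoc, Subcomplex.homOfLE_ι, hb₀]; rfl
  · rw [Category.assoc, hl, sq₀.inr_desc]

lemma IsCoCart.relContractible_faces {p : X ⟶ Y} {f : Mor X} (hf : IsCoCart p f) {n : ℕ}
    {θ : ⦋2⦌ ⟶ ⦋n⦌} (hθ : Function.Injective θ.toOrderHom) {l l' : List (Finset (Fin (n + 1)))}
    (h : Refines (l.map fun S => Finset.univ.filter fun i => θ.toOrderHom i ∈ S) [{0, 1}, {0, 2}] ∧
      Refines [{0, 1}, {0, 2}] (l.map fun S => Finset.univ.filter fun i => θ.toOrderHom i ∈ S))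
    (h' : Refines (l ++ [Finset.univ.image θ.toOrderHom]) l' ∧
      Refines l' (l ++ [Finset.univ.image θ.toOrderHom])) (hD : faces.{u} l ≤ faces l')
    (α : (faces.{u} l : SSet.{u}) ⟶ points X) (γ : (faces.{u} l' : SSet.{u}) ⟶ points Y)
    (v : Δ[1] ⟶ (faces.{u} l : SSet.{u}))
    (hv : v ≫ (faces l).ι = SSet.stdSimplex.δ 2 ≫ SSet.stdSimplex.map θ)
    (hα : v ≫ α = simplexMap f) : RelContractible p (Subcomplex.homOfLE hD) α γ := by
  obtain ⟨a, hD, b, sq, ha, -⟩ := isPushout_faces.{u} hθ faces_horn_two_zero h h'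
  refine RelContractible.of_isPushout sq (hf _ _ ?_)
  rw [← hα, ← Category.assoc]
  congr 1
  rw [← cancel_mono (faces l).ι, Category.assoc, ha, hv, ← Category.assoc, horn_two_zero_ι₀₁_ι]

lemma exists_lift_faces {m n : ℕ} {θ : ⦋m⦌ ⟶ ⦋n⦌} (hθ : Function.Injective θ.toOrderHom)
    {l : List (Finset (Fin (n + 1)))} (h : Refines [Finset.univ.image θ.toOrderHom] l) :
    ∃ b : Δ[m] ⟶ (faces.{u} l : SSet.{u}), b ≫ (faces l).ι = SSet.stdSimplex.map θ :=
  ⟨Subcomplex.lift (SSet.stdSimplex.map θ) (by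
    rw [range_map θ hθ, ← faces_singleton]
    exact faces_le h), rfl⟩

lemma condition_of_relPoint {p : X ⟶ Y} {A B : SSet.{u}} {i : A ⟶ B} {α : A ⟶ points X}
    {γ : B ⟶ points Y} (t : (pullback (postcomp A p) (restrict i Y)) _⦋0⦌)
    (ht₁ : (pullback.fst (postcomp A p) (restrict i Y)).app _ t = α)
    (ht₂ : (pullback.snd (postcomp A p) (restrict i Y)).app _ t = γ) :
    α ≫ pointsMap p = i ≫ γ := by
  have := ConcreteCategory.congr_hom (congr_app
    (pullback.condition (f := postcomp A p) (g := restrict i Y)) (op ⦋0⦌)) t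
  rw [← ht₁, ← ht₂]
  exact this

section

variable {p : X ⟶ Y} (hp : IsReedyFibration p) (hX : IsSegal X) (hY : IsSegal Y)
  {ν : (X _⦋2⦌) _⦋0⦌}

include hp hX hY

/-- CoCartesian morphisms are stable under composition. -/
lemma IsCoCart.comp (h₂ : IsCoCart p ((X.δ (n := 1) 2).app _ ν))
    (h₀ : IsCoCart p ((X.δ (n := 1) 0).app _ ν)) : IsCoCart p ((X.δ (n := 1) 1).app _ ν) := by
  intro α γ hα t ht₁ ht₂
  have w := condition_of_relPoint t ht₁ ht₂
  rw [← δ_comp_simplexMap] at hα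
  -- In Δ[3] the cell `ν` is placed on 012, and the given horn on the edges 02 and 03 of the face
  -- 023.
  obtain ⟨α₁, b₂, b₁, hb₂, hb₁, hα₂, hα₁⟩ := exists_triangle_edge.{u}
    (θ := SimplexCategory.δ (1 : Fin 3) ≫ SimplexCategory.δ (1 : Fin 4)) (S := {0, 3})
    (by decide) (by decide) (by decide) (simplexMap ν) (horn₂₀.ι₀₂ ≫ α)
    (SSet.stdSimplex.δ 1 ≫ SSet.stdSimplex.δ 1) (by decide)
    ((SSet.stdSimplex.δ 1 ≫= hα.symm).trans (horn₂₀.isPushout.w =≫ α))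
  obtain ⟨a, hD, b, sq, ha, hb⟩ := isPushout_faces.{u} (l := [({0, 1, 2} : Finset (Fin 4)), {0, 3}])
    (l' := [{0, 1, 2}, {0, 2, 3}]) (θ := SimplexCategory.δ (1 : Fin 4)) (by decide)
    faces_horn_two_zero (by decide) (by decide)
  have haα : a ≫ α₁ = α := by
    refine horn₂₀.isPushout.hom_ext ?_ ?_
    · rw [hα, ← hα₂, ← Category.assoc, ← Category.assoc]
      congr 1
      rw [← cancel_mono (faces _).ι, Category.assoc, ha, Category.assoc, hb₂, ← Category.assoc,
        horn_two_zero_ι₀₁_ι]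
      decide
    · rw [← hα₁, ← Category.assoc]
      congr 1
      rw [← cancel_mono (faces _).ι, Category.assoc, ha, hb₁, ← Category.assoc,
        horn_two_zero_ι₀₂_ι]
      decide
  have w' : a ≫ α₁ ≫ pointsMap p = Λ[2, 0].ι ≫ γ := by rw [← Category.assoc, haα, w]
  have hγ₁ := sq.inl_desc _ _ w'
  have hγ₂ := sq.inr_desc _ _ w'
  generalize sq.desc _ _ w' = γ' at hγ₁ hγ₂
  -- The triangles 012 and 023 of the base extend to a full 3-simplex, so that the two filtrations
  -- of Δ[3] can be compared over it.
  obtain ⟨γ₃, rfl⟩ := hY.isLocal_squareFaces.exists_extension γ'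
  have key : RelContractible p (faces.{u} [({0, 1, 2} : Finset (Fin 4)), {0, 3}]).ι α₁ γ₃ := by
    have hD₁ : faces.{u} [({0, 1, 2} : Finset (Fin 4)), {0, 3}] ≤ faces [{0, 1, 2}, {0, 1, 3}] :=
      faces_le (by decide)
    have hD₂ : faces.{u} [({0, 1, 2} : Finset (Fin 4)), {0, 1, 3}] ≤ innerHornFaces :=
      faces_le (by decide)
    rw [← Subcomplex.homOfLE_ι hD₁, ← Subcomplex.homOfLE_ι hD₂]
    refine RelContractible.comp hp (i := Subcomplex.homOfLE hD₁)
      (j := Subcomplex.homOfLE hD₂ ≫ innerHornFaces.ι) ?_ fun β hβ hβ' => ?_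
    -- One filtration attaches 013 using the coCartesian edge 01, then 123 using the coCartesian
    -- edge 12, and finally fills the inner horn.
    · refine h₂.relContractible_faces (θ := SimplexCategory.δ (2 : Fin 4)) (by decide) (by decide)
        (by decide) _ _ _ (SSet.stdSimplex.δ 2 ≫ b₂) ?_ ?_
      · rw [Category.assoc, hb₂]; decide
      · rw [Category.assoc, hα₂, δ_comp_simplexMap]
    · refine RelContractible.comp hp (i := Subcomplex.homOfLE hD₂)
        (j := innerHornFaces.ι) ?_ fun β' _ _ => relContractible_of_isTrivialFibration
          (isTrivialFibration_relMap hp hX.isLocal_innerHornFaces hY.isLocal_innerHornFaces) _ _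
      refine h₀.relContractible_faces (θ := SimplexCategory.δ (0 : Fin 4)) (by decide) (by decide)
        (by decide) _ _ _ (SSet.stdSimplex.δ 0 ≫ b₂ ≫ Subcomplex.homOfLE hD₁) ?_ ?_
      · rw [Category.assoc, Category.assoc, Subcomplex.homOfLE_ι, hb₂]; decide
      · rw [Category.assoc, Category.assoc, hβ, hα₂, δ_comp_simplexMap]
  rw [← Subcomplex.homOfLE_ι hD] at key
  -- The other filtration attaches 023 and then fills the square, which is free; so the attachment
  -- of 023 has contractible fiber too.
  have h₁ := RelContractible.of_isPushout' sq (RelContractible.of_comp_right hp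
    (j := squareFaces.ι) (i := Subcomplex.homOfLE hD) key (fun β' _ _ =>
      relContractible_of_isTrivialFibration
        (isTrivialFibration_relMap hp hX.isLocal_squareFaces hY.isLocal_squareFaces) _ _) hγ₁.symm)
        hγ₁.symm
  rw [haα, hγ₂] at h₁
  exact h₁ t ht₁ ht₂

/-- Cancellation for coCartesian morphisms. -/
lemma IsCoCart.of_comp (h₂ : IsCoCart p ((X.δ (n := 1) 2).app _ ν))
    (h₁ : IsCoCart p ((X.δ (n := 1) 1).app _ ν)) : IsCoCart p ((X.δ (n := 1) 0).app _ ν) := by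
  intro α γ hα t ht₁ ht₂
  have w := condition_of_relPoint t ht₁ ht₂
  rw [← δ_comp_simplexMap] at hα
  -- The given horn now sits on the edges 12 and 13 of the face 123, with `ν` on 012.
  obtain ⟨α₁, b₂, b₁, hb₂, hb₁, hα₂, hα₁⟩ := exists_triangle_edge.{u}
    (θ := SimplexCategory.δ (1 : Fin 3) ≫ SimplexCategory.δ (0 : Fin 4)) (S := {1, 3})
    (by decide) (by decide) (by decide) (simplexMap ν) (horn₂₀.ι₀₂ ≫ α)
    (SSet.stdSimplex.δ 1 ≫ SSet.stdSimplex.δ 0) (by decide)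
    ((SSet.stdSimplex.δ 1 ≫= hα.symm).trans (horn₂₀.isPushout.w =≫ α))
  -- The Segal condition composes the edges 01 and 13, giving the face 013 and with it an edge 03.
  obtain ⟨hE, hE'⟩ := IsLocal.faces hX (θ := SimplexCategory.δ (2 : Fin 4)) (by decide)
    [{0, 1, 2}, {1, 3}] [{0, 1, 2}, {0, 1, 3}] (by decide) (by decide)
  obtain ⟨β, rfl⟩ := hE'.exists_extension α₁
  obtain ⟨a, hD, b, sq, ha, hb⟩ := isPushout_faces.{u}
    (l := [({0, 1, 2} : Finset (Fin 4)), {0, 1, 3}])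
    (l' := [{0, 1, 2}, {0, 1, 3}, {1, 2, 3}]) (θ := SimplexCategory.δ (0 : Fin 4)) (by decide)
    faces_horn_two_zero (by decide) (by decide)
  have haα : a ≫ β = α := by
    refine horn₂₀.isPushout.hom_ext ?_ ?_
    · rw [hα, ← hα₂, ← Category.assoc, ← Category.assoc, ← Category.assoc]
      congr 1
      rw [← cancel_mono (faces _).ι, Category.assoc, ha, ← Category.assoc, horn_two_zero_ι₀₁_ι,
        Category.assoc, Category.assoc, Subcomplex.homOfLE_ι, hb₂]
      decide
    · rw [← hα₁, ← Category.assoc, ← Category.assoc]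
      congr 1
      rw [← cancel_mono (faces _).ι, Category.assoc, ha, ← Category.assoc, horn_two_zero_ι₀₂_ι,
        Category.assoc, Subcomplex.homOfLE_ι, hb₁]
      decide
  have w' : a ≫ β ≫ pointsMap p = Λ[2, 0].ι ≫ γ := by rw [← Category.assoc, haα, w]
  have hγ₁ := sq.inl_desc _ _ w'
  have hγ₂ := sq.inr_desc _ _ w'
  generalize sq.desc _ _ w' = γ' at hγ₁ hγ₂
  obtain ⟨γ₃, rfl⟩ := hY.isLocal_innerHornFaces.exists_extension γ'
  have hA : faces.{u} [({0, 1, 2} : Finset (Fin 4)), {0, 3}] ≤ faces [{0, 1, 2}, {0, 1, 3}] :=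
    faces_le (by decide)
  have hF : faces.{u} [({0, 1, 2} : Finset (Fin 4)), {0, 3}] ≤ squareFaces := faces_le (by decide)
  obtain ⟨b₃, hb₃⟩ := exists_lift_faces.{u} (θ := SimplexCategory.δ (3 : Fin 4)) (by decide)
    (l := [({0, 1, 2} : Finset (Fin 4)), {0, 3}]) (by decide)
  have hβ : b₃ ≫ Subcomplex.homOfLE hA ≫ β = simplexMap ν := by
    rw [← hα₂, ← Category.assoc, ← Category.assoc]
    congr 1
    rw [← cancel_mono (faces _).ι, Category.assoc, Category.assoc, Subcomplex.homOfLE_ι,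
      Subcomplex.homOfLE_ι, hb₂, hb₃]
    rfl
  -- From 012 and 03 the whole simplex is reached by attaching 023 along the coCartesian edge 02. On
  -- the other route 013 is attached along the coCartesian edge 01, then 123, then the interior;
  -- only the step 123 is unknown, so it follows by cancellation.
  have key : RelContractible p (faces.{u} [({0, 1, 2} : Finset (Fin 4)), {0, 3}]).ι
      (Subcomplex.homOfLE hA ≫ β) γ₃ := by
    rw [← Subcomplex.homOfLE_ι hF]
    refine RelContractible.comp hp (i := Subcomplex.homOfLE hF) (j := squareFaces.ι) ?_
      fun β' _ _ => relContractible_of_isTrivialFibration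
        (isTrivialFibration_relMap hp hX.isLocal_squareFaces hY.isLocal_squareFaces) _ _
    refine h₁.relContractible_faces (θ := SimplexCategory.δ (1 : Fin 4)) (by decide) (by decide)
      (by decide) _ _ _ (SSet.stdSimplex.δ 1 ≫ b₃) ?_ ?_
    · rw [Category.assoc, hb₃]; decide
    · rw [Category.assoc, hβ, δ_comp_simplexMap]
  rw [← Subcomplex.homOfLE_ι hA, ← Subcomplex.homOfLE_ι hD, ← Category.assoc] at key
  have key₁ := RelContractible.of_comp_right hp
    (j := innerHornFaces.ι) (i := Subcomplex.homOfLE hA ≫ Subcomplex.homOfLE hD) key (fun β' _ _ =>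
      relContractible_of_isTrivialFibration
        (isTrivialFibration_relMap hp hX.isLocal_innerHornFaces hY.isLocal_innerHornFaces) _ _)
    (by rw [Category.assoc, Category.assoc, hγ₁])
  have key₂ : RelContractible p (Subcomplex.homOfLE hA) (Subcomplex.homOfLE hA ≫ β)
      (Subcomplex.homOfLE hD ≫ innerHornFaces.ι ≫ γ₃) := by
    refine h₂.relContractible_faces (θ := SimplexCategory.δ (2 : Fin 4)) (by decide) (by decide)
      (by decide) _ _ _ (SSet.stdSimplex.δ 2 ≫ b₃) ?_ ?_
    · rw [Category.assoc, hb₃]; decide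
    · rw [Category.assoc, hβ, δ_comp_simplexMap]
  have h₃ := RelContractible.of_isPushout' sq (RelContractible.of_comp_left hp
    (j := Subcomplex.homOfLE hD) key₂ key₁) hγ₁.symm
  rw [haα, hγ₂] at h₃
  exact h₃ t ht₁ ht₂

end

end SimplicialSpace

/-! ### CoCartesian morphisms and homotopy equivalences -/

namespace SimplicialSpace

open MonoidalCategory CartesianMonoidalCategory HomotopicalAlgebra SSet
open SSet.modelCategoryQuillen

variable {X Y : SimplicialSpace.{u}}

lemma map_map_app {a b b' c : ℕ} {θ : ⦋a⦌ ⟶ ⦋b⦌} {η : ⦋b⦌ ⟶ ⦋c⦌} {θ' : ⦋a⦌ ⟶ ⦋b'⦌}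
    {η' : ⦋b'⦌ ⟶ ⦋c⦌} (h : θ ≫ η = θ' ≫ η') {l : SimplexCategoryᵒᵖ} (ν : (X _⦋c⦌).obj l) :
    (X.map θ.op).app l ((X.map η.op).app l ν) = (X.map θ'.op).app l ((X.map η'.op).app l ν) := by
  have : X.map η.op ≫ X.map θ.op = X.map η'.op ≫ X.map θ'.op := by
    rw [← X.map_comp, ← X.map_comp, ← op_comp, ← op_comp, h]
  exact ConcreteCategory.congr_hom (congr_app this l) ν

lemma map_map_app_self {a b : ℕ} {θ : ⦋a⦌ ⟶ ⦋b⦌} {η : ⦋b⦌ ⟶ ⦋a⦌} (h : θ ≫ η = 𝟙 _)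
    {l : SimplexCategoryᵒᵖ} (ν : (X _⦋a⦌).obj l) :
    (X.map θ.op).app l ((X.map η.op).app l ν) = ν := by
  have : X.map η.op ≫ X.map θ.op = 𝟙 _ := by
    rw [← X.map_comp, ← op_comp, h]; exact X.map_id _
  exact ConcreteCategory.congr_hom (congr_app this l) ν

lemma map_app_naturality (p : X ⟶ Y) {a b : ℕ} (θ : ⦋a⦌ ⟶ ⦋b⦌) {l : SimplexCategoryᵒᵖ}
    (ν : (X _⦋b⦌).obj l) :
    (p.app (op ⦋a⦌)).app l ((X.map θ.op).app l ν) = (Y.map θ.op).app l ((p.app (op ⦋b⦌)).app l ν) :=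
  ConcreteCategory.congr_hom (congr_app (p.naturality θ.op) l) ν

lemma horn_two_two_ι₀₂_ι : horn₂₂.ι₀₂.{u} ≫ Λ[2, 2].ι = SSet.stdSimplex.δ 1 := horn.ι_ι _ _ _

lemma horn_two_two_ι₁₂_ι : horn₂₂.ι₁₂.{u} ≫ Λ[2, 2].ι = SSet.stdSimplex.δ 0 := horn.ι_ι _ _ _

/-- Restriction of triangles to a horn is a Kan fibration, so a triangle can be dragged along
compatible paths of two of its edges. -/
lemma exists_cell_lift (hX : IsReedyFibrant X) {Λ : (Δ[2] : SSet.{u}).Subcomplex} {k k' : Fin 2}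
    {i₀ i₁ : Δ[1] ⟶ (Λ : SSet.{u})} {a b : Fin 3}
    (sq : IsPushout (SSet.stdSimplex.δ k) (SSet.stdSimplex.δ k') i₀ i₁)
    (h₀ : i₀ ≫ Λ.ι = SSet.stdSimplex.δ a) (h₁ : i₁ ≫ Λ.ι = SSet.stdSimplex.δ b)
    (ν : (X _⦋2⦌) _⦋0⦌) (e e' : (X _⦋1⦌) _⦋1⦌)
    (he : (X.δ (n := 0) k).app _ e = (X.δ (n := 0) k').app _ e')
    (he₀ : (X _⦋1⦌).δ 1 e = (X.δ (n := 1) a).app _ ν)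
    (he₁ : (X _⦋1⦌).δ 1 e' = (X.δ (n := 1) b).app _ ν) :
    ∃ ν' : (X _⦋2⦌) _⦋0⦌, (X.δ (n := 1) a).app _ ν' = (X _⦋1⦌).δ 0 e ∧
      (X.δ (n := 1) b).app _ ν' = (X _⦋1⦌).δ 0 e' := by
  have w : SSet.stdSimplex.δ k ≫ SSet.yonedaEquiv (X := row X (op ⦋1⦌)).symm e =
      SSet.stdSimplex.δ k' ≫ SSet.yonedaEquiv (X := row X (op ⦋1⦌)).symm e' := by
    refine (yonedaEquiv_symm_naturality_left (X := row X (op ⦋1⦌)) (SimplexCategory.δ k) e).trans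
      (Eq.trans ?_ (yonedaEquiv_symm_naturality_left (X := row X (op ⦋1⦌))
        (SimplexCategory.δ k') e').symm)
    exact congr_arg _ he
  have hE₀ := sq.inl_desc _ _ w
  have hE₁ := sq.inr_desc _ _ w
  generalize sq.desc _ _ w = E at hE₀ hE₁
  have r : ∀ (f : (X _⦋1⦌) _⦋1⦌) (i : Fin 2), SSet.yonedaEquiv (X := row X (op ⦋1⦌)).symm f ≫
      rowMap X (SimplexCategory.δ i).op = simplexMap ((X _⦋1⦌).δ i f) := fun f i =>
    yonedaEquiv_symm_comp (X := row X (op ⦋1⦌)) (Y := points X) f (rowMap X (SimplexCategory.δ i).op)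
  obtain ⟨E', hE', hE''⟩ := (hX.isKanFibration_restrict Λ.ι).exists_edge_lift (simplexMap ν) E (by
    change E ≫ rowMap X (SimplexCategory.δ 1).op = Λ.ι ≫ simplexMap ν
    refine sq.hom_ext ?_ ?_
    · rw [← Category.assoc, hE₀, r, he₀, ← Category.assoc, h₀, δ_comp_simplexMap]
    · rw [← Category.assoc, hE₁, r, he₁, ← Category.assoc, h₁, δ_comp_simplexMap])
  change Λ.ι ≫ (show Δ[2] ⟶ row X (op ⦋1⦌) from E') = E at hE''
  obtain ⟨ν', hν'⟩ := exists_simplexMap ((show Δ[2] ⟶ row X (op ⦋1⦌) from E') ≫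
    rowMap X (SimplexCategory.δ 0).op)
  refine ⟨ν', simplexMap_injective ?_, simplexMap_injective ?_⟩
  · rw [← δ_comp_simplexMap, hν', ← h₀, ← r, ← hE₀, ← hE'']; rfl
  · rw [← δ_comp_simplexMap, hν', ← h₁, ← r, ← hE₁, ← hE'']; rfl

lemma homotopicMor_idMor (x : Obj X) : HomotopicMor x x (idMor x) (idMor x) :=
  ⟨(X _⦋1⦌).σ (n := 0) 0 (idMor x), (homSpace X x x).map _ (idMor_mem_homSpace x),
    ConcreteCategory.congr_hom ((X _⦋1⦌).δ_comp_σ_succ (i := 0)) (idMor x),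
    ConcreteCategory.congr_hom ((X _⦋1⦌).δ_comp_σ_self (i := 0)) (idMor x)⟩

lemma isHoEquiv_of_cells {f : Mor X} {ν ν' : (X _⦋2⦌) _⦋0⦌} (h₂ : (X.δ (n := 1) 2).app _ ν = f)
    (h₁ : (X.δ (n := 1) 1).app _ ν = idMor (source f)) (h₀ : (X.δ (n := 1) 0).app _ ν' = f)
    (h₁' : (X.δ (n := 1) 1).app _ ν' = idMor (target f)) : IsHoEquiv f := by
  refine ⟨⟨(X.δ (n := 1) 0).app _ ν, ⟨mem_fiber_zero_iff.2 ?_, mem_fiber_zero_iff.2 ?_⟩, _,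
    ⟨ν, h₂, rfl, h₁⟩, homotopicMor_idMor _⟩, (X.δ (n := 1) 2).app _ ν',
    ⟨mem_fiber_zero_iff.2 ?_, mem_fiber_zero_iff.2 ?_⟩, _,
    ⟨ν', rfl, h₀, h₁'⟩, homotopicMor_idMor _⟩
  · rw [← h₂]
    exact map_map_app (θ := SimplexCategory.δ 1) (η := SimplexCategory.δ 0)
      (θ' := SimplexCategory.δ 0) (η' := SimplexCategory.δ 2) (by decide) ν
  · refine Eq.trans ?_ (target_idMor (source f))
    rw [← h₁]
    exact map_map_app (θ := SimplexCategory.δ 0) (η := SimplexCategory.δ 0)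
      (θ' := SimplexCategory.δ 0) (η' := SimplexCategory.δ 1) (by decide) ν
  · refine Eq.trans ?_ (source_idMor (target f))
    rw [← h₁']
    exact map_map_app (θ := SimplexCategory.δ 1) (η := SimplexCategory.δ 2)
      (θ' := SimplexCategory.δ 1) (η' := SimplexCategory.δ 1) (by decide) ν'
  · rw [← h₀]
    exact map_map_app (θ := SimplexCategory.δ 0) (η := SimplexCategory.δ 2)
      (θ' := SimplexCategory.δ 1) (η' := SimplexCategory.δ 0) (by decide) ν'

lemma isHoEquiv_of_joined (hX : IsReedyFibrant X) {f : Mor X} {x : Obj X}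
    (h : Joined f (idMor x)) : IsHoEquiv f := by
  obtain ⟨e, he₁, rfl⟩ := h.symm (isKan_obj hX 1)
  have hν₀ : (X.δ (n := 1) 0).app _ ((X.σ (n := 1) 0).app _ (idMor x)) = idMor x :=
    map_map_app_self (by decide) _
  have hν₁ : (X.δ (n := 1) 1).app _ ((X.σ (n := 1) 0).app _ (idMor x)) = idMor x :=
    map_map_app_self (by decide) _
  have hν₂ : (X.δ (n := 1) 2).app _ ((X.σ (n := 1) 0).app _ (idMor x)) = idMor x :=
    (map_map_app (θ := SimplexCategory.δ 2) (η := SimplexCategory.σ 0)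
      (θ' := SimplexCategory.σ 0) (η' := SimplexCategory.δ 1) (by decide) (idMor x)).trans
      (congr_arg ((X.σ 0).app (op ⦋0⦌)) (source_idMor x))
  have key : ∀ (k : Fin 2) (i : Fin 2), (X _⦋1⦌).δ i ((X.σ (n := 0) 0).app _ ((X.δ k).app _ e)) =
      (X.σ (n := 0) 0).app _ ((X.δ k).app _ ((X _⦋1⦌).δ i e)) := fun k i =>
    (NatTrans.naturality_apply (X.δ k ≫ X.σ (n := 0) 0) (SimplexCategory.δ i).op e).symm
  -- The degenerate triangle on the identity of `x` is dragged along the path to `f` on 01 and along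
  -- the identities of the moving source on 02, producing a left inverse. The outer horn Λ[2,2]
  -- similarly gives a right inverse.
  obtain ⟨ν, h₂, h₁⟩ := exists_cell_lift hX horn₂₀.isPushout horn_two_zero_ι₀₁_ι
    horn_two_zero_ι₀₂_ι ((X.σ (n := 1) 0).app _ (idMor x)) e
    ((X.σ (n := 0) 0).app _ ((X.δ 1).app _ e)) (map_map_app_self (by decide) _).symm
    (he₁.trans hν₂.symm) (by
      rw [key, he₁, hν₁]
      exact congr_arg ((X.σ 0).app (op ⦋0⦌)) (source_idMor x))
  obtain ⟨ν', h₁', h₀⟩ := exists_cell_lift hX horn₂₂.isPushout horn_two_two_ι₀₂_ι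
    horn_two_two_ι₁₂_ι ((X.σ (n := 1) 0).app _ (idMor x))
    ((X.σ (n := 0) 0).app _ ((X.δ 0).app _ e)) e (map_map_app_self (by decide) _)
    (by
      rw [key, he₁, hν₁]
      exact congr_arg ((X.σ 0).app (op ⦋0⦌)) (target_idMor x)) (he₁.trans hν₀.symm)
  rw [key] at h₁ h₁'
  exact isHoEquiv_of_cells h₂ h₁ h₀ h₁'

/-- In a complete Segal space, the homotopy equivalences are the morphisms which are joined to
identities. -/
lemma isHoEquiv_iff (hX : IsCSS X) {f : Mor X} : IsHoEquiv f ↔ ∃ x, Joined f (idMor x) := by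
  refine ⟨fun h => ?_, fun ⟨x, hx⟩ => isHoEquiv_of_joined hX.reedyFibrant hx⟩
  obtain ⟨⟨g, hg⟩, -⟩ := isEquivalence_iff.1 hX.complete
  let f' : (hoEquivSpace X : SSet.{u}) _⦋0⦌ := ⟨f, mem_fullSubcomplex_zero.2 h⟩
  have := (hg.joined f').map (hoEquivSpace X).ι
  exact ⟨g.app _ f', this.symm (isKan_obj hX.reedyFibrant 1)⟩

lemma isInvariant_isHoEquiv (hX : IsCSS X) : IsInvariant (K := X _⦋1⦌) IsHoEquiv := by
  refine isInvariant_of_forward (isKan_obj hX.reedyFibrant 1) fun f g h => ?_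
  rw [isHoEquiv_iff hX, isHoEquiv_iff hX]
  exact fun ⟨x, hx⟩ => ⟨x, h.trans (isKan_obj hX.reedyFibrant 1) hx⟩

lemma IsHoEquiv.isCoCart {p : X ⟶ Y} (hp : IsReedyFibration p) (hX : IsCSS X) (hY : IsSegal Y)
    {f : Mor X} (hf : IsHoEquiv f) : IsCoCart p f := by
  obtain ⟨x, hx⟩ := (isHoEquiv_iff hX).1 hf
  exact (isInvariant_isCoCart hp hX.reedyFibrant hY.reedyFibrant hx).2
    (isCoCart_idMor hp hX.toIsSegal hY x)

/-- Composition with an identity. -/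
lemma IsSegal.joined_of_idMor (hX : IsSegal X) {ν : (X _⦋2⦌) _⦋0⦌} {z : Obj X}
    (h : (X.δ (n := 1) 0).app _ ν = idMor z) :
    Joined ((X.δ (n := 1) 2).app _ ν) ((X.δ (n := 1) 1).app _ ν) := by
  set f := (X.δ (n := 1) 2).app _ ν with hf
  let ν' : (X _⦋2⦌) _⦋0⦌ := (X.σ (n := 1) 1).app _ f
  have h₂ : (X.δ (n := 1) 2).app _ ν' = f := map_map_app_self (by decide) f
  have h₁ : (X.δ (n := 1) 1).app _ ν' = f := map_map_app_self (by decide) f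
  have h₀ : (X.δ (n := 1) 0).app _ ν' = idMor z := by
    refine (map_map_app (θ := SimplexCategory.δ 0) (η := SimplexCategory.σ 1)
      (θ' := SimplexCategory.σ 0) (η' := SimplexCategory.δ 0) (by decide) f).trans
        (congr_arg ((X.σ 0).app (op ⦋0⦌)) ?_)
    refine Eq.trans ?_ (source_idMor z)
    rw [← h]
    exact map_map_app (θ := SimplexCategory.δ 0) (η := SimplexCategory.δ 2)
      (θ' := SimplexCategory.δ 1) (η' := SimplexCategory.δ 0) (by decide) ν
  -- The degenerate triangle `ν'` and `ν` agree on the inner horn, and the space of extensions of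
  -- that horn is contractible.
  have : Joined (K := mapSpace Δ[2] X) (simplexMap ν') (simplexMap ν) := by
    refine (hX.isLocal_horn.contractibleAt (Λ[2, 1].ι ≫ simplexMap ν)).joined ?_ rfl
    change Λ[2, 1].ι ≫ simplexMap ν' = _
    refine horn₂₁.isPushout.hom_ext ?_ ?_
    · rw [← Category.assoc, ← Category.assoc, horn_two_one_ι₀₁_ι, δ_comp_simplexMap,
        δ_comp_simplexMap, h₂]
    · rw [← Category.assoc, ← Category.assoc, horn_two_one_ι₁₂_ι, δ_comp_simplexMap,
        δ_comp_simplexMap, h₀, h]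
  have := (joined_of_simplexMap this).map (X.δ (n := 1) 1)
  rwa [h₁] at this

/-- The edge 12 is joined to an identity, and the triangle can be dragged along this path. At its
end the edges 01 and 02 are joined, so the original edge 01 is joined to the identity on 02. -/
lemma IsCSS.isHoEquiv_of_cell (hX : IsCSS X) {ν : (X _⦋2⦌) _⦋0⦌} {x : Obj X}
    (h₁ : (X.δ (n := 1) 1).app _ ν = idMor x) (h₀ : IsHoEquiv ((X.δ (n := 1) 0).app _ ν)) :
    IsHoEquiv ((X.δ (n := 1) 2).app _ ν) := by
  have hK := isKan_obj hX.reedyFibrant 1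
  obtain ⟨z, e, he₁, he₀⟩ := (isHoEquiv_iff hX).1 h₀
  have hq : IsKanFibration (X.δ (n := 1) 0) := by
    have := hX.reedyFibrant.isKanFibration_restrict (SSet.stdSimplex.{u}.δ (0 : Fin 3))
    have e : X.δ (n := 1) 0 = (evIso X 2).inv ≫ restrict (SSet.stdSimplex.{u}.δ (0 : Fin 3)) X ≫
        (evIso X 1).hom := by
      rw [← Category.assoc, evIso_inv_restrict_δ, Category.assoc, Iso.inv_hom_id, Category.comp_id]
    rw [e]
    exact (isKanFibration_of_isIso _).comp (this.comp (isKanFibration_of_isIso _))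
  obtain ⟨E, hE, hE'⟩ := hq.exists_edge_lift ν e he₁
  have hJ : Joined ν ((X _⦋2⦌).δ 0 E) := ⟨E, hE, rfl⟩
  have h : (X.δ (n := 1) 0).app _ ((X _⦋2⦌).δ 0 E) = idMor z := by
    rw [← he₀, ← hE']
    exact NatTrans.naturality_apply (X.δ (n := 1) 0) (SimplexCategory.δ 0).op E
  refine (isHoEquiv_iff hX).2 ⟨x, ?_⟩
  rw [← h₁]
  exact ((hJ.map (X.δ (n := 1) 2)).trans hK (hX.toIsSegal.joined_of_idMor h)).trans hK
    ((hJ.map (X.δ (n := 1) 1)).symm hK)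

/-- The horn with g on 01 and an identity on 02 lies under a degenerate triangle; the coCartesian
property extends it, and the edge 12 is a left inverse of g, again over an identity. -/
lemma exists_inverse_of_isCoCart {p : X ⟶ Y} {g : Mor X} {y : Obj Y} (hg : IsCoCart p g)
    (h : mapMor p g = idMor y) : ∃ ν : (X _⦋2⦌) _⦋0⦌, (X.δ (n := 1) 2).app _ ν = g ∧
      (X.δ (n := 1) 1).app _ ν = idMor (source g) ∧
      mapMor p ((X.δ (n := 1) 0).app _ ν) = idMor y := by
  have w : SSet.stdSimplex.δ (1 : Fin 2) ≫ simplexMap g =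
      SSet.stdSimplex.δ (1 : Fin 2) ≫ simplexMap (idMor (source g)) := by
    rw [δ_comp_simplexMap, δ_comp_simplexMap]
    exact congr_arg simplexMap (source_idMor (source g)).symm
  have hα₀ := horn₂₀.isPushout.inl_desc _ _ w
  have hα₁ := horn₂₀.isPushout.inr_desc _ _ w
  generalize horn₂₀.isPushout.desc _ _ w = α at hα₀ hα₁
  have hid : mapMor p (idMor (source g)) = idMor y := by
    refine (map_app_naturality p (SimplexCategory.σ 0) (source g)).trans ?_
    exact congr_arg ((Y.σ 0).app (op ⦋0⦌))
      ((source_mapMor p g).symm.trans ((congr_arg source h).trans (source_idMor y)))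
  have hν₀ : (Y.δ (n := 1) 0).app _ ((Y.σ (n := 1) 0).app _ (idMor y)) = idMor y :=
    map_map_app_self (by decide) _
  have hν₁ : (Y.δ (n := 1) 1).app _ ((Y.σ (n := 1) 0).app _ (idMor y)) = idMor y :=
    map_map_app_self (by decide) _
  have hν₂ : (Y.δ (n := 1) 2).app _ ((Y.σ (n := 1) 0).app _ (idMor y)) = idMor y :=
    (map_map_app (θ := SimplexCategory.δ 2) (η := SimplexCategory.σ 0)
      (θ' := SimplexCategory.σ 0) (η' := SimplexCategory.δ 1) (by decide) (idMor y)).trans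
      (congr_arg ((Y.σ 0).app (op ⦋0⦌)) (source_idMor y))
  obtain ⟨β, hβ, hβ'⟩ := (hg α (simplexMap ((Y.σ (n := 1) 0).app _ (idMor y))) hα₀).exists_extension
    (horn₂₀.isPushout.hom_ext (by
      rw [← Category.assoc, hα₀, ← Category.assoc, horn_two_zero_ι₀₁_ι, δ_comp_simplexMap,
        simplexMap_pointsMap, hν₂]
      exact congr_arg simplexMap h) (by
      rw [← Category.assoc, hα₁, ← Category.assoc, horn_two_zero_ι₀₂_ι, δ_comp_simplexMap,
        simplexMap_pointsMap, hν₁]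
      exact congr_arg simplexMap hid))
  obtain ⟨ν, rfl⟩ := exists_simplexMap β
  refine ⟨ν, simplexMap_injective ?_, simplexMap_injective ?_, ?_⟩
  · rw [← δ_comp_simplexMap, ← hα₀, ← hβ, ← Category.assoc, horn_two_zero_ι₀₁_ι]
  · rw [← δ_comp_simplexMap, ← hα₁, ← hβ, ← Category.assoc, horn_two_zero_ι₀₂_ι]
  · rw [simplexMap_pointsMap] at hβ'
    refine (map_app_naturality p (SimplexCategory.δ 0) ν).trans ?_
    rw [simplexMap_injective hβ']
    exact hν₀

/-- CoCartesian morphisms over identities are homotopy equivalences. -/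
lemma IsCoCart.isHoEquiv {p : X ⟶ Y} (hp : IsReedyFibration p) (hX : IsCSS X) (hY : IsSegal Y)
    {g : Mor X} {y : Obj Y} (hg : IsCoCart p g) (h : mapMor p g = idMor y) : IsHoEquiv g := by
  obtain ⟨ν, rfl, h₁, h₀⟩ := exists_inverse_of_isCoCart hg h
  -- By cancellation the left inverse is coCartesian as well, so it has a left inverse of its own;
  -- having `g` as right inverse, it is a homotopy equivalence.
  have hc : IsCoCart p ((X.δ (n := 1) 0).app _ ν) :=
    IsCoCart.of_comp hp hX.toIsSegal hY hg (by rw [h₁]; exact isCoCart_idMor hp hX.toIsSegal hY _)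
  obtain ⟨ν', h₂', h₁', -⟩ := exists_inverse_of_isCoCart hc h₀
  refine hX.isHoEquiv_of_cell h₁ (isHoEquiv_of_cells h₂' h₁' rfl (h₁.trans ?_))
  refine congr_arg idMor ((target_idMor _).symm.trans ?_)
  rw [← h₁]
  exact map_map_app (θ := SimplexCategory.δ 0) (η := SimplexCategory.δ 1)
      (θ' := SimplexCategory.δ 0) (η' := SimplexCategory.δ 0) (by decide) ν

end SimplicialSpace

namespace SimplicialSpace

open MonoidalCategory CartesianMonoidalCategory HomotopicalAlgebra SSet
open SSet.modelCategoryQuillen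

variable {X Y Z : SimplicialSpace.{u}}

/-! ### CoCartesian simplices -/

lemma map_comp_app {a b : SimplexCategory} {c : SimplexCategoryᵒᵖ} (θ : a ⟶ b) (η : b ⟶ c.unop)
    {l : SimplexCategoryᵒᵖ} (ν : (X.obj c).obj l) :
    (X.map (θ ≫ η).op).app l ν = (X.map θ.op).app l ((X.map η.op).app l ν) := by
  have : X.map (θ ≫ η).op = X.map η.op ≫ X.map θ.op := by rw [op_comp, X.map_comp]
  exact ConcreteCategory.congr_hom (congr_app this l) ν

section

variable {p : X ⟶ Y} (hp : IsReedyFibration p)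

include hp

lemma isCoCartesianSimplex_iff (hX : IsReedyFibrant X) {n : SimplexCategoryᵒᵖ}
    {σ : (X.obj n) _⦋0⦌} :
    IsCoCartesianSimplex p n σ ↔ ∀ θ : ⦋1⦌ ⟶ n.unop, IsCoCart p ((X.map θ.op).app _ σ) :=
  forall_congr' fun _ => isCoCartesianMor_iff hp hX _

lemma isInvariant_isCoCartesianSimplex (hX : IsReedyFibrant X) (hY : IsReedyFibrant Y)
    (n : SimplexCategoryᵒᵖ) : IsInvariant (K := X.obj n) (IsCoCartesianSimplex p n) := by
  intro σ τ h
  rw [isCoCartesianSimplex_iff hp hX, isCoCartesianSimplex_iff hp hX]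
  exact forall_congr' fun θ => isInvariant_isCoCart hp hX hY (h.map (X.map θ.op))

variable (hX : IsSegal X) (hY : IsSegal Y)

include hX hY

lemma isCoCart_map_const {n : ℕ} (σ : (X _⦋n⦌) _⦋0⦌) (θ : ⦋1⦌ ⟶ ⦋n⦌)
    (h : θ.toOrderHom 0 = θ.toOrderHom 1) : IsCoCart p ((X.map θ.op).app _ σ) := by
  have e : θ = SimplexCategory.σ (0 : Fin 1) ≫ SimplexCategory.const ⦋0⦌ ⦋n⦌ (θ.toOrderHom 0) := by
    ext i : 3
    match i with
    | 0 => rfl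
    | 1 => exact h.symm
  rw [e, map_comp_app (c := op ⦋n⦌)]
  exact isCoCart_idMor hp hX hY _

lemma isCoCartesianSimplex_zero (x : (X _⦋0⦌) _⦋0⦌) : IsCoCartesianSimplex p (op ⦋0⦌) x := by
  rw [isCoCartesianSimplex_iff hp hX.reedyFibrant]
  exact fun θ => isCoCart_map_const hp hX hY _ θ (Subsingleton.elim (α := Fin 1) _ _)

/-- An edge from i to j is a composite of consecutive ones, so closure under composition suffices,
by induction on j - i; edges of length zero are identities. -/
lemma isCoCartesianSimplex_iff_spine {n : ℕ} {σ : (X _⦋n⦌) _⦋0⦌} :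
    IsCoCartesianSimplex p (op ⦋n⦌) σ ↔
      ∀ i : Fin n, IsCoCart p ((X.map (SimplexCategory.mkOfSucc i).op).app _ σ) := by
  rw [isCoCartesianSimplex_iff hp hX.reedyFibrant]
  refine ⟨fun h i => h _, fun h => ?_⟩
  have key : ∀ (d : ℕ) (i j : Fin (n + 1)) (hij : i ≤ j), i.val + d = j.val →
      IsCoCart p ((X.map (SimplexCategory.mkOfLe i j hij).op).app _ σ) := by
    intro d
    induction d with
    | zero =>
      intro i j hij e
      exact isCoCart_map_const hp hX hY _ _ (Fin.ext e)
    | succ d ih =>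
      intro i j hij e
      let k : Fin n := ⟨i.val + d, by omega⟩
      have hik : i ≤ k.castSucc := Nat.le_add_right _ _
      have hkj : k.castSucc ≤ j := by
        change i.val + d ≤ j.val
        omega
      have hj : j = k.succ := Fin.ext e.symm
      let η : ⦋2⦌ ⟶ ⦋n⦌ := SimplexCategory.mkOfLeComp i k.castSucc j hik hkj
      have e₂ : SimplexCategory.δ 2 ≫ η = SimplexCategory.mkOfLe i k.castSucc hik := by
        ext x : 3
        match x with | 0 => rfl | 1 => rfl
      have e₁ : SimplexCategory.δ 1 ≫ η = SimplexCategory.mkOfLe i j hij := by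
        ext x : 3
        match x with | 0 => rfl | 1 => rfl
      have e₀ : SimplexCategory.δ 0 ≫ η = SimplexCategory.mkOfSucc k := by
        ext x : 3
        match x with | 0 => rfl | 1 => exact hj
      rw [← e₁, map_comp_app (c := op ⦋n⦌)]
      refine IsCoCart.comp hp hX hY ?_ ?_
      · have := ih i k.castSucc hik rfl
        rw [← e₂, map_comp_app (c := op ⦋n⦌)] at this
        exact this
      · have := h k
        rw [← e₀, map_comp_app (c := op ⦋n⦌)] at this
        exact this
  intro θ
  have e : θ = SimplexCategory.mkOfLe (θ.toOrderHom 0) (θ.toOrderHom 1)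
      (θ.toOrderHom.monotone (Fin.zero_le _)) := by
    ext x : 3
    match x with | 0 => rfl | 1 => rfl
  rw [e]
  have hle : (θ.toOrderHom 0).val ≤ (θ.toOrderHom 1).val := θ.toOrderHom.monotone (Fin.zero_le _)
  exact key ((θ.toOrderHom 1).val - (θ.toOrderHom 0).val) _ _ _ (by omega)

lemma isCoCartesianSimplex_one {f : Mor X} :
    IsCoCartesianSimplex p (op ⦋1⦌) f ↔ IsCoCart p f := by
  rw [isCoCartesianSimplex_iff_spine hp hX hY]
  have e : (X.map (SimplexCategory.mkOfSucc (0 : Fin 1)).op).app (op ⦋0⦌) f = f := by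
    rw [SimplexCategory.mkOfSucc_eq_id]
    exact ConcreteCategory.congr_hom (congr_app (X.map_id _) _) f
  constructor
  · intro h
    have := h 0
    rwa [e] at this
  · intro h i
    obtain rfl := Subsingleton.elim i 0
    rwa [e]

end

/-! ### Reedy fibrations -/

lemma postcomp_hom_ext {i : X ⟶ Y} (hi : ∀ n, Mono (i.app n)) {A K : SSet.{u}}
    {f g : K ⟶ mapSpace A X} (h : f ≫ postcomp A i = g ≫ postcomp A i) : f = g := by
  refine toCot_injective (SSet.hom_ext fun n => ConcreteCategory.hom_ext _ _ fun a => ?_)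
  have := ConcreteCategory.congr_hom (congr_app (congr_arg toCot h) n) a
  rw [toCot_postcomp, toCot_postcomp] at this
  have hn := hi n
  exact (cancel_mono (i.app n)).1 this

lemma exists_lift_relMap {A B K L : SSet.{u}} {p : X ⟶ Y} {i : A ⟶ B} {j : K ⟶ L}
    (h : HasLiftingProperty j (relMap p i)) (a : K ⟶ mapSpace B X) (b : L ⟶ mapSpace A X)
    (c : L ⟶ mapSpace B Y) (w : b ≫ postcomp A p = c ≫ restrict i Y)
    (w₁ : a ≫ restrict i X = j ≫ b) (w₂ : a ≫ postcomp B p = j ≫ c) :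
    ∃ l : L ⟶ mapSpace B X, j ≫ l = a ∧ l ≫ restrict i X = b ∧ l ≫ postcomp B p = c := by
  have hv₁ := pullback.lift_fst b c w
  have hv₂ := pullback.lift_snd b c w
  generalize pullback.lift b c w = v at hv₁ hv₂
  have sq : CommSq a j (relMap p i) v := ⟨by
    apply pullback.hom_ext
    · rw [Category.assoc, relMap_fst, Category.assoc, hv₁, w₁]
    · rw [Category.assoc, relMap_snd, Category.assoc, hv₂, w₂]⟩
  refine ⟨sq.lift, sq.fac_left, ?_, ?_⟩
  · rw [← relMap_fst p i, ← Category.assoc, sq.fac_right, hv₁]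
  · rw [← relMap_snd p i, ← Category.assoc, sq.fac_right, hv₂]

lemma hasLiftingProperty_relMap {A B K L : SSet.{u}} {p : X ⟶ Y} {i : A ⟶ B} {j : K ⟶ L}
    (h : ∀ (a : K ⟶ mapSpace B X) (b : L ⟶ mapSpace A X) (c : L ⟶ mapSpace B Y),
      b ≫ postcomp A p = c ≫ restrict i Y → a ≫ restrict i X = j ≫ b →
      a ≫ postcomp B p = j ≫ c →
      ∃ l : L ⟶ mapSpace B X, j ≫ l = a ∧ l ≫ restrict i X = b ∧ l ≫ postcomp B p = c) :
    HasLiftingProperty j (relMap p i) := by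
  refine ⟨fun {a v} sq => ?_⟩
  have w₁ := sq.w =≫ pullback.fst _ _
  have w₂ := sq.w =≫ pullback.snd _ _
  rw [Category.assoc, relMap_fst, Category.assoc] at w₁
  rw [Category.assoc, relMap_snd, Category.assoc] at w₂
  obtain ⟨l, h, h₁, h₂⟩ := h a (v ≫ pullback.fst _ _) (v ≫ pullback.snd _ _)
    (by rw [Category.assoc, pullback.condition, Category.assoc]) w₁ w₂
  refine ⟨⟨l, h, pullback.hom_ext ?_ ?_⟩⟩
  · rw [Category.assoc, relMap_fst, h₁]
  · rw [Category.assoc, relMap_snd, h₂]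

lemma IsReedyFibration.comp {p : X ⟶ Y} {q : Y ⟶ Z} (hp : IsReedyFibration p)
    (hq : IsReedyFibration q) : IsReedyFibration (p ≫ q) := by
  rw [isReedyFibration_iff] at *
  refine fun n m k => hasLiftingProperty_relMap fun a b c w w₁ w₂ => ?_
  obtain ⟨l₁, h₁, h₁', h₁''⟩ := exists_lift_relMap (hq n m k) (a ≫ postcomp _ p)
    (b ≫ postcomp _ p) c w (w₁ =≫ postcomp _ p) w₂
  obtain ⟨l₂, h₂, h₂', h₂''⟩ := exists_lift_relMap (hp n m k) a b l₁ h₁'.symm w₁ h₁.symm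
  exact ⟨l₂, h₂, h₂', (h₂'' =≫ postcomp _ q).trans h₁''⟩

lemma IsReedyFibration.isReedyFibrant {p : X ⟶ Y} (hp : IsReedyFibration p)
    (hY : IsReedyFibrant Y) : IsReedyFibrant X := by
  intro n
  rw [← relMap_fst p]
  exact (hp.isKanFibration_relMap _).comp
    (isKanFibration_of_isPullback (IsPullback.of_hasPullback _ _).flip
      (hY.isKanFibration_restrict _))

/-! ### Reedy fibrancy of LFib -/

section LFib

variable {p : X ⟶ Y} (hp : IsReedyFibration p) (hX : IsReedyFibrant X) (hY : IsReedyFibrant Y)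

lemma mono_LFib_ι (p : X ⟶ Y) (n : SimplexCategoryᵒᵖ) : Mono ((LFib.ι p).app n) :=
  inferInstanceAs (Mono (Subcomplex.ι _))

include hp hX hY

/-- The inclusion of `LFib` is a Reedy fibration. -/
lemma isReedyFibration_LFib_ι : IsReedyFibration (LFib.ι p) := by
  rw [isReedyFibration_iff]
  refine fun n m k => hasLiftingProperty_relMap fun a b c w w₁ w₂ => ?_
  -- The inclusion is a levelwise monomorphism, so the lift is forced to be `c`. It only has to be
  -- checked that `c` takes coCartesian values, which is inherited from the vertices of the horn.
  have hr : Subcomplex.range (c ≫ (evIso X n).hom) ≤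
      fullSubcomplex (X _⦋n⦌) (IsCoCartesianSimplex p (op ⦋n⦌)) := by
    refine range_le_fullSubcomplex_of_horn (i := k)
      (isInvariant_isCoCartesianSimplex hp hX hY (op ⦋n⦌)) _ fun x => ?_
    have e : Λ[m + 1, k].ι ≫ c ≫ (evIso X n).hom =
        (a ≫ (evIso (LFib p) n).hom) ≫ (LFib.ι p).app (op ⦋n⦌) := by
      rw [← Category.assoc, ← w₂, Category.assoc, postcomp_evIso, Category.assoc]
    have e' := ConcreteCategory.congr_hom (congr_app e (op ⦋0⦌)) x
    have := mem_fullSubcomplex_zero.1 ((a ≫ (evIso (LFib p) n).hom).app (op ⦋0⦌) x).2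
    exact e'.symm ▸ this
  let l : Δ[m + 1] ⟶ (LFib p) _⦋n⦌ := Subcomplex.lift _ hr
  have hl : l ≫ (LFib.ι p).app (op ⦋n⦌) = c ≫ (evIso X n).hom := rfl
  have hl' : (l ≫ (evIso (LFib p) n).inv) ≫ postcomp Δ[n] (LFib.ι p) = c := by
    rw [Category.assoc, evIso_inv_postcomp, ← Category.assoc, hl, Category.assoc, Iso.hom_inv_id,
      Category.comp_id]
  refine ⟨l ≫ (evIso (LFib p) n).inv, postcomp_hom_ext (mono_LFib_ι p) ?_,
    postcomp_hom_ext (mono_LFib_ι p) ?_, hl'⟩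
  · rw [Category.assoc, hl', w₂]
  · rw [Category.assoc, restrict_postcomp, ← Category.assoc, hl', w]

lemma isReedyFibration_LFib_proj : IsReedyFibration (LFib.proj p) :=
  (isReedyFibration_LFib_ι hp hX hY).comp hp

lemma isReedyFibrant_LFib : IsReedyFibrant (LFib p) :=
  (isReedyFibration_LFib_ι hp hX hY).isReedyFibrant hX

end LFib

end SimplicialSpace

namespace SSet

lemma exists_iso_of_range {A B : SSet.{u}} (m : A ⟶ B) [Mono m] {S : B.Subcomplex}
    (h : Subcomplex.range m = S) : ∃ e : A ≅ (S : SSet.{u}), e.hom ≫ S.ι = m := by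
  subst h
  exact ⟨asIso (Subcomplex.toRange m), rfl⟩

lemma IsEquivalence.of_iso {K L K' L' : SSet.{u}} {f : K ⟶ L} (h : IsEquivalence f) {f' : K' ⟶ L'}
    (e : K' ≅ K) (e' : L' ≅ L) (w : f' ≫ e'.hom = e.hom ≫ f) : IsEquivalence f' := by
  have := h.iso_comp_iso e e'.symm
  rwa [Iso.symm_hom, ← Category.assoc, ← w, Category.assoc, Iso.hom_inv_id, Category.comp_id] at this

end SSet

namespace SimplicialSpace

open MonoidalCategory CartesianMonoidalCategory HomotopicalAlgebra SSet
open SSet.modelCategoryQuillen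

variable {X Y : SimplicialSpace.{u}}

/-! ### Segal maps -/

/-- The `i`-th arrow of a path. -/
def arrowMap (X : SimplicialSpace.{u}) {n : ℕ} (i : Fin n) : pathSpace X n ⟶ X _⦋1⦌ where
  app l := TypeCat.ofHom fun γ : (row X l).Path n => γ.arrow i
  naturality _ _ _ := rfl

/-- The map induced on spaces of paths. -/
def pathSpaceMap (p : X ⟶ Y) (n : ℕ) : pathSpace X n ⟶ pathSpace Y n where
  app l := TypeCat.ofHom fun γ : (row X l).Path n => γ.map (rowHom p l)
  naturality l m φ := by
    refine ConcreteCategory.hom_ext _ _ fun (γ : (row X l).Path n) => ?_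
    refine SSet.Path.ext (funext fun i => ?_) (funext fun i => ?_)
    · exact NatTrans.naturality_apply (p.app (op ⦋0⦌)) φ (γ.vertex i)
    · exact NatTrans.naturality_apply (p.app (op ⦋1⦌)) φ (γ.arrow i)

lemma segalMap_pathSpaceMap (p : X ⟶ Y) (n : ℕ) :
    segalMap X n ≫ pathSpaceMap p n = p.app (op ⦋n⦌) ≫ segalMap Y n := by
  refine SSet.hom_ext fun l => ConcreteCategory.hom_ext _ _ fun (σ : (X _⦋n⦌).obj l) => ?_
  refine SSet.Path.ext (funext fun i => ?_) (funext fun i => ?_)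
  · exact map_app_naturality p (SimplexCategory.const ⦋0⦌ ⦋n⦌ i) σ
  · exact map_app_naturality p (SimplexCategory.mkOfSucc i) σ

lemma mono_pathSpaceMap {p : X ⟶ Y} (hp : ∀ n, Mono (p.app n)) (n : ℕ) :
    Mono (pathSpaceMap p n) := by
  have hi : ∀ m l, Function.Injective ((p.app m).app l) := fun m l => by
    have := hp m
    exact (CategoryTheory.mono_iff_injective _).1 inferInstance
  rw [NatTrans.mono_iff_mono_app]
  intro l
  rw [CategoryTheory.mono_iff_injective]
  intro γ γ' h
  refine SSet.Path.ext (funext fun i => hi _ _ ?_) (funext fun i => hi _ _ ?_)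
  · exact Path.congr_vertex h i
  · exact Path.congr_arrow h i

section

variable {p : X ⟶ Y} (hp : IsReedyFibration p)

include hp

section

variable (hX : IsSegal X) (hY : IsSegal Y)

include hX hY

/-- Every object is coCartesian, so only the arrows of a path are constrained. -/
lemma range_pathSpaceMap_LFib_ι (n : ℕ) : Subcomplex.range (pathSpaceMap (LFib.ι p) n) =
    fullSubcomplex (pathSpace X n) fun γ => ∀ i, IsCoCart p ((arrowMap X i).app _ γ) := by
  apply le_antisymm
  · rw [range_le_fullSubcomplex_iff]
    intro γ i
    exact (isCoCartesianSimplex_one hp hX hY).1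
      (mem_fullSubcomplex_zero.1 ((arrowMap (LFib p) i).app _ γ).2)
  · intro l (γ : (row X l).Path n) hγ
    have h₀ : ∀ i, γ.vertex i ∈ (fullSubcomplex (X _⦋0⦌) (IsCoCartesianSimplex p (op ⦋0⦌))).obj l :=
      fun i v => isCoCartesianSimplex_zero hp hX hY _
    have h₁ : ∀ i, γ.arrow i ∈ (fullSubcomplex (X _⦋1⦌) (IsCoCartesianSimplex p (op ⦋1⦌))).obj l :=
      fun i v => (isCoCartesianSimplex_one hp hX hY).2 (hγ v i)
    refine ⟨(⟨fun i => ⟨γ.vertex i, h₀ i⟩, fun i => ⟨γ.arrow i, h₁ i⟩, fun i => ?_, fun i => ?_⟩ :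
      (row (LFib p) l).Path n), rfl⟩
    · exact Subtype.ext (γ.arrow_src i)
    · exact Subtype.ext (γ.arrow_tgt i)

/-- `LFib` is a Segal space. -/
lemma isSegal_LFib : IsSegal (LFib p) where
  reedyFibrant := isReedyFibrant_LFib hp hX.reedyFibrant hY.reedyFibrant
  segal n hn := by
    have := mono_pathSpaceMap (mono_LFib_ι p) n
    obtain ⟨e, he⟩ := exists_iso_of_range _ (range_pathSpaceMap_LFib_ι hp hX hY n)
    -- The Segal equivalence of `X` restricts to full subcomplexes that correspond to each other,
    -- because a simplex is coCartesian when its spine is.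
    have : IsEquivalence (segalMap (LFib p) n ≫ e.hom) := IsEquivalence.full (hX.segal n hn) (P := IsCoCartesianSimplex p (op ⦋n⦌))
      (Q := fun γ => ∀ i, IsCoCart p ((arrowMap X i).app _ γ))
      (fun σ => isCoCartesianSimplex_iff_spine hp hX hY)
      (fun γ γ' h => forall_congr' fun i => isInvariant_isCoCart hp hX.reedyFibrant
        hY.reedyFibrant (h.map (arrowMap X i)))
      (f' := segalMap (LFib p) n ≫ e.hom)
      ((segalMap (LFib p) n ≫= he).trans (segalMap_pathSpaceMap (LFib.ι p) n))
    exact this.of_iso (Iso.refl _) e (Category.id_comp _).symm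

end

/-! ### Completeness -/

omit hp in
lemma mem_homSpace_map {x y : Obj X} {l : SimplexCategoryᵒᵖ} {τ : (X _⦋1⦌).obj l}
    (h : τ ∈ (homSpace X x y).obj l) :
    (p.app (op ⦋1⦌)).app l τ ∈ (homSpace Y (mapObj p x) (mapObj p y)).obj l :=
  ((homSpaceMap p x y).app l ⟨τ, h⟩).2

omit hp in
lemma mapMor_idMor (x : Obj X) : mapMor p (idMor x) = idMor (mapObj p x) :=
  map_app_naturality p (SimplexCategory.σ 0) x

omit hp in
lemma HomotopicMor.map {x y : Obj X} {f g : Mor X} (h : HomotopicMor x y f g) :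
    HomotopicMor (mapObj p x) (mapObj p y) (mapMor p f) (mapMor p g) := by
  obtain ⟨γ, hγ, rfl, rfl⟩ := h
  exact ⟨_, mem_homSpace_map hγ,
    (NatTrans.naturality_apply (p.app (op ⦋1⦌)) (SimplexCategory.δ 1).op γ).symm,
    (NatTrans.naturality_apply (p.app (op ⦋1⦌)) (SimplexCategory.δ 0).op γ).symm⟩

omit hp in
lemma IsComposition.map {f g k : Mor X} (h : IsComposition f g k) :
    IsComposition (mapMor p f) (mapMor p g) (mapMor p k) := by
  obtain ⟨ν, rfl, rfl, rfl⟩ := h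
  exact ⟨_, (map_app_naturality p (SimplexCategory.δ 2) ν).symm,
    (map_app_naturality p (SimplexCategory.δ 0) ν).symm,
    (map_app_naturality p (SimplexCategory.δ 1) ν).symm⟩

omit hp in
lemma IsHoEquiv.map {f : Mor X} (h : IsHoEquiv f) (p : X ⟶ Y) : IsHoEquiv (mapMor p f) := by
  have hs : source (mapMor p f) = mapObj p (source f) := source_mapMor p f
  have ht : target (mapMor p f) = mapObj p (target f) :=
    (map_app_naturality p (SimplexCategory.δ 0) f).symm
  obtain ⟨⟨g, hg, k, hk, hk'⟩, g', hg', k', hk₁, hk₁'⟩ := h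
  unfold IsHoEquiv
  rw [hs, ht]
  refine ⟨⟨_, mem_homSpace_map hg, _, hk.map, ?_⟩, _, mem_homSpace_map hg', _, hk₁.map, ?_⟩
  · rw [← mapMor_idMor]
    exact hk'.map
  · rw [← mapMor_idMor]
    exact hk₁'.map

variable (hX : IsCSS X) (hY : IsSegal Y)

include hX hY

/-- A path in X_1 from f to an identity stays among coCartesian morphisms. It thus exhibits f as an
equivalence in LFib, using only that LFib is Reedy fibrant and not its completeness, which is still
to be shown. -/
lemma isHoEquiv_LFib_iff {f : Mor (LFib p)} :
    IsHoEquiv f ↔ IsHoEquiv (mapMor (LFib.ι p) f) := by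
  refine ⟨fun h => h.map _, fun h => ?_⟩
  obtain ⟨x, e, he₁, he₀⟩ := (isHoEquiv_iff hX).1 h
  obtain ⟨e', he'₁, rfl⟩ := (isKanFibration_fullSubcomplex_ι
    (isInvariant_isCoCartesianSimplex hp hX.reedyFibrant hY.reedyFibrant
      (op ⦋1⦌))).exists_edge_lift f e he₁
  let x' : Obj (LFib p) := ⟨x, mem_fullSubcomplex_zero.2
    (isCoCartesianSimplex_zero hp hX.toIsSegal hY x)⟩
  refine isHoEquiv_of_joined (isReedyFibrant_LFib hp hX.reedyFibrant hY.reedyFibrant) (x := x')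
    ⟨e', he'₁, Subtype.ext he₀⟩

/-- Homotopy equivalences are coCartesian, so passing to LFib loses none of them. -/
lemma range_hoEquivSpace_LFib :
    Subcomplex.range ((hoEquivSpace (LFib p)).ι ≫ (LFib.ι p).app (op ⦋1⦌)) = hoEquivSpace X := by
  apply le_antisymm
  · refine range_le_fullSubcomplex_iff.2 fun f => ?_
    exact (isHoEquiv_LFib_iff hp hX hY).1 (mem_fullSubcomplex_zero.1 f.2)
  · intro l τ hτ
    have h₁ : τ ∈ (fullSubcomplex (X _⦋1⦌) (IsCoCartesianSimplex p (op ⦋1⦌))).obj l := fun v =>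
      (isCoCartesianSimplex_one hp hX.toIsSegal hY).2 ((hτ v).isCoCart hp hX hY)
    exact ⟨⟨⟨τ, h₁⟩, fun v => (isHoEquiv_LFib_iff hp hX hY).2 (hτ v)⟩, rfl⟩

lemma range_LFib_ι_zero :
    Subcomplex.range ((LFib.ι p).app (op ⦋0⦌)) = ⊤ := by
  refine top_le_iff.1 fun l x _ => ?_
  exact ⟨⟨x, fun v => isCoCartesianSimplex_zero hp hX.toIsSegal hY _⟩, rfl⟩

/-- `LFib` is a complete Segal space. -/
lemma isCSS_LFib : IsCSS (LFib p) where
  toIsSegal := isSegal_LFib hp hX.toIsSegal hY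
  complete := by
    have h₀ := mono_LFib_ι p (op ⦋0⦌)
    have h₁ := mono_LFib_ι p (op ⦋1⦌)
    obtain ⟨e₀, he₀⟩ := exists_iso_of_range _ (range_LFib_ι_zero hp hX hY)
    have hm : Mono ((hoEquivSpace (LFib p)).ι ≫ (LFib.ι p).app (op ⦋1⦌)) := mono_comp _ _
    obtain ⟨e₁, he₁⟩ := exists_iso_of_range _ (range_hoEquivSpace_LFib hp hX hY)
    refine hX.complete.of_iso (e₀ ≪≫ Subcomplex.topIso _) e₁ ?_
    rw [← cancel_mono (hoEquivSpace X).ι, Category.assoc, he₁]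
    exact ((LFib.ι p).naturality (SimplexCategory.σ (n := 0) 0).op).trans (he₀.symm =≫ X.σ 0)

end

end SimplicialSpace

namespace SSet

open HomotopicalAlgebra modelCategoryQuillen

/-- The base change of q to Z is a trivial fibration, and a section of it gives the lift. -/
lemma IsKanFibration.exists_lift_of_forall_contractibleAt {E B Z : SSet.{u}} {q : E ⟶ B}
    (hq : IsKanFibration q) (v : Z ⟶ B) (h : ∀ z : Z _⦋0⦌, ContractibleAt q (v.app _ z)) :
    ∃ w : Z ⟶ E, w ≫ q = v := by
  have sq := IsPullback.of_hasPullback q v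
  obtain ⟨s, hs, -⟩ := ((isKanFibration_of_isPullback sq hq).isTrivialFibration_of_contractibleAt
    fun z => (contractibleAt_iff_of_isPullback sq z).2 (h z)).exists_section
  exact ⟨s ≫ pullback.fst _ _, by
    rw [Category.assoc, pullback.condition, ← Category.assoc, hs, Category.id_comp]⟩

end SSet

/-! ### Lifting of families of morphisms and of composites -/

namespace SimplicialSpace

open MonoidalCategory CartesianMonoidalCategory HomotopicalAlgebra SSet
open SSet.modelCategoryQuillen

variable {X Y : SimplicialSpace.{u}}

lemma isKanFibration_δ (hX : IsReedyFibrant X) {n : ℕ} (i : Fin (n + 2)) :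
    IsKanFibration (X.δ i) := by
  have e : X.δ i = (evIso X (n + 1)).inv ≫ restrict (SSet.stdSimplex.{u}.δ i) X ≫
      (evIso X n).hom := by
    rw [← Category.assoc, evIso_inv_restrict_δ, Category.assoc, Iso.inv_hom_id, Category.comp_id]
  rw [e]
  exact (isKanFibration_of_isIso _).comp
    ((hX.isKanFibration_restrict _).comp (isKanFibration_of_isIso _))

section

variable {p : X ⟶ Y} (hp : IsReedyFibration p)

include hp

/-- Lifting against the comparison map of the square formed by source maps. -/
lemma exists_lift_source {K L : SSet.{u}} {j : K ⟶ L} (hj : anodyneExtensions j)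
    (a : K ⟶ X _⦋1⦌) (b : L ⟶ X _⦋0⦌) (c : L ⟶ Y _⦋1⦌) (w : b ≫ p.app (op ⦋0⦌) = c ≫ src Y)
    (w₁ : a ≫ src X = j ≫ b) (w₂ : a ≫ p.app (op ⦋1⦌) = j ≫ c) :
    ∃ l : L ⟶ X _⦋1⦌, j ≫ l = a ∧ l ≫ src X = b ∧ l ≫ p.app (op ⦋1⦌) = c := by
  obtain ⟨l, h, h₁, h₂⟩ := exists_lift_relMap
    ((hp.isKanFibration_relMap (SSet.stdSimplex.δ (1 : Fin 2))).hasLiftingProperty hj)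
    (a ≫ (evIso X 1).inv) (b ≫ (evIso X 0).inv) (c ≫ (evIso Y 1).inv) (by
      rw [Category.assoc, Category.assoc, evIso_inv_postcomp, evIso_inv_restrict_δ,
        ← Category.assoc, w, Category.assoc]) (by
      rw [Category.assoc, evIso_inv_restrict_δ, ← Category.assoc, w₁, Category.assoc]) (by
      rw [Category.assoc, evIso_inv_postcomp, ← Category.assoc, w₂, Category.assoc])
  refine ⟨l ≫ (evIso X 1).hom, ?_, ?_, ?_⟩
  · rw [← Category.assoc, h, Category.assoc, Iso.inv_hom_id, Category.comp_id]
  · rw [Category.assoc, ← restrict_δ_evIso, ← Category.assoc, h₁, Category.assoc, Iso.inv_hom_id,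
      Category.comp_id]
  · rw [Category.assoc, ← postcomp_evIso, ← Category.assoc, h₂, Category.assoc, Iso.inv_hom_id,
      Category.comp_id]

/-- Lifting along a coCartesian morphism. -/
lemma IsCoCart.exists_lift {f : Mor X} (hf : IsCoCart p f) {Z : SSet.{u}} (a : Z ⟶ X _⦋1⦌)
    (c : Z ⟶ Y _⦋2⦌) (w : a ≫ src X = const (source f)) (w₁ : a ≫ p.app (op ⦋1⦌) = c ≫ Y.δ 1)
    (w₂ : c ≫ Y.δ 2 = const (mapMor p f)) :
    ∃ l : Z ⟶ X _⦋2⦌, l ≫ X.δ 2 = const f ∧ l ≫ X.δ 1 = a ∧ l ≫ p.app (op ⦋2⦌) = c := by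
  obtain ⟨g, hg₁, hg₂⟩ := exists_mapSpace_lift horn₂₀.isPushout (const f) a (by
    rw [w]; exact const_comp _ _)
  have hg : g ≫ postcomp Λ[2, 0] p = (c ≫ (evIso Y 2).inv) ≫ restrict Λ[2, 0].ι Y := by
    apply mapSpace_hom_ext horn₂₀.isPushout
    · rw [Category.assoc, ← restrict_postcomp, ← Category.assoc, hg₁, Category.assoc,
        evIso_inv_postcomp, ← Category.assoc, const_comp, Category.assoc _ _ (restrict _ Y),
        ← restrict_comp, horn_two_zero_ι₀₁_ι, Category.assoc, evIso_inv_restrict_δ,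
        ← Category.assoc, w₂]
    · rw [Category.assoc, ← restrict_postcomp, ← Category.assoc, hg₂, Category.assoc,
        evIso_inv_postcomp, ← Category.assoc, Category.assoc _ _ (restrict _ Y),
        ← restrict_comp, horn_two_zero_ι₀₂_ι, Category.assoc c, evIso_inv_restrict_δ,
        ← Category.assoc, w₁, Category.assoc]
  have hv₁ := pullback.lift_fst _ _ hg
  have hv₂ := pullback.lift_snd _ _ hg
  generalize pullback.lift _ _ hg = v at hv₁ hv₂
  obtain ⟨l, hl⟩ := (hp.isKanFibration_relMap
    (Λ[2, 0] : (Δ[2] : SSet.{u}).Subcomplex).ι).exists_lift_of_forall_contractibleAt v fun z => by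
      refine hf _ _ ?_ _ rfl rfl
      have h₁ := ConcreteCategory.congr_hom (congr_app (hv₁ =≫ restrict horn₂₀.ι₀₁ X) (op ⦋0⦌)) z
      refine h₁.trans ((ConcreteCategory.congr_hom (congr_app hg₁ (op ⦋0⦌)) z).trans ?_)
      rw [const_evIso_inv]
      exact const_app_zero (Y := mapSpace Δ[1] X) _
  have hl₁ := hl =≫ pullback.fst _ _
  rw [Category.assoc, relMap_fst, hv₁] at hl₁
  have hl₂ := hl =≫ pullback.snd _ _
  rw [Category.assoc, relMap_snd, hv₂] at hl₂
  refine ⟨l ≫ (evIso X 2).hom, ?_, ?_, ?_⟩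
  · have := hl₁ =≫ restrict horn₂₀.ι₀₁ X
    rw [Category.assoc, ← restrict_comp, horn_two_zero_ι₀₁_ι, hg₁] at this
    rw [Category.assoc, ← restrict_δ_evIso, ← Category.assoc, this, Category.assoc,
      Iso.inv_hom_id, Category.comp_id]
  · have := hl₁ =≫ restrict horn₂₀.ι₀₂ X
    rw [Category.assoc, ← restrict_comp, horn_two_zero_ι₀₂_ι, hg₂] at this
    rw [Category.assoc, ← restrict_δ_evIso, ← Category.assoc, this, Category.assoc,
      Iso.inv_hom_id, Category.comp_id]
  · rw [Category.assoc, ← postcomp_evIso, ← Category.assoc, hl₂, Category.assoc,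
      Iso.inv_hom_id, Category.comp_id]

/-- Lifting of composites. -/
lemma IsSegal.exists_lift (hX : IsSegal X) (hY : IsSegal Y) {K L : SSet.{u}} (j : K ⟶ L) [Mono j]
    (a : K ⟶ X _⦋2⦌) (e e' : L ⟶ X _⦋1⦌) (c : L ⟶ Y _⦋2⦌)
    (w : e ≫ X.δ (n := 0) 0 = e' ≫ X.δ (n := 0) 1) (w₂ : e ≫ p.app (op ⦋1⦌) = c ≫ Y.δ 2)
    (w₀ : e' ≫ p.app (op ⦋1⦌) = c ≫ Y.δ 0) (h₂ : a ≫ X.δ 2 = j ≫ e) (h₀ : a ≫ X.δ 0 = j ≫ e')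
    (hc : a ≫ p.app (op ⦋2⦌) = j ≫ c) :
    ∃ l : L ⟶ X _⦋2⦌, j ≫ l = a ∧ l ≫ X.δ 2 = e ∧ l ≫ X.δ 0 = e' ∧ l ≫ p.app (op ⦋2⦌) = c := by
  obtain ⟨g, hg₁, hg₂⟩ := exists_mapSpace_lift horn₂₁.isPushout e e' w
  obtain ⟨l, hl, hl₁, hl₂⟩ := exists_lift_relMap (p := p) (i := Λ[2, 1].ι) (j := j)
    ((isTrivialFibration_relMap hp hX.isLocal_horn hY.isLocal_horn).hasLiftingProperty j)
    (a ≫ (evIso X 2).inv) g (c ≫ (evIso Y 2).inv) (by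
    apply mapSpace_hom_ext horn₂₁.isPushout
    · rw [Category.assoc, ← restrict_postcomp, ← Category.assoc, hg₁, Category.assoc,
        evIso_inv_postcomp, ← Category.assoc, Category.assoc _ _ (restrict _ Y),
        ← restrict_comp, horn_two_one_ι₀₁_ι, Category.assoc c, evIso_inv_restrict_δ,
        ← Category.assoc, w₂, Category.assoc]
    · rw [Category.assoc, ← restrict_postcomp, ← Category.assoc, hg₂, Category.assoc,
        evIso_inv_postcomp, ← Category.assoc, Category.assoc _ _ (restrict _ Y),
        ← restrict_comp, horn_two_one_ι₁₂_ι, Category.assoc c, evIso_inv_restrict_δ,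
        ← Category.assoc, w₀, Category.assoc]) (by
    apply mapSpace_hom_ext horn₂₁.isPushout
    · rw [Category.assoc j, hg₁, Category.assoc _ _ (restrict _ X), ← restrict_comp,
        horn_two_one_ι₀₁_ι, Category.assoc, evIso_inv_restrict_δ, ← Category.assoc, h₂,
        Category.assoc]
    · rw [Category.assoc j, hg₂, Category.assoc _ _ (restrict _ X), ← restrict_comp,
        horn_two_one_ι₁₂_ι, Category.assoc, evIso_inv_restrict_δ, ← Category.assoc, h₀,
        Category.assoc]) (by
    rw [Category.assoc, evIso_inv_postcomp, ← Category.assoc, hc, Category.assoc])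
  refine ⟨l ≫ (evIso X 2).hom, ?_, ?_, ?_, ?_⟩
  · rw [← Category.assoc, hl, Category.assoc, Iso.inv_hom_id, Category.comp_id]
  · have := hl₁ =≫ restrict horn₂₁.ι₀₁ X
    rw [Category.assoc, ← restrict_comp, horn_two_one_ι₀₁_ι, hg₁] at this
    rw [Category.assoc, ← restrict_δ_evIso, ← Category.assoc, this, Category.assoc,
      Iso.inv_hom_id, Category.comp_id]
  · have := hl₁ =≫ restrict horn₂₁.ι₁₂ X
    rw [Category.assoc, ← restrict_comp, horn_two_one_ι₁₂_ι, hg₂] at this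
    rw [Category.assoc, ← restrict_δ_evIso, ← Category.assoc, this, Category.assoc,
      Iso.inv_hom_id, Category.comp_id]
  · rw [Category.assoc, ← postcomp_evIso, ← Category.assoc, hl₂, Category.assoc,
      Iso.inv_hom_id, Category.comp_id]

end

/-! ### Homotopy equivalences -/

/-- The degeneracy s_0 is a section of the source map, and completeness makes it an equivalence. -/
lemma IsCSS.isTrivialFibration_source (hX : IsCSS X) :
    IsTrivialFibration ((hoEquivSpace X).ι ≫ src X) := by
  have hι := isKanFibration_fullSubcomplex_ι (isInvariant_isHoEquiv hX)
  have hK : IsKan (hoEquivSpace X : SSet.{u}) := hι.isKan (isKan_obj hX.reedyFibrant 1)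
  refine (hι.comp (isKanFibration_δ hX.reedyFibrant 1)).isTrivialFibration hK ?_
  obtain ⟨⟨g, hg⟩, -⟩ := isEquivalence_iff.1 hX.complete
  exact isEquivalence_of_section hK (s := toHoEquivSpace X) (X.δ_comp_σ_succ (i := 0)) hg

section

variable {p : X ⟶ Y} (hp : IsReedyFibration p) (hX : IsCSS X) (hY : IsCSS Y)

/-- The map induced on spaces of homotopy equivalences. -/
def hoEquivSpaceMap (p : X ⟶ Y) : (hoEquivSpace X : SSet.{u}) ⟶ (hoEquivSpace Y : SSet.{u}) :=
  Subcomplex.lift ((hoEquivSpace X).ι ≫ p.app (op ⦋1⦌)) (range_le_fullSubcomplex_iff.2 fun f =>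
    (mem_fullSubcomplex_zero.1 f.2).map p)

lemma hoEquivSpaceMap_ι (p : X ⟶ Y) : hoEquivSpaceMap p ≫ (hoEquivSpace Y).ι =
    (hoEquivSpace X).ι ≫ p.app (op ⦋1⦌) := rfl

lemma hoEquivSpace_source_comp (p : X ⟶ Y) : ((hoEquivSpace X).ι ≫ src X) ≫ p.app (op ⦋0⦌) =
    hoEquivSpaceMap p ≫ (hoEquivSpace Y).ι ≫ src Y :=
  (hoEquivSpace X).ι ≫= p.naturality (SimplexCategory.δ (n := 0) 1).op

include hp hX hY

lemma isTrivialFibration_hoEquivSpace :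
    IsTrivialFibration (pullback.lift _ _ (hoEquivSpace_source_comp p)) := by
  have h₁ := pullback.lift_fst _ _ (hoEquivSpace_source_comp p)
  have h₂ := pullback.lift_snd _ _ (hoEquivSpace_source_comp p)
  generalize pullback.lift _ _ (hoEquivSpace_source_comp p) = φ at h₁ h₂
  have hφ : IsKanFibration φ := by
    refine isKanFibration_iff.2 fun n i a b w => ?_
    have w₁ := w =≫ pullback.fst _ _
    have w₂ := w =≫ pullback.snd _ _
    rw [Category.assoc, h₁, Category.assoc] at w₁
    rw [Category.assoc, h₂, Category.assoc] at w₂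
    obtain ⟨l, hl, hl₁, hl₂⟩ := exists_lift_source hp (anodyneExtensions.horn_ι i)
      (a ≫ (hoEquivSpace X).ι) (b ≫ pullback.fst _ _) ((b ≫ pullback.snd _ _) ≫
        (hoEquivSpace Y).ι) (by
        rw [Category.assoc, pullback.condition, Category.assoc, Category.assoc]) w₁
        (w₂ =≫ (hoEquivSpace Y).ι)
    have hr : Subcomplex.range l ≤ hoEquivSpace X := by
      refine range_le_fullSubcomplex_of_horn (i := i) (isInvariant_isHoEquiv hX) l fun x => ?_
      have e' := ConcreteCategory.congr_hom (congr_app hl (op ⦋0⦌)) x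
      exact e'.symm ▸ mem_fullSubcomplex_zero.1 (a.app (op ⦋0⦌) x).2
    have hl' : Subcomplex.lift l hr ≫ (hoEquivSpace X).ι = l := rfl
    generalize Subcomplex.lift l hr = l' at hl'
    subst hl'
    refine ⟨l', ?_, pullback.hom_ext ?_ ?_⟩
    · rw [← cancel_mono (hoEquivSpace X).ι, Category.assoc, hl]
    · rw [Category.assoc, h₁, ← hl₁, Category.assoc]
    · rw [← cancel_mono (hoEquivSpace Y).ι, ← hl₂, Category.assoc l' φ, h₂, Category.assoc,
        hoEquivSpaceMap_ι, Category.assoc]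
  -- After projection to X_0 the map becomes the source map of equivalences of `X`; the projection
  -- is a base change of the one of `Y`. Both are trivial fibrations by completeness.
  refine hφ.isTrivialFibration_of_contractibleAt fun b => ?_
  refine ContractibleAt.of_comp_left (q₂ := pullback.fst _ _) hφ
    ((isTrivialFibration_of_isPullback (IsPullback.of_hasPullback _ _).flip
      hY.isTrivialFibration_source).contractibleAt _) ?_ rfl
  rw [h₁]
  exact hX.isTrivialFibration_source.contractibleAt _

/-- Extension of maps into homotopy equivalences. -/
lemma exists_lift_hoEquiv {K L : SSet.{u}} (j : K ⟶ L) [Mono j] (a : K ⟶ X _⦋1⦌)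
    (ha : ∀ v : K _⦋0⦌, IsHoEquiv (a.app _ v)) (b : L ⟶ X _⦋0⦌) (c : L ⟶ Y _⦋1⦌)
    (hc : ∀ v : L _⦋0⦌, IsHoEquiv (c.app _ v)) (w : b ≫ p.app (op ⦋0⦌) = c ≫ src Y)
    (w₁ : a ≫ src X = j ≫ b) (w₂ : a ≫ p.app (op ⦋1⦌) = j ≫ c) :
    ∃ l : L ⟶ X _⦋1⦌, j ≫ l = a ∧ l ≫ src X = b ∧ l ≫ p.app (op ⦋1⦌) = c ∧
      ∀ v : L _⦋0⦌, IsHoEquiv (l.app _ v) := by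
  have h₁ := pullback.lift_fst _ _ (hoEquivSpace_source_comp p)
  have h₂ := pullback.lift_snd _ _ (hoEquivSpace_source_comp p)
  have hφ := isTrivialFibration_hoEquivSpace hp hX hY
  generalize pullback.lift _ _ (hoEquivSpace_source_comp p) = φ at h₁ h₂ hφ
  obtain ⟨a, rfl⟩ : ∃ a' : K ⟶ (hoEquivSpace X : SSet.{u}), a' ≫ (hoEquivSpace X).ι = a :=
    ⟨Subcomplex.lift a (range_le_fullSubcomplex_iff.2 ha), rfl⟩
  obtain ⟨c, rfl⟩ : ∃ c' : L ⟶ (hoEquivSpace Y : SSet.{u}), c' ≫ (hoEquivSpace Y).ι = c :=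
    ⟨Subcomplex.lift c (range_le_fullSubcomplex_iff.2 hc), rfl⟩
  rw [Category.assoc] at w
  have hv₁ := pullback.lift_fst b c w
  have hv₂ := pullback.lift_snd b c w
  generalize pullback.lift b c w = v at hv₁ hv₂
  obtain ⟨l, hl, hl'⟩ := hφ.exists_lift j a v (pullback.hom_ext
    (by rw [Category.assoc, h₁, Category.assoc, hv₁, ← w₁, Category.assoc])
    (by
      rw [← cancel_mono (hoEquivSpace Y).ι, Category.assoc, Category.assoc, Category.assoc,
        Category.assoc, ← Category.assoc φ, h₂, ← Category.assoc v, hv₂, hoEquivSpaceMap_ι,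
        ← Category.assoc, w₂]))
  refine ⟨l ≫ (hoEquivSpace X).ι, ?_, ?_, ?_, fun v => mem_fullSubcomplex_zero.1 (l.app _ v).2⟩
  · rw [← Category.assoc, hl]
  · rw [Category.assoc, ← h₁, ← Category.assoc, hl', hv₁]
  · rw [Category.assoc, ← hoEquivSpaceMap_ι, ← h₂, ← Category.assoc, ← Category.assoc, hl', hv₂]

end

end SimplicialSpace

/-! ### The space of coCartesian lifts and the two implications -/

namespace SimplicialSpace

open MonoidalCategory CartesianMonoidalCategory HomotopicalAlgebra SSet
open SSet.modelCategoryQuillen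

variable {X Y : SimplicialSpace.{u}}

/-- CoCartesian lifts of a morphism with a given source form a contractible space. -/
lemma IsCoCart.exists_extension {p : X ⟶ Y} (hp : IsReedyFibration p) (hX : IsCSS X)
    (hY : IsCSS Y) {f : Mor X} (hf : IsCoCart p f) {K L : SSet.{u}} (j : K ⟶ L) [Mono j]
    (a : K ⟶ X _⦋1⦌) (ha : ∀ v : K _⦋0⦌, IsCoCart p (a.app _ v))
    (hs : a ≫ src X = const (source f)) (hq : a ≫ p.app (op ⦋1⦌) = const (mapMor p f)) :
    ∃ l : L ⟶ X _⦋1⦌, j ≫ l = a ∧ l ≫ src X = const (source f) ∧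
      l ≫ p.app (op ⦋1⦌) = const (mapMor p f) ∧ ∀ v : L _⦋0⦌, IsCoCart p (l.app _ v) := by
  have hν₂ : (Y.δ (n := 1) 2).app _ ((Y.σ (n := 1) 1).app _ (mapMor p f)) = mapMor p f :=
    ConcreteCategory.congr_hom (congr_app (Y.δ_comp_σ_succ (i := (1 : Fin 2))) (op ⦋0⦌)) _
  have hν₁ : (Y.δ (n := 1) 1).app _ ((Y.σ (n := 1) 1).app _ (mapMor p f)) = mapMor p f :=
    ConcreteCategory.congr_hom (congr_app (Y.δ_comp_σ_self (i := (1 : Fin 2))) (op ⦋0⦌)) _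
  have hν₀ : (Y.δ (n := 1) 0).app _ ((Y.σ (n := 1) 1).app _ (mapMor p f)) =
      idMor (target (mapMor p f)) :=
    ConcreteCategory.congr_hom (congr_app
      (Y.δ_comp_σ_of_le (n := 0) (i := 0) (j := 0) (by decide)) (op ⦋0⦌)) _
  generalize (Y.σ (n := 1) 1).app _ (mapMor p f) = ν at hν₂ hν₁ hν₀
  -- The family `a` of lifts factors through `f`, over the degenerate triangle with edges pf, pf and
  -- an identity. The second factors are coCartesian by cancellation and lie over an identity, so
  -- they form a family of homotopy equivalences.
  obtain ⟨m, hm₂, hm₁, hm⟩ := IsCoCart.exists_lift hp hf a (const ν) hs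
    (by rw [hq, const_comp, hν₁]) (by rw [const_comp, hν₂])
  have hmp : (m ≫ X.δ 0) ≫ p.app (op ⦋1⦌) = const (idMor (target (mapMor p f))) := by
    have h : X.δ (n := 1) 0 ≫ p.app (op ⦋1⦌) = p.app (op ⦋2⦌) ≫ Y.δ 0 :=
      p.naturality (SimplexCategory.δ (n := 1) 0).op
    rw [Category.assoc, h, ← Category.assoc, hm, const_comp, hν₀]
  have hms : (m ≫ X.δ 0) ≫ src X = const (target f) := by
    have h : X.δ (n := 1) 0 ≫ X.δ (n := 0) 1 = X.δ (n := 1) 2 ≫ X.δ (n := 0) 0 :=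
      (X.δ_comp_δ (n := 0) (i := 0) (j := 1) (by decide)).symm
    rw [Category.assoc]
    refine (m ≫= h).trans ?_
    rw [← Category.assoc, hm₂, const_comp]
  have ht : (tgt Y).app _ (mapMor p f) = mapObj p (target f) :=
    (map_app_naturality p (SimplexCategory.δ 0) f).symm
  have hme (v : K _⦋0⦌) : IsHoEquiv ((m ≫ X.δ 0).app _ v) := by
    refine IsCoCart.isHoEquiv hp hX hY.toIsSegal (y := target (mapMor p f)) ?_ ?_
    · refine IsCoCart.of_comp hp hX.toIsSegal hY.toIsSegal (ν := m.app _ v) ?_ ?_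
      · have := ConcreteCategory.congr_hom (congr_app hm₂ (op ⦋0⦌)) v
        rw [const_app_zero] at this
        exact this.symm ▸ hf
      · exact (ConcreteCategory.congr_hom (congr_app hm₁ (op ⦋0⦌)) v).symm ▸ ha v
    · have := ConcreteCategory.congr_hom (congr_app hmp (op ⦋0⦌)) v
      rwa [const_app_zero] at this
  -- Homotopy equivalences with fixed source over a fixed identity extend from `K` to `L`.
  obtain ⟨e, he, hes, hep, hee⟩ := exists_lift_hoEquiv hp hX hY j (m ≫ X.δ 0) hme
    (const (target f)) (const (idMor (target (mapMor p f))))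
    (fun v => by rw [const_app_zero]; exact isHoEquiv_idMor _)
    (by
      rw [const_comp, const_comp]
      exact congr_arg const (ht.symm.trans (source_idMor _).symm))
    (by rw [hms, comp_const]) (by rw [hmp, comp_const])
  -- Composing the extended family with `f`, relative to the composites already given on `K`, yields
  -- triangles whose edges 02 are the required lifts.
  obtain ⟨k, hk, hk₂, hk₀, hkp⟩ := IsSegal.exists_lift hp hX.toIsSegal hY.toIsSegal j m (const f) e
    (const ν) (by rw [const_comp]; exact hes.symm) (by rw [const_comp, const_comp, hν₂])
    (by rw [hep, const_comp, hν₀]) (by rw [hm₂, comp_const]) he.symm (by rw [hm, comp_const])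
  refine ⟨k ≫ X.δ 1, by rw [← Category.assoc, hk, hm₁], ?_, ?_, fun v => ?_⟩
  · have h : X.δ (n := 1) 1 ≫ X.δ (n := 0) 1 = X.δ (n := 1) 2 ≫ X.δ (n := 0) 1 :=
      X.δ_comp_δ_self (i := 1)
    rw [Category.assoc]
    refine (k ≫= h).trans ?_
    rw [← Category.assoc, hk₂, const_comp]
  · have h : X.δ (n := 1) 1 ≫ p.app (op ⦋1⦌) = p.app (op ⦋2⦌) ≫ Y.δ 1 :=
      p.naturality (SimplexCategory.δ (n := 1) 1).op
    rw [Category.assoc, h, ← Category.assoc, hkp, const_comp, hν₁]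
  · refine IsCoCart.comp hp hX.toIsSegal hY.toIsSegal (ν := k.app _ v) ?_ ?_
    · have := ConcreteCategory.congr_hom (congr_app hk₂ (op ⦋0⦌)) v
      rw [const_app_zero] at this
      exact this.symm ▸ hf
    · have := ConcreteCategory.congr_hom (congr_app hk₀ (op ⦋0⦌)) v
      exact this.symm ▸ (hee v).isCoCart hp hX hY.toIsSegal

lemma src_naturality (p : X ⟶ Y) : src X ≫ p.app (op ⦋0⦌) = p.app (op ⦋1⦌) ≫ src Y :=
  p.naturality (SimplexCategory.δ (n := 0) 1).op

lemma IsReedyFibration.isKanFibration_source {p : X ⟶ Y} (hp : IsReedyFibration p) :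
    IsKanFibration (pullback.lift _ _ (src_naturality p)) := by
  have h₁ := pullback.lift_fst _ _ (src_naturality p)
  have h₂ := pullback.lift_snd _ _ (src_naturality p)
  generalize pullback.lift _ _ (src_naturality p) = φ at h₁ h₂
  refine isKanFibration_iff.2 fun n i a b w => ?_
  have w₁ := w =≫ pullback.fst _ _
  have w₂ := w =≫ pullback.snd _ _
  rw [Category.assoc, h₁, Category.assoc] at w₁
  rw [Category.assoc, h₂, Category.assoc] at w₂
  obtain ⟨l, hl, hl₁, hl₂⟩ := exists_lift_source hp (anodyneExtensions.horn_ι i) a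
    (b ≫ pullback.fst _ _) (b ≫ pullback.snd _ _)
    (by rw [Category.assoc, pullback.condition, Category.assoc]) w₁ w₂
  refine ⟨l, hl, pullback.hom_ext ?_ ?_⟩
  · rw [Category.assoc, h₁, hl₁]
  · rw [Category.assoc, h₂, hl₂]

section

variable {p : X ⟶ Y} (hp : IsReedyFibration p) (hX : IsCSS X) (hY : IsCSS Y)

include hp hX hY

/-- The fiber over an object x and a morphism f is the space of coCartesian lifts of f starting at
x. The hypothesis gives one lift, and `IsCoCart.exists_extension` then fills all spheres. -/
lemma IsCoCartesianFibration.isTrivialFibration_source (h : IsCoCartesianFibration p) :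
    IsTrivialFibration (pullback.lift _ _ (src_naturality (LFib.proj p))) := by
  have h₁ := pullback.lift_fst _ _ (src_naturality (LFib.proj p))
  have h₂ := pullback.lift_snd _ _ (src_naturality (LFib.proj p))
  have hφ := (isReedyFibration_LFib_proj hp hX.reedyFibrant
    hY.reedyFibrant).isKanFibration_source
  generalize pullback.lift _ _ (src_naturality (LFib.proj p)) = φ at h₁ h₂ hφ
  refine hφ.isTrivialFibration_of_contractibleAt fun b n u hu => ?_
  have hb := ConcreteCategory.congr_hom (congr_app
    (pullback.condition (f := (LFib.proj p).app (op ⦋0⦌)) (g := src Y)) (op ⦋0⦌)) b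
  have hu₁ := hu =≫ pullback.fst _ _
  have hu₂ := hu =≫ pullback.snd _ _
  rw [Category.assoc, h₁, const_comp] at hu₁
  rw [Category.assoc, h₂, const_comp] at hu₂
  have m₀ := mono_LFib_ι p (op ⦋0⦌)
  obtain ⟨f, hf₁, hf₂, hf⟩ := h.exists_lift
    ((pullback.snd ((LFib.proj p).app (op ⦋0⦌)) (src Y)).app (op ⦋0⦌) b)
    (mapObj (LFib.ι p) ((pullback.fst ((LFib.proj p).app (op ⦋0⦌)) (src Y)).app (op ⦋0⦌) b)) hb
  rw [isCoCartesianMor_iff hp hX.reedyFibrant] at hf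
  obtain ⟨l, hl, hl₁, hl₂, hlc⟩ := hf.exists_extension hp hX hY ∂Δ[n].ι
    (u ≫ (LFib.ι p).app (op ⦋1⦌))
    (fun v => (isCoCartesianSimplex_one hp hX.toIsSegal hY.toIsSegal).1
      (mem_fullSubcomplex_zero.1 (u.app (op ⦋0⦌) v).2)) (by
      rw [hf₁, Category.assoc, ← src_naturality, ← Category.assoc, hu₁, const_comp]) (by
      rw [hf₂, Category.assoc]
      exact hu₂)
  have hr : Subcomplex.range l ≤ fullSubcomplex (X _⦋1⦌) (IsCoCartesianSimplex p (op ⦋1⦌)) :=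
    range_le_fullSubcomplex_iff.2 fun v =>
      (isCoCartesianSimplex_one hp hX.toIsSegal hY.toIsSegal).2 (hlc v)
  obtain ⟨l, rfl⟩ : ∃ l' : Δ[n] ⟶ LFib p _⦋1⦌, l' ≫ (LFib.ι p).app (op ⦋1⦌) = l :=
    ⟨Subcomplex.lift l hr, rfl⟩
  have m₁ := mono_LFib_ι p (op ⦋1⦌)
  refine ⟨l, ?_, pullback.hom_ext ?_ ?_⟩
  · rw [← cancel_mono ((LFib.ι p).app (op ⦋1⦌)), Category.assoc, hl]
  · rw [Category.assoc, h₁, const_comp, ← cancel_mono ((LFib.ι p).app (op ⦋0⦌)), const_comp,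
      Category.assoc, src_naturality, ← Category.assoc, hl₁, hf₁]
  · rw [Category.assoc, h₂, const_comp, ← hf₂, ← hl₂, Category.assoc]
    rfl

lemma IsCoCartesianFibration.isLeftFibration (h : IsCoCartesianFibration p) :
    IsLeftFibration (LFib.proj p) where
  css_source := isCSS_LFib hp hX hY.toIsSegal
  css_target := hY
  reedy := isReedyFibration_LFib_proj hp hX.reedyFibrant hY.reedyFibrant
  isHomotopyPullback := ⟨src_naturality _,
    (IsCoCartesianFibration.isTrivialFibration_source hp hX hY h).isEquivalence⟩

/-- The comparison map of the source square is a Kan fibration and an equivalence, hence surjective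
on points. Since every object belongs to LFib, each lifting datum is a point of its target, and a
preimage is a coCartesian lift with exactly the prescribed source and image. -/
lemma isCoCartesianFibration_of_isLeftFibration (h : IsLeftFibration (LFib.proj p)) :
    IsCoCartesianFibration p where
  css_source := hX
  css_target := hY
  reedy := hp
  exists_lift f x hx := by
    obtain ⟨w, he⟩ := h.isHomotopyPullback
    let x' : Obj (LFib p) := ⟨x, mem_fullSubcomplex_zero.2
      (isCoCartesianSimplex_zero hp hX.toIsSegal hY.toIsSegal x)⟩
    obtain ⟨t, ht₁, ht₂⟩ := exists_simplex_of_isPullback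
      (IsPullback.of_hasPullback ((LFib.proj p).app (op ⦋0⦌)) (src Y)) x' f hx
    obtain ⟨f', rfl⟩ := h.reedy.isKanFibration_source.exists_point_of_isEquivalence he t
    have h₁ := ConcreteCategory.congr_hom (congr_app
      (pullback.lift_fst _ _ (src_naturality (LFib.proj p))) (op ⦋0⦌)) f'
    have h₂ := ConcreteCategory.congr_hom (congr_app
      (pullback.lift_snd _ _ (src_naturality (LFib.proj p))) (op ⦋0⦌)) f'
    refine ⟨mapMor (LFib.ι p) f', ?_, h₂.symm.trans ht₂, ?_⟩
    · exact congr_arg Subtype.val (h₁.symm.trans ht₁)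
    · exact (isCoCartesianMor_iff hp hX.reedyFibrant _).2
        ((isCoCartesianSimplex_one hp hX.toIsSegal hY.toIsSegal).1 (mem_fullSubcomplex_zero.1 f'.2))

end

end SimplicialSpace
theorem mainTheorem3 {C W : SimplicialSpace.{u}} (hC : SimplicialSpace.IsCSS C)
    (hW : SimplicialSpace.IsCSS W) (p : C ⟶ W) (hp : SimplicialSpace.IsReedyFibration p) :
    SimplicialSpace.IsCoCartesianFibration p ↔
      SimplicialSpace.IsLeftFibration (SimplicialSpace.LFib.proj p) :=
  ⟨SimplicialSpace.IsCoCartesianFibration.isLeftFibration hp hC hW,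
    SimplicialSpace.isCoCartesianFibration_of_isLeftFibration hp hC hW⟩
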